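/- Let $L>0$. Consider the $L$-periodic one-dimensional Hou–Luo model $$\partial_t\omega+u\,\partial_x\omega=\partial_x\theta,\qquad \partial_t\theta+u\,\partial_x\theta=0,\qquad u_x=H\omega,$$ where $H\omega(x)=\frac1L\,\mathrm{P.V.}\!\int_0^L\omega(y)\cot\!\big[\tfrac{\pi}{L}(x-y)\big]dy$ is the periodic Hilbert transform and $u$ is given by the Biot–Savart law $$u(x,t)=\frac1\pi\int_0^L\omega(y,t)\,\log\big|\sin\big[\tfrac{\pi}{L}(x-y)\big]\big|\,dy .$$ A regular solution on a time interval $I$ with data $(\omega_0,\theta_0)$ is a pair $(\omega,\theta)$ of functions on $I\times\mathbb R$, $L$-periodic in $x$, with $\omega$ of class $C^1$ and $\theta$ of class $C^2$ jointly in $(t,x)$ (one-sided in time at an endpoint belonging to $I$), which satisfies the system in the interior of $I$ and equals $(\omega_0,\theta_0)$ at $t=0$. Let $\theta_0\in C^2(\mathbb R)$ be $L$-periodic and even with $\theta_0'\ge0$ on $[0,L/2]$ and $\theta_0(L/2)>\theta_0(0)$. Then there is a finite time $T>0$, depending only on $L$ and $\theta_0$, such that for every $L$-periodic odd $\omega_0\in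 C^1(\mathbb R)$ with $\omega_0\ge0$ on $[0,L/2]$ the following hold. 1. There is no global regular solution, i.e. no regular solution on $[0,\infty)$, with data $(\omega_0,\theta_0)$. 2. There is no regular solution on $[0,T]$ with data $(\omega_0,\theta_0)$. 3. If $(\omega,\theta)$ is a regular solution on $[0,T)$ with data $(\omega_0,\theta_0)$, then $\theta$ forms a shock at $x=0$ by time $T$: $\theta(0,t)=\theta_0(0)$ for all $t\in[0,T)$, while for every $x\in(0,L/2]$ one has $\theta(x,t)-\theta(0,t)\ge\frac12\big(\theta_0(L/2)-\theta_0(0)\big)$ for all $t<T$ sufficiently close to $T$. -/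

import Mathlib

open Real Set Filter Topology MeasureTheory

/-- The velocity generated by an `L`-periodic vorticity `w` through the periodic Biot–Savart law
`u(x) = (1/π) ∫₀ᴸ w(y) log |sin (π (x - y) / L)| dy`.
Its derivative is the periodic Hilbert transform of `w`, see `HouLuo.velocity_deriv_eq_hilbert`. -/
noncomputable def HouLuo.velocity (L : ℝ) (w : ℝ → ℝ) (x : ℝ) : ℝ :=
  (1 / π) * ∫ y in (0 : ℝ)..L, w y * Real.log |Real.sin (π / L * (x - y))|

/-- The truncation at distance `ε` of the periodic Hilbert transform
`H w(x) = (1/L) P.V. ∫ w(y) cot (π (x - y) / L) dy`, the integral being over the period centred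
at `x`. The principal value is the limit as `ε → 0+`. -/
noncomputable def HouLuo.hilbertTrunc (L : ℝ) (w : ℝ → ℝ) (x ε : ℝ) : ℝ :=
  (1 / L) * ((∫ y in (x - L / 2)..(x - ε), w y * Real.cot (π / L * (x - y))) +
    ∫ y in (x + ε)..(x + L / 2), w y * Real.cot (π / L * (x - y)))

theorem HouLuo.velocity_eq_centered {L : ℝ} (hL : 0 < L) {w : ℝ → ℝ}
    (hper : Function.Periodic w L) (x : ℝ) :
    HouLuo.velocity L w x =
      (1 / π) * ∫ z in (-(L / 2))..(L / 2), w (x - z) * Real.log (Real.sin (π / L * z)) := by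
  unfold HouLuo.velocity
  congr 1
  have hp : Function.Periodic
      (fun y => w y * Real.log |Real.sin (π / L * (x - y))|) L := by
    intro y
    have : π / L * (x - (y + L)) = π / L * (x - y) - π := by
      field_simp
      ring
    simp only [hper y, this, Real.sin_sub_pi, abs_neg]
  have h1 := hp.intervalIntegral_add_eq 0 (x - L / 2)
  rw [zero_add] at h1
  rw [h1]
  have h2 := intervalIntegral.integral_comp_sub_left (a := -(L / 2)) (b := L / 2)
    (fun y => w y * Real.log |Real.sin (π / L * (x - y))|) x
  simp only [sub_sub_cancel, Real.log_abs] at h2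
  rw [h2]
  simp only [Real.log_abs]
  congr 1
  ring

theorem HouLuo.kernel_integrable {L : ℝ} (hL : 0 < L) (a b : ℝ) :
    IntervalIntegrable (fun z => Real.log (Real.sin (π / L * z))) volume a b := by
  have hc : π / L ≠ 0 := by positivity
  have h := (intervalIntegrable_log_sin (a := π / L * a) (b := π / L * b)).comp_mul_left
    (c := π / L)
  rw [mul_div_cancel_left₀ _ hc, mul_div_cancel_left₀ _ hc] at h
  exact h

theorem HouLuo.hasDerivAt_velocity {L : ℝ} (hL : 0 < L) {w : ℝ → ℝ}
    (hw : ContDiff ℝ 1 w) (hper : Function.Periodic w L) (x : ℝ) :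
    HasDerivAt (HouLuo.velocity L w)
      ((1 / π) * ∫ z in (-(L / 2))..(L / 2),
        deriv w (x - z) * Real.log (Real.sin (π / L * z))) x := by
  have hfun : HouLuo.velocity L w = fun x => (1 / π) *
      ∫ z in (-(L / 2))..(L / 2), w (x - z) * Real.log (Real.sin (π / L * z)) :=
    funext fun x => HouLuo.velocity_eq_centered hL hper x
  rw [hfun]
  refine HasDerivAt.const_mul _ ?_
  have hcw : Continuous w := hw.continuous
  have hcd : Continuous (deriv w) := hw.continuous_deriv le_rfl
  have hk := HouLuo.kernel_integrable hL (-(L / 2)) (L / 2)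
  have hk' := (intervalIntegrable_iff.mp hk).aestronglyMeasurable
  obtain ⟨M, hM⟩ := (isCompact_Icc (a := x - 1 - L / 2)
    (b := x + 1 + L / 2)).exists_bound_of_continuousOn hcd.continuousOn
  refine (intervalIntegral.hasDerivAt_integral_of_dominated_loc_of_deriv_le
    (F := fun x z => w (x - z) * Real.log (Real.sin (π / L * z)))
    (F' := fun x z => deriv w (x - z) * Real.log (Real.sin (π / L * z)))
    (s := Metric.ball x 1)
    (bound := fun z => M * ‖Real.log (Real.sin (π / L * z))‖)
    (Metric.ball_mem_nhds x one_pos) ?_ ?_ ?_ ?_ ?_ ?_).2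
  · refine Eventually.of_forall fun y => ?_
    exact (Continuous.aestronglyMeasurable (by fun_prop)).mul
      hk'
  · exact hk.continuousOn_mul (by fun_prop)
  · exact (Continuous.aestronglyMeasurable (by fun_prop)).mul
      hk'
  · refine Eventually.of_forall fun z hz y hy => ?_
    rw [uIoc_of_le (by linarith)] at hz
    rw [Metric.mem_ball, Real.dist_eq, abs_lt] at hy
    rw [norm_mul]
    refine mul_le_mul_of_nonneg_right (hM _ ⟨?_, ?_⟩) (norm_nonneg _)
    · linarith [hz.2, hy.1]
    · linarith [hz.1, hy.2]
  · exact hk.norm.const_mul M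
  · refine Eventually.of_forall fun z _ y _ => ?_
    have h1 : HasDerivAt w (deriv w (y - z)) (y - z) :=
      (hw.differentiable one_ne_zero _).hasDerivAt
    exact (h1.comp_sub_const y z).mul_const _

/-- For a continuously differentiable `L`-periodic `w`, the velocity of the Biot–Savart law
satisfies `u_x = H w` with the principal-value periodic Hilbert transform `H`. -/
theorem HouLuo.velocity_deriv_eq_hilbert {L : ℝ} (hL : 0 < L) {w : ℝ → ℝ}
    (hw : ContDiff ℝ 1 w) (hper : Function.Periodic w L) (x : ℝ) :
    DifferentiableAt ℝ (HouLuo.velocity L w) x ∧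
    Tendsto (HouLuo.hilbertTrunc L w x) (𝓝[>] 0) (𝓝 (deriv (HouLuo.velocity L w) x)) := by
  have hd := HouLuo.hasDerivAt_velocity hL hw hper x
  refine ⟨hd.differentiableAt, ?_⟩
  rw [hd.deriv]
  have hcw : Continuous w := hw.continuous
  have hcd : Continuous (deriv w) := hw.continuous_deriv le_rfl
  have hwd : ∀ y, HasDerivAt w (deriv w y) y := fun y =>
    (hw.differentiable one_ne_zero _).hasDerivAt
  have hk := fun a b => HouLuo.kernel_integrable hL a b
  set g : ℝ → ℝ := fun z => Real.log (Real.sin (π / L * z)) with hg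
  have hμ : 0 < π / L := by positivity
  -- fold the integral to the half period
  have hev : ∀ z, g (-z) = g z := by
    intro z
    simp only [hg, mul_neg, Real.sin_neg, Real.log_neg_eq_log]
  have hfold : (∫ z in (-(L / 2))..(L / 2), deriv w (x - z) * g z) =
      ∫ z in (0 : ℝ)..(L / 2), (deriv w (x + z) + deriv w (x - z)) * g z := by
    have i1 : ∀ a b, IntervalIntegrable (fun z => deriv w (x - z) * g z) volume a b :=
      fun a b => (hk a b).continuousOn_mul (by fun_prop)
    have i2 : ∀ a b, IntervalIntegrable (fun z => deriv w (x + z) * g z) volume a b :=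
      fun a b => (hk a b).continuousOn_mul (by fun_prop)
    rw [← intervalIntegral.integral_add_adjacent_intervals (i1 _ 0) (i1 0 _)]
    have := intervalIntegral.integral_comp_neg (a := 0) (b := L / 2)
      (fun z => deriv w (x - z) * g z)
    simp only [neg_zero, sub_neg_eq_add, hev] at this
    rw [← this, ← intervalIntegral.integral_add (i2 _ _) (i1 _ _)]
    simp only [add_mul]
  rw [hfold]
  set v : ℝ → ℝ := fun z => w (x + z) - w (x - z) with hv
  have hvd : ∀ z, HasDerivAt v (deriv w (x + z) + deriv w (x - z)) z := by
    intro z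
    have h1 := (hwd (x + z)).comp_const_add x z
    have h2 := (hwd (x - z)).comp_const_sub x z
    have h3 := h1.sub h2
    rw [sub_neg_eq_add] at h3
    exact h3
  have hvc : Continuous v := by simp only [hv]; fun_prop
  have hint : ∀ a b, IntervalIntegrable
      (fun z => (deriv w (x + z) + deriv w (x - z)) * g z) volume a b :=
    fun a b => (hk a b).continuousOn_mul (by fun_prop)
  -- the truncated transform, integrated by parts
  have hEq : ∀ᶠ ε in 𝓝[>] (0 : ℝ), HouLuo.hilbertTrunc L w x ε =
      (1 / π) * ((∫ z in ε..(L / 2), (deriv w (x + z) + deriv w (x - z)) * g z) + v ε * g ε) := by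
    filter_upwards [Ioo_mem_nhdsGT (show (0 : ℝ) < L / 2 by positivity)] with ε hε
    have hsin : ∀ z ∈ Icc ε (L / 2), 0 < Real.sin (π / L * z) := by
      intro z hz
      apply Real.sin_pos_of_pos_of_lt_pi
      · have : 0 < z := hε.1.trans_le hz.1
        positivity
      · have : z < L := by linarith [hz.2]
        calc π / L * z < π / L * L := by gcongr
          _ = π := by field_simp
    have hgd : ∀ z ∈ uIcc ε (L / 2), HasDerivAt g (π / L * Real.cot (π / L * z)) z := by
      intro z hz
      rw [uIcc_of_le hε.2.le] at hz
      have h1 : HasDerivAt (fun z : ℝ => π / L * z) (π / L) z := by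
        simpa using (hasDerivAt_id z).const_mul (π / L)
      have := (h1.sin).log (hsin z hz).ne'
      convert this using 1
      rw [Real.cot_eq_cos_div_sin]
      ring
    have hcot : ContinuousOn (fun z => Real.cot (π / L * z)) (uIcc ε (L / 2)) := by
      rw [uIcc_of_le hε.2.le]
      simp only [Real.cot_eq_cos_div_sin]
      exact ContinuousOn.div (by fun_prop) (by fun_prop) fun z hz => (hsin z hz).ne'
    have hparts := intervalIntegral.integral_mul_deriv_eq_deriv_mul
      (u := g) (v := v) (u' := fun z => π / L * Real.cot (π / L * z))
      (v' := fun z => deriv w (x + z) + deriv w (x - z)) (a := ε) (b := L / 2) hgd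
      (fun z _ => hvd z) (hcot.const_mul _).intervalIntegrable
      (Continuous.intervalIntegrable (by fun_prop) _ _)
    have hg0 : g (L / 2) = 0 := by
      have : π / L * (L / 2) = π / 2 := by field_simp
      simp [hg, this]
    have e1 : (∫ y in (x - L / 2)..(x - ε), w y * Real.cot (π / L * (x - y))) =
        ∫ z in ε..(L / 2), w (x - z) * Real.cot (π / L * z) := by
      have := intervalIntegral.integral_comp_sub_left (a := ε) (b := L / 2)
        (fun y => w y * Real.cot (π / L * (x - y))) x
      simpa only [sub_sub_cancel] using this.symm
    have e2 : (∫ y in (x + ε)..(x + L / 2), w y * Real.cot (π / L * (x - y))) =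
        ∫ z in ε..(L / 2), -(w (x + z) * Real.cot (π / L * z)) := by
      have := intervalIntegral.integral_comp_add_left (a := ε) (b := L / 2)
        (fun y => w y * Real.cot (π / L * (x - y))) x
      rw [← this]
      congr 1
      funext z
      have : π / L * (x - (x + z)) = -(π / L * z) := by ring
      rw [this]
      simp [Real.cot_eq_cos_div_sin, Real.sin_neg, Real.cos_neg, div_neg]
    have i1 : IntervalIntegrable (fun z => w (x - z) * Real.cot (π / L * z)) volume ε (L / 2) :=
      (hcot.intervalIntegrable).continuousOn_mul (by fun_prop)
    have i2 : IntervalIntegrable (fun z => -(w (x + z) * Real.cot (π / L * z)))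
        volume ε (L / 2) :=
      ((hcot.intervalIntegrable).continuousOn_mul (by fun_prop)).neg
    unfold HouLuo.hilbertTrunc
    rw [e1, e2, ← intervalIntegral.integral_add i1 i2]
    have e3 : (∫ z in ε..(L / 2), π / L * Real.cot (π / L * z) * v z) =
        -(π / L) * ∫ z in ε..(L / 2), (w (x - z) * Real.cot (π / L * z) +
          -(w (x + z) * Real.cot (π / L * z))) := by
      rw [← intervalIntegral.integral_const_mul]
      congr 1
      funext z
      simp only [hv]
      ring
    have e4 : (∫ z in ε..(L / 2), (deriv w (x + z) + deriv w (x - z)) * g z) =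
        ∫ z in ε..(L / 2), g z * (deriv w (x + z) + deriv w (x - z)) := by
      simp only [mul_comm]
    rw [e4, hparts, e3, hg0]
    generalize (∫ z in ε..(L / 2), (w (x - z) * Real.cot (π / L * z) +
      -(w (x + z) * Real.cot (π / L * z)))) = J
    have hπ := Real.pi_pos.ne'
    field_simp
    ring
  refine Tendsto.congr' (EventuallyEq.symm hEq) ?_
  refine Tendsto.const_mul _ ?_
  rw [← add_zero (∫ z in (0 : ℝ)..(L / 2), _)]
  refine Tendsto.add ?_ ?_
  · have hc := intervalIntegral.continuous_primitive hint (L / 2)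
    have h0 := ((hc.tendsto 0).mono_left (nhdsWithin_le_nhds (s := Ioi (0 : ℝ)))).neg
    simpa only [← intervalIntegral.integral_symm] using h0
  · have hs1 : Tendsto (fun ε : ℝ => ε⁻¹ * v ε) (𝓝[>] 0)
        (𝓝 (deriv w (x + 0) + deriv w (x - 0))) := by
      have := (hvd 0).tendsto_slope_zero_right
      simpa [hv] using this
    have hs2 : Tendsto (fun ε : ℝ => ε⁻¹ * Real.sin (π / L * ε)) (𝓝[>] 0) (𝓝 (π / L)) := by
      have h1 : HasDerivAt (fun z : ℝ => π / L * z) (π / L) 0 := by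
        simpa using (hasDerivAt_id (0 : ℝ)).const_mul (π / L)
      have := (h1.sin).tendsto_slope_zero_right
      simpa using this
    have hs3 : Tendsto (fun ε : ℝ => Real.sin (π / L * ε) * Real.log (Real.sin (π / L * ε)))
        (𝓝[>] 0) (𝓝 0) := by
      have hc : Continuous fun ε : ℝ =>
          Real.sin (π / L * ε) * Real.log (Real.sin (π / L * ε)) :=
        Real.continuous_mul_log.comp (f := fun ε : ℝ => Real.sin (π / L * ε)) (by fun_prop)
      have := (hc.tendsto 0).mono_left (nhdsWithin_le_nhds (s := Ioi (0 : ℝ)))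
      simpa using this
    have hlim := (hs1.div hs2 hμ.ne').mul hs3
    rw [mul_zero] at hlim
    refine hlim.congr' ?_
    filter_upwards [Ioo_mem_nhdsGT hL] with ε hε
    have hs : 0 < Real.sin (π / L * ε) := by
      apply Real.sin_pos_of_pos_of_lt_pi
      · have := hε.1
        positivity
      · calc π / L * ε < π / L * L := by gcongr; exact hε.2
          _ = π := by field_simp
    have hε0 := hε.1.ne'
    simp only [Pi.div_apply, hg]
    generalize Real.sin (π / L * ε) = S at hs
    have hS := hs.ne'
    field_simp

/-- `(ω, θ)`, written `ω t x` and `θ t x`, is a regular (classical) `L`-periodic solution on the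
time interval `I` of
`ω_t + u ω_x = θ_x`, `θ_t + u θ_x = 0`, `u_x = H ω`
with initial data `(ω₀, θ₀)`: the vorticity is `C¹` and the density is `C²` jointly in time and
space on `I × ℝ` (one-sided in time at an endpoint belonging to `I`). -/
structure HouLuo.IsRegularSolution (L : ℝ) (ω₀ θ₀ : ℝ → ℝ) (I : Set ℝ) (ω θ : ℝ → ℝ → ℝ) :
    Prop where
  contDiffOn_vorticity : ContDiffOn ℝ 1 (fun p : ℝ × ℝ => ω p.1 p.2) (I ×ˢ univ)
  contDiffOn_density : ContDiffOn ℝ 2 (fun p : ℝ × ℝ => θ p.1 p.2) (I ×ˢ univ)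
  periodic_vorticity : ∀ t ∈ I, Function.Periodic (ω t) L
  periodic_density : ∀ t ∈ I, Function.Periodic (θ t) L
  vorticity_eq : ∀ t ∈ interior I, ∀ x : ℝ,
    deriv (fun s => ω s x) t + HouLuo.velocity L (ω t) x * deriv (ω t) x = deriv (θ t) x
  density_eq : ∀ t ∈ interior I, ∀ x : ℝ,
    deriv (fun s => θ s x) t + HouLuo.velocity L (ω t) x * deriv (θ t) x = 0
  initial_vorticity : ∀ x : ℝ, ω 0 x = ω₀ x
  initial_density : ∀ x : ℝ, θ 0 x = θ₀ x

/-!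
Finite-time shock formation for the periodic Hou–Luo model.

By an energy estimate for the even part of `ω` and of `θₓ`, in which the Hilbert transform is
bounded on `L²` through its Fourier multiplier (`integral_sq_deriv_velocity_le`), a regular
solution keeps an odd vorticity (`IsRegularSolution.odd_vorticity`). Hence `u` vanishes at `0` and
`L / 2`, and `θₓ ≥ 0`, then `ω ≥ 0`, and so `u ≤ 0` persist on `[0, L / 2]`: the fluid moves
towards the origin, and `θ(t, x)` is nondecreasing in `t` and in `x`.

Let `c` be the mean of `θ₀(0)` and `θ₀(L / 2)`, and suppose that `θ(t, x₀) < c` up to the time `T`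
for some `x₀ ∈ (0, L / 2)`. The quantity `h = (θ - c)₊²` is transported by the flow, is
nondecreasing in `x` and vanishes on `[0, x₀]`. Consider
`I = ∫ h cot (π x / L) dx` and `J = ∫ h ω cot (π x / L) dx` over `[x₀, L / 2]`. No singularity at
the origin enters, and `I` is bounded because `h` is.

* For odd `ω ≥ 0`, `-u(x) cot (π x / L) ≥ (2 / π) ∫ ω(y) cot (π y / L) dy`, the integral being over
  `[x, L / 2]` (`integral_mul_cot_le`). This gives `I' ≥ (2 / π) J`.
* The derivative of `J` is the sum of `∫ h θₓ cot` and of the stretching term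
  `-∫ (h ω)ₓ u cot = ∫ h ω (u cot)ₓ`. The latter is nonnegative for every nondecreasing `h ≥ 0`
  (`integral_deriv_mul_velocity_nonpos`): in the variables `log tan (π x / L)` the Biot–Savart
  kernel of an odd vorticity is a function `artanh (1 / cosh d)` of the difference `d`, and the
  derivative of its product with `cot` has a nonnegative symmetrization. To avoid the principal
  value, the kernel is replaced by `artanh (1 / (cosh d + ε))`, which has the same positivity
  (`symm_kernel_nonneg`), and `ε` tends to zero.
* The former is at least a constant times `I²`, by an integration by parts and the Cauchy–Schwarz
  inequality (`le_integral_buoyancy`).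

The inequalities `I' ≥ a J`, `J' ≥ b I²` make `I` unbounded before a time determined by `a`, `b`
and a lower bound for `I` at time zero (`exists_lt_of_quadratic`), a contradiction. These constants
depend on `L` and `θ₀` only. So `θ ≥ c` near the time `T` at every point of `(0, L / 2]`, while
`θ(t, 0) = θ₀(0)`; by continuity, no solution is regular up to and including `T`.
-/

namespace HouLuo

/-! ### The logarithmic kernel and its regularization -/

/-- The product `sin a cos a sin b cos b`, which separates `sin² (a + b)` from `sin² (a - b)`. -/
noncomputable def sinCosProd (a b : ℝ) : ℝ := sin a * cos a * (sin b * cos b)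

/-- The numerator `sin² (a + b) + 2 ε sin a cos a sin b cos b` of the regularized kernel. -/
noncomputable def kernelNum (ε a b : ℝ) : ℝ := sin (a + b) ^ 2 + 2 * ε * sinCosProd a b

/-- The denominator `sin² (a - b) + 2 ε sin a cos a sin b cos b` of the regularized kernel. -/
noncomputable def kernelDen (ε a b : ℝ) : ℝ := sin (a - b) ^ 2 + 2 * ε * sinCosProd a b

/-- The regularization `½ log ((sin² (a + b) + 2 ε s) / (sin² (a - b) + 2 ε s))` of the odd
Biot–Savart kernel `log |sin (a + b) / sin (a - b)|`, where `s = sin a cos a sin b cos b`.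
In the variable `d = log (tan a / tan b)` it is `artanh (1 / (cosh d + ε))`. -/
noncomputable def logKernel (ε a b : ℝ) : ℝ := log (kernelNum ε a b / kernelDen ε a b) / 2

/-- The derivative of `logKernel ε` with respect to `log (tan a)`. -/
noncomputable def logKernelDeriv (ε a b : ℝ) : ℝ :=
  -(2 * sinCosProd a b * sin (a + b) * sin (a - b)) / (kernelNum ε a b * kernelDen ε a b)

section kernel

variable {ε a b : ℝ}

theorem sinCosProd_comm (a b : ℝ) : sinCosProd b a = sinCosProd a b := by
  unfold sinCosProd; ring

theorem sin_add_sq (a b : ℝ) : sin (a + b) ^ 2 = sin (a - b) ^ 2 + 4 * sinCosProd a b := by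
  rw [sin_add, sin_sub, sinCosProd]; ring

theorem kernelNum_eq (ε a b : ℝ) : kernelNum ε a b = kernelDen ε a b + 4 * sinCosProd a b := by
  rw [kernelNum, kernelDen, sin_add_sq]; ring

theorem sinCosProd_pos (ha : a ∈ Ioo 0 (π / 2)) (hb : b ∈ Ioo 0 (π / 2)) :
    0 < sinCosProd a b := by
  have h1 := sin_pos_of_pos_of_lt_pi ha.1 (by linarith [ha.2, pi_pos])
  have h2 := sin_pos_of_pos_of_lt_pi hb.1 (by linarith [hb.2, pi_pos])
  have h3 := cos_pos_of_mem_Ioo ⟨by linarith [ha.1, pi_pos], ha.2⟩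
  have h4 := cos_pos_of_mem_Ioo ⟨by linarith [hb.1, pi_pos], hb.2⟩
  unfold sinCosProd; positivity

theorem kernelDen_pos (hε : 0 < ε) (ha : a ∈ Ioo 0 (π / 2)) (hb : b ∈ Ioo 0 (π / 2)) :
    0 < kernelDen ε a b := by
  have := sinCosProd_pos ha hb
  unfold kernelDen; positivity

theorem kernelNum_pos (hε : 0 < ε) (ha : a ∈ Ioo 0 (π / 2)) (hb : b ∈ Ioo 0 (π / 2)) :
    0 < kernelNum ε a b := by
  have := sinCosProd_pos ha hb
  unfold kernelNum; positivity

theorem kernelNum_comm (ε a b : ℝ) : kernelNum ε b a = kernelNum ε a b := by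
  rw [kernelNum, kernelNum, sinCosProd_comm, add_comm b a]

theorem kernelDen_comm (ε a b : ℝ) : kernelDen ε b a = kernelDen ε a b := by
  rw [kernelDen, kernelDen, sinCosProd_comm, ← neg_sub, sin_neg, neg_sq]

theorem logKernel_comm (ε a b : ℝ) : logKernel ε b a = logKernel ε a b := by
  rw [logKernel, logKernel, kernelNum_comm, kernelDen_comm]

theorem logKernelDeriv_comm (ε a b : ℝ) : logKernelDeriv ε b a = -logKernelDeriv ε a b := by
  rw [logKernelDeriv, logKernelDeriv, kernelNum_comm, kernelDen_comm, sinCosProd_comm,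
    ← neg_sub, sin_neg, add_comm b a]
  ring

theorem logKernel_nonneg (hε : 0 < ε) (ha : a ∈ Ioo 0 (π / 2)) (hb : b ∈ Ioo 0 (π / 2)) :
    0 ≤ logKernel ε a b := by
  have h1 := kernelDen_pos hε ha hb
  have h2 := sinCosProd_pos ha hb
  refine div_nonneg (log_nonneg ?_) zero_le_two
  rw [le_div_iff₀ h1, kernelNum_eq]
  linarith

theorem logKernel_le (hε : 0 < ε) (ha : a ∈ Ioo 0 (π / 2)) (hb : b ∈ Ioo 0 (π / 2)) :
    logKernel ε a b ≤ log (1 + 2 / ε) / 2 := by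
  have h1 := kernelDen_pos hε ha hb
  have h2 := sinCosProd_pos ha hb
  have h3 := kernelNum_pos hε ha hb
  refine div_le_div_of_nonneg_right (log_le_log (by positivity) ?_) zero_le_two
  rw [div_le_iff₀ h1, kernelNum_eq]
  have h4 : 2 * ε * sinCosProd a b ≤ kernelDen ε a b := by
    unfold kernelDen; nlinarith [sq_nonneg (sin (a - b))]
  have h5 : 4 * sinCosProd a b = 2 / ε * (2 * ε * sinCosProd a b) := by field_simp; ring
  have h6 : 0 < 2 / ε := by positivity
  nlinarith

theorem abs_logKernelDeriv_le (hε : 0 < ε) (ha : a ∈ Ioo 0 (π / 2)) (hb : b ∈ Ioo 0 (π / 2)) :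
    |logKernelDeriv ε a b| ≤ 1 / (2 * ε) := by
  have h1 := kernelDen_pos hε ha hb
  have h2 := sinCosProd_pos ha hb
  have h3 := kernelNum_pos hε ha hb
  rw [logKernelDeriv, abs_div, abs_of_pos (mul_pos h3 h1), abs_neg,
    div_le_div_iff₀ (mul_pos h3 h1) (by positivity)]
  have h4 : |2 * sinCosProd a b * sin (a + b) * sin (a - b)| =
      2 * sinCosProd a b * |sin (a + b) * sin (a - b)| := by
    rw [mul_assoc, abs_mul, abs_of_pos (by positivity)]
  rw [h4, kernelNum, kernelDen]
  generalize sinCosProd a b = s at *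
  generalize sin (a + b) = n at *
  generalize sin (a - b) = m at *
  have h5 : 0 ≤ (|n * m| - 2 * ε * s) ^ 2 := sq_nonneg _
  have h6 : |n * m| ^ 2 = n ^ 2 * m ^ 2 := by rw [sq_abs]; ring
  have h7 : 0 ≤ 2 * ε * s * (n ^ 2 + m ^ 2) := by positivity
  nlinarith

/-- `log r ≥ 2 (r - 1) / (r + 1)` for `r = A / B ≥ 1`. -/
theorem two_mul_div_le_log_div {A B : ℝ} (hB : 0 < B) (hAB : B ≤ A) :
    2 * (A - B) / (A + B) ≤ log (A / B) := by
  have h := le_log_one_add_of_nonneg (x := A / B - 1)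
    (by rw [sub_nonneg, le_div_iff₀ hB]; linarith)
  have e1 : 1 + (A / B - 1) = A / B := by ring
  have e2 : 2 * (A / B - 1) / (A / B - 1 + 2) = 2 * (A - B) / (A + B) := by
    have : A + B ≠ 0 := by linarith
    have e3 : A / B - 1 + 2 = (A + B) / B := by field_simp; ring
    rw [e3]; field_simp
  rwa [e1, e2] at h

theorem hasDerivAt_logKernel (hε : 0 < ε) (ha : a ∈ Ioo 0 (π / 2)) (hb : b ∈ Ioo 0 (π / 2)) :
    HasDerivAt (fun a => logKernel ε a b) (logKernelDeriv ε a b / (sin a * cos a)) a := by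
  have h1 := kernelDen_pos hε ha hb
  have h2 := sinCosProd_pos ha hb
  have h3 := kernelNum_pos hε ha hb
  have hs := sin_pos_of_pos_of_lt_pi ha.1 (by linarith [ha.2, pi_pos])
  have hc := cos_pos_of_mem_Ioo ⟨by linarith [ha.1, pi_pos], ha.2⟩
  have ds : HasDerivAt (fun a => sinCosProd a b)
      ((cos a * cos a + sin a * -sin a) * (sin b * cos b)) a :=
    ((hasDerivAt_sin a).mul (hasDerivAt_cos a)).mul_const _
  have dA : HasDerivAt (fun a => kernelNum ε a b) (2 * sin (a + b) * cos (a + b) +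
      2 * ε * ((cos a * cos a + sin a * -sin a) * (sin b * cos b))) a := by
    have := (((hasDerivAt_id a).add_const b).sin.pow 2).add (ds.const_mul (2 * ε))
    refine this.congr_deriv ?_
    simp
  have dB : HasDerivAt (fun a => kernelDen ε a b) (2 * sin (a - b) * cos (a - b) +
      2 * ε * ((cos a * cos a + sin a * -sin a) * (sin b * cos b))) a := by
    have := (((hasDerivAt_id a).sub_const b).sin.pow 2).add (ds.const_mul (2 * ε))
    refine this.congr_deriv ?_
    simp
  have := ((dA.div dB h1.ne').log (div_pos h3 h1).ne').div_const 2
  refine this.congr_deriv ?_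
  have key : (2 * sin (a + b) * cos (a + b) +
      2 * ε * ((cos a * cos a + sin a * -sin a) * (sin b * cos b))) * kernelDen ε a b -
      kernelNum ε a b * (2 * sin (a - b) * cos (a - b) +
      2 * ε * ((cos a * cos a + sin a * -sin a) * (sin b * cos b))) =
      -(4 * (sin b * cos b) * sin (a + b) * sin (a - b)) := by
    have e1 : sin (a - b) * cos (a + b) - sin (a + b) * cos (a - b) =
        -(2 * sin b * cos b) * (sin a ^ 2 + cos a ^ 2) := by
      rw [sin_add, sin_sub, cos_add, cos_sub]; ring
    have e2 : sin (a + b) * cos (a + b) - sin (a - b) * cos (a - b) =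
        2 * (cos a * cos a + sin a * -sin a) * (sin b * cos b) := by
      have : sin (a + b) * cos (a + b) - sin (a - b) * cos (a - b) =
        2 * (cos a ^ 2 * cos b - sin a ^ 2 * cos b) * sin b  := by
        rw [sin_add, sin_sub, cos_add, cos_sub]; ring
      rw [this]; ring
    rw [sin_sq_add_cos_sq, mul_one] at e1
    have e3 := sin_add_sq a b
    unfold kernelNum kernelDen
    linear_combination (2 * sin (a + b) * sin (a - b)) * e1 + (4 * ε * sinCosProd a b) * e2 -
      (2 * ε * ((cos a * cos a + sin a * -sin a) * (sin b * cos b))) * e3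
  rw [key, logKernelDeriv]
  have h1' := h1.ne'
  have h3' := h3.ne'
  simp only [sinCosProd, Pi.div_apply]
  field_simp
  ring

/-- Positivity of the symmetrized kernel: the singular parts of the two terms cancel, and what is
left is controlled by `log r ≥ 2 (r - 1) / (r + 1)`. -/
theorem symm_kernel_nonneg_of_lt (hε : 0 < ε) (ha : a ∈ Ioo 0 (π / 2)) (hb : b ∈ Ioo 0 (π / 2))
    (hba : b < a) {p q : ℝ} (hq : 0 ≤ q) (hqp : q ≤ p) :
    0 ≤ p * ((logKernel ε a b - logKernelDeriv ε a b) / sin a ^ 2) +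
      q * ((logKernel ε a b + logKernelDeriv ε a b) / sin b ^ 2) := by
  have h1 := kernelDen_pos hε ha hb
  have h2 := sinCosProd_pos ha hb
  have h3 := kernelNum_pos hε ha hb
  have hR := logKernel_nonneg hε ha hb
  have hsa := sin_pos_of_pos_of_lt_pi ha.1 (by linarith [ha.2, pi_pos])
  have hsb := sin_pos_of_pos_of_lt_pi hb.1 (by linarith [hb.2, pi_pos])
  have hn : 0 < sin (a + b) :=
    sin_pos_of_pos_of_lt_pi (by linarith [ha.1, hb.1]) (by linarith [ha.2, hb.2])
  have hm : 0 < sin (a - b) :=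
    sin_pos_of_pos_of_lt_pi (by linarith) (by linarith [ha.2, hb.1])
  have hRd : logKernelDeriv ε a b ≤ 0 := by
    rw [logKernelDeriv, neg_div, neg_nonpos]; positivity
  have hlog : 4 * sinCosProd a b / (kernelNum ε a b + kernelDen ε a b) ≤ logKernel ε a b := by
    have := two_mul_div_le_log_div h1 (by rw [kernelNum_eq]; linarith :
      kernelDen ε a b ≤ kernelNum ε a b)
    rw [logKernel, le_div_iff₀ two_pos]
    refine le_trans (le_of_eq ?_) this
    rw [show kernelNum ε a b - kernelDen ε a b = 4 * sinCosProd a b by rw [kernelNum_eq]; ring]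
    ring
  have hnm : sin (a + b) ^ 2 + sin (a - b) ^ 2 ≤ 2 * (sin a ^ 2 + sin b ^ 2) := by
    have e : sin (a + b) ^ 2 + sin (a - b) ^ 2 =
        2 * (sin a ^ 2 * cos b ^ 2 + cos a ^ 2 * sin b ^ 2) := by rw [sin_add, sin_sub]; ring
    rw [e]
    nlinarith [sin_sq_add_cos_sq a, sin_sq_add_cos_sq b, sq_nonneg (sin a), sq_nonneg (sin b),
      mul_nonneg (sq_nonneg (sin a)) (sq_nonneg (sin b))]
  have hprod : sin (a + b) * sin (a - b) = sin a ^ 2 - sin b ^ 2 := by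
    have : sin (a + b) * sin (a - b) = sin a ^ 2 * cos b ^ 2 - cos a ^ 2 * sin b ^ 2 := by
      rw [sin_add, sin_sub]; ring
    rw [this, cos_sq', cos_sq']; ring
  have hcore : 0 ≤ (sin a ^ 2 + sin b ^ 2) * logKernel ε a b +
      sin (a + b) * sin (a - b) * logKernelDeriv ε a b := by
    have hA : sin (a + b) ^ 2 ≤ kernelNum ε a b := by
      unfold kernelNum
      have := mul_pos hε h2
      linarith
    have hB : sin (a - b) ^ 2 ≤ kernelDen ε a b := by
      unfold kernelDen
      have := mul_pos hε h2
      linarith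
    have hmul := mul_le_mul_of_nonneg_left hlog
      (by positivity : 0 ≤ sin a ^ 2 + sin b ^ 2)
    refine le_trans ?_ (add_le_add_left hmul _)
    rw [logKernelDeriv]
    generalize sinCosProd a b = s at *
    generalize kernelNum ε a b = A at *
    generalize kernelDen ε a b = B at *
    generalize sin (a + b) = n at *
    generalize sin (a - b) = m at *
    generalize sin a ^ 2 + sin b ^ 2 = S at *
    have e : S * (4 * s / (A + B)) + n * m * (-(2 * s * n * m) / (A * B)) =
        2 * s * (2 * S * (A * B) - n ^ 2 * m ^ 2 * (A + B)) / ((A + B) * (A * B)) := by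
      field_simp
      ring
    rw [e]
    refine div_nonneg (mul_nonneg (by positivity) ?_) (by positivity)
    have k1 : n ^ 2 * m ^ 2 * A ≤ n ^ 2 * A * B := by nlinarith [mul_pos (pow_pos hn 2) h3]
    have k2 : n ^ 2 * m ^ 2 * B ≤ m ^ 2 * A * B := by nlinarith [mul_pos (pow_pos hm 2) h1]
    have k3 : (n ^ 2 + m ^ 2) * (A * B) ≤ 2 * S * (A * B) :=
      mul_le_mul_of_nonneg_right hnm (by positivity)
    nlinarith
  have step : q * ((logKernel ε a b - logKernelDeriv ε a b) / sin a ^ 2) ≤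
      p * ((logKernel ε a b - logKernelDeriv ε a b) / sin a ^ 2) :=
    mul_le_mul_of_nonneg_right hqp (div_nonneg (by linarith) (by positivity))
  refine le_trans ?_ (add_le_add_left step _)
  rw [← mul_add]
  refine mul_nonneg hq ?_
  have e : (logKernel ε a b - logKernelDeriv ε a b) / sin a ^ 2 +
      (logKernel ε a b + logKernelDeriv ε a b) / sin b ^ 2 =
      ((sin a ^ 2 + sin b ^ 2) * logKernel ε a b +
        (sin a ^ 2 - sin b ^ 2) * logKernelDeriv ε a b) / (sin a ^ 2 * sin b ^ 2) := by
    field_simp; ring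
  rw [e, ← hprod]
  positivity

theorem symm_kernel_nonneg (hε : 0 < ε) {f : ℝ → ℝ} (hf : MonotoneOn f (Ioo 0 (π / 2)))
    (hf0 : ∀ x ∈ Ioo 0 (π / 2), 0 ≤ f x)
    (ha : a ∈ Ioo 0 (π / 2)) (hb : b ∈ Ioo 0 (π / 2)) :
    0 ≤ f a * ((logKernel ε a b - logKernelDeriv ε a b) / sin a ^ 2) +
      f b * ((logKernel ε b a - logKernelDeriv ε b a) / sin b ^ 2) := by
  have e1 := logKernel_comm ε a b
  have e2 := logKernelDeriv_comm ε a b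
  rcases lt_trichotomy a b with h | h | h
  · have := symm_kernel_nonneg_of_lt hε hb ha h (hf0 a ha) (hf ha hb h.le)
    rw [e1, e2] at this ⊢
    rw [add_comm]
    convert this using 3
    ring
  · subst h
    have h0 : logKernelDeriv ε a a = 0 := by simp [logKernelDeriv]
    have := logKernel_nonneg hε ha ha
    have := hf0 a ha
    rw [h0]; positivity
  · have := symm_kernel_nonneg_of_lt hε ha hb h (hf0 b hb) (hf hb ha h.le)
    rw [e1, e2, sub_neg_eq_add]
    exact this

end kernel

/-! ### Pointwise bounds for the velocity of an odd vorticity -/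

section velocity

variable {L : ℝ} {w : ℝ → ℝ}

theorem angle_mem_Ioo (hL : 0 < L) {x : ℝ} (hx : x ∈ Ioo 0 (L / 2)) :
    π / L * x ∈ Ioo 0 (π / 2) := by
  have := pi_pos
  refine ⟨mul_pos (by positivity) hx.1, ?_⟩
  calc π / L * x < π / L * (L / 2) := by
        have := hx.2
        gcongr
    _ = π / 2 := by field_simp

theorem intervalIntegrable_log_sin_sub (hL : 0 < L) (x a b : ℝ) :
    IntervalIntegrable (fun y => log (sin (π / L * (x - y)))) volume a b := by
  have := (kernel_integrable hL (x - a) (x - b)).comp_sub_left x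
  simpa only [sub_sub_cancel] using this

theorem intervalIntegrable_log_sin_add (hL : 0 < L) (x a b : ℝ) :
    IntervalIntegrable (fun y => log (sin (π / L * (x + y)))) volume a b := by
  have := (kernel_integrable hL (x + a) (x + b)).comp_add_left x
  simpa only [add_sub_cancel_left] using this

/-- For an odd vorticity the Biot–Savart integral folds to the half period. -/
theorem velocity_eq_half (hL : 0 < L) (hw : Continuous w) (hper : Function.Periodic w L)
    (hodd : ∀ x, w (-x) = -w x) (x : ℝ) :
    velocity L w x = (1 / π) * ∫ y in (0 : ℝ)..(L / 2),
      w y * (log (sin (π / L * (x - y))) - log (sin (π / L * (x + y)))) := by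
  unfold velocity
  congr 1
  have hp : Function.Periodic (fun y => w y * log |sin (π / L * (x - y))|) L := by
    intro y
    have : π / L * (x - (y + L)) = π / L * (x - y) - π := by
      field_simp
      ring
    simp only [hper y, this, sin_sub_pi, abs_neg]
  have h1 := hp.intervalIntegral_add_eq 0 (-(L / 2))
  rw [zero_add, show -(L / 2) + L = L / 2 by ring] at h1
  rw [h1]
  simp only [log_abs]
  have i1 : ∀ a b, IntervalIntegrable (fun y => w y * log (sin (π / L * (x - y)))) volume a b :=
    fun a b => (intervalIntegrable_log_sin_sub hL x a b).continuousOn_mul hw.continuousOn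
  have i2 : ∀ a b, IntervalIntegrable (fun y => w y * log (sin (π / L * (x + y)))) volume a b :=
    fun a b => (intervalIntegrable_log_sin_add hL x a b).continuousOn_mul hw.continuousOn
  rw [← intervalIntegral.integral_add_adjacent_intervals (i1 _ 0) (i1 0 _)]
  have h2 := intervalIntegral.integral_comp_neg (a := 0) (b := L / 2)
    (fun y => w y * log (sin (π / L * (x - y))))
  simp only [neg_zero, sub_neg_eq_add, hodd, neg_mul] at h2
  rw [← h2, intervalIntegral.integral_neg, ← sub_eq_neg_add,
    ← intervalIntegral.integral_sub (i1 _ _) (i2 _ _)]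
  simp only [mul_sub]

theorem velocity_zero (hL : 0 < L) (hw : Continuous w) (hper : Function.Periodic w L)
    (hodd : ∀ x, w (-x) = -w x) : velocity L w 0 = 0 := by
  rw [velocity_eq_half hL hw hper hodd]
  simp [sin_neg]

theorem velocity_half_period (hL : 0 < L) (hw : Continuous w) (hper : Function.Periodic w L)
    (hodd : ∀ x, w (-x) = -w x) : velocity L w (L / 2) = 0 := by
  rw [velocity_eq_half hL hw hper hodd]
  have h1 : ∀ y, π / L * (L / 2 - y) = π / 2 - π / L * y := fun y => by field_simp
  have h2 : ∀ y, π / L * (L / 2 + y) = π / L * y + π / 2 := fun y => by field_simp; ring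
  simp [h1, h2, sin_pi_div_two_sub, sin_add_pi_div_two]

theorem sin_sub_sq_pos {a b : ℝ} (ha : a ∈ Ioo 0 (π / 2)) (hb : b ∈ Ioo 0 (π / 2))
    (hab : a ≠ b) : 0 < sin (a - b) ^ 2 := by
  have hm : sin (a - b) ≠ 0 := by
    intro h
    rw [sin_eq_zero_iff_of_lt_of_lt (by linarith [ha.1, hb.2, pi_pos])
      (by linarith [ha.2, hb.1, pi_pos])] at h
    exact hab (by linarith)
  positivity

theorem log_sin_sub_sub_log_sin_add {a b : ℝ} (ha : a ∈ Ioo 0 (π / 2)) (hb : b ∈ Ioo 0 (π / 2))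
    (hab : a ≠ b) : log (sin (a - b)) - log (sin (a + b)) = -logKernel 0 a b := by
  have hn : 0 < sin (a + b) :=
    sin_pos_of_pos_of_lt_pi (by linarith [ha.1, hb.1]) (by linarith [ha.2, hb.2])
  have hm : sin (a - b) ≠ 0 := fun h => by simpa [h] using sin_sub_sq_pos ha hb hab
  simp only [logKernel, kernelNum, kernelDen, mul_zero, zero_mul, add_zero]
  rw [log_div (by positivity) (by positivity), log_pow, log_pow]
  push_cast
  ring

theorem logKernel_zero_nonneg {a b : ℝ} (ha : a ∈ Ioo 0 (π / 2)) (hb : b ∈ Ioo 0 (π / 2))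
    (hab : a ≠ b) : 0 ≤ logKernel 0 a b := by
  have h := sin_sub_sq_pos ha hb hab
  have h2 := sinCosProd_pos ha hb
  refine div_nonneg (log_nonneg ?_) zero_le_two
  simp only [kernelNum, kernelDen, mul_zero, zero_mul, add_zero]
  rw [le_div_iff₀ h, sin_add_sq]
  linarith

theorem logKernel_le_logKernel_zero {ε a b : ℝ} (hε : 0 < ε) (ha : a ∈ Ioo 0 (π / 2))
    (hb : b ∈ Ioo 0 (π / 2)) (hab : a ≠ b) : logKernel ε a b ≤ logKernel 0 a b := by
  have h := sin_sub_sq_pos ha hb hab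
  have h1 := kernelDen_pos hε ha hb
  have h2 := sinCosProd_pos ha hb
  have h3 := kernelNum_pos hε ha hb
  refine div_le_div_of_nonneg_right (log_le_log (by positivity) ?_) zero_le_two
  simp only [kernelNum, kernelDen, mul_zero, zero_mul, add_zero] at h1 h3 ⊢
  rw [div_le_div_iff₀ h1 h, sin_add_sq]
  have := mul_pos hε h2
  nlinarith

/-- With `s = tan b / tan a > 1` this is the inequality `s log ((s + 1) / (s - 1)) ≥ 2`. -/
theorem two_mul_cot_le {a b : ℝ} (ha : a ∈ Ioo 0 (π / 2)) (hb : b ∈ Ioo 0 (π / 2))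
    (hab : a < b) : 2 * cot b ≤ cot a * logKernel 0 a b := by
  have hsa := sin_pos_of_pos_of_lt_pi ha.1 (by linarith [ha.2, pi_pos])
  have hsb := sin_pos_of_pos_of_lt_pi hb.1 (by linarith [hb.2, pi_pos])
  have hca := cos_pos_of_mem_Ioo ⟨by linarith [ha.1, pi_pos], ha.2⟩
  have hcb := cos_pos_of_mem_Ioo ⟨by linarith [hb.1, pi_pos], hb.2⟩
  have hn : 0 < sin (a + b) :=
    sin_pos_of_pos_of_lt_pi (by linarith [ha.1, hb.1]) (by linarith [ha.2, hb.2])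
  have hm : 0 < sin (b - a) :=
    sin_pos_of_pos_of_lt_pi (by linarith) (by linarith [hb.2, ha.1])
  have h1 := two_mul_div_le_log_div (A := sin (a + b)) hm
    (by rw [sin_add, sin_sub]; nlinarith [mul_pos hsa hcb])
  have h2 : logKernel 0 a b = log (sin (a + b) / sin (b - a)) := by
    have h3 : sin (a - b) = -sin (b - a) := by rw [← sin_neg, neg_sub]
    have h4 := log_sin_sub_sub_log_sin_add ha hb hab.ne
    rw [h3, log_neg_eq_log] at h4
    rw [log_div hn.ne' hm.ne']
    linarith
  rw [h2, cot_eq_cos_div_sin, cot_eq_cos_div_sin]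
  have hca' : 0 ≤ cos a / sin a := by positivity
  refine le_trans (le_of_eq ?_) (mul_le_mul_of_nonneg_left h1 hca')
  have e1 : sin (a + b) - sin (b - a) = 2 * sin a * cos b := by rw [sin_add, sin_sub]; ring
  have e2 : sin (a + b) + sin (b - a) = 2 * cos a * sin b := by rw [sin_add, sin_sub]; ring
  rw [e1, e2]
  field_simp

/-- For `x` inside the half period the velocity is an integral against the unregularized kernel. -/
theorem velocity_eq_logKernel (hL : 0 < L) (hw : Continuous w) (hper : Function.Periodic w L)
    (hodd : ∀ x, w (-x) = -w x) {x : ℝ} (hx : x ∈ Ioo 0 (L / 2)) :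
    IntervalIntegrable (fun y => w y * logKernel 0 (π / L * x) (π / L * y)) volume 0 (L / 2) ∧
    (∫ y in (0 : ℝ)..(L / 2), w y * logKernel 0 (π / L * x) (π / L * y)) =
      -(π * velocity L w x) := by
  have hL2 : (0 : ℝ) ≤ L / 2 := by positivity
  have hμ : 0 < π / L := by have := pi_pos; positivity
  have hae : ∀ᵐ y ∂volume, y ∈ Ioc 0 (L / 2) →
      -(w y * (log (sin (π / L * (x - y))) - log (sin (π / L * (x + y))))) =
      w y * logKernel 0 (π / L * x) (π / L * y) := by
    have n1 : ∀ᵐ y ∂(volume : Measure ℝ), y ≠ x := by simp [ae_iff, measure_singleton]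
    have n2 : ∀ᵐ y ∂(volume : Measure ℝ), y ≠ L / 2 := by simp [ae_iff, measure_singleton]
    filter_upwards [n1, n2] with y h1 h2 hy
    have hy' : y ∈ Ioo 0 (L / 2) := ⟨hy.1, lt_of_le_of_ne hy.2 h2⟩
    rw [mul_sub (π / L), mul_add (π / L), log_sin_sub_sub_log_sin_add (angle_mem_Ioo hL hx)
      (angle_mem_Ioo hL hy') fun h => h1 (mul_left_cancel₀ hμ.ne' h).symm]
    ring
  have hint : IntervalIntegrable (fun y =>
      -(w y * (log (sin (π / L * (x - y))) - log (sin (π / L * (x + y)))))) volume 0 (L / 2) :=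
    (((intervalIntegrable_log_sin_sub hL x _ _).sub
      (intervalIntegrable_log_sin_add hL x _ _)).continuousOn_mul hw.continuousOn).neg
  have hae' : ∀ᵐ y ∂volume, y ∈ Set.uIoc 0 (L / 2) →
      -(w y * (log (sin (π / L * (x - y))) - log (sin (π / L * (x + y))))) =
      w y * logKernel 0 (π / L * x) (π / L * y) := by
    rwa [uIoc_of_le hL2]
  refine ⟨hint.congr_ae ?_, ?_⟩
  · rw [EventuallyEq, ae_restrict_iff' measurableSet_uIoc]
    exact hae'
  · rw [← intervalIntegral.integral_congr_ae hae', intervalIntegral.integral_neg,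
      velocity_eq_half hL hw hper hodd x]
    have := pi_pos.ne'
    field_simp

theorem velocity_nonpos (hL : 0 < L) (hw : Continuous w) (hper : Function.Periodic w L)
    (hodd : ∀ x, w (-x) = -w x) (hpos : ∀ x ∈ Icc 0 (L / 2), 0 ≤ w x)
    {x : ℝ} (hx : x ∈ Icc 0 (L / 2)) : velocity L w x ≤ 0 := by
  rcases hx.1.eq_or_lt with h | h
  · rw [← h, velocity_zero hL hw hper hodd]
  rcases hx.2.eq_or_lt with h' | h'
  · rw [h', velocity_half_period hL hw hper hodd]
  have h1 := (velocity_eq_logKernel hL hw hper hodd ⟨h, h'⟩).2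
  have hμ : 0 < π / L := by have := pi_pos; positivity
  have h2 : 0 ≤ ∫ y in (0 : ℝ)..(L / 2), w y * logKernel 0 (π / L * x) (π / L * y) := by
    refine intervalIntegral.integral_nonneg_of_ae_restrict (by positivity) ?_
    have n1 : ∀ᵐ y ∂(volume : Measure ℝ), y ∉ ({x, 0, L / 2} : Set ℝ) :=
      (Set.toFinite _).countable.ae_notMem _
    rw [EventuallyLE, ae_restrict_iff' measurableSet_Icc]
    filter_upwards [n1] with y hy1 hy
    simp only [mem_insert_iff, mem_singleton_iff, not_or] at hy1
    have hy' : y ∈ Ioo 0 (L / 2) :=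
      ⟨lt_of_le_of_ne hy.1 (Ne.symm hy1.2.1), lt_of_le_of_ne hy.2 hy1.2.2⟩
    refine mul_nonneg (hpos y hy) (logKernel_zero_nonneg (angle_mem_Ioo hL ⟨h, h'⟩)
      (angle_mem_Ioo hL hy') fun h => hy1.1 (mul_left_cancel₀ hμ.ne' h).symm)
  have := pi_pos
  nlinarith

theorem cot_nonneg_of_mem (hL : 0 < L) {x : ℝ} (hx : x ∈ Icc 0 (L / 2)) : 0 ≤ cot (π / L * x) := by
  have := pi_pos
  have h0 : 0 ≤ π / L * x := mul_nonneg (by positivity) hx.1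
  have h1 : π / L * x ≤ π / 2 := by
    calc π / L * x ≤ π / L * (L / 2) := by
          have := hx.2
          gcongr
      _ = π / 2 := by field_simp
  rw [cot_eq_cos_div_sin]
  exact div_nonneg (cos_nonneg_of_mem_Icc ⟨by linarith, h1⟩)
    (sin_nonneg_of_nonneg_of_le_pi h0 (by linarith))

theorem sin_angle_pos (hL : 0 < L) {x : ℝ} (hx : x ∈ Ioc 0 (L / 2)) : 0 < sin (π / L * x) := by
  have := pi_pos
  refine sin_pos_of_pos_of_lt_pi (mul_pos (by positivity) hx.1) ?_
  calc π / L * x ≤ π / L * (L / 2) := by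
        have := hx.2
        gcongr
    _ = π / 2 := by field_simp
    _ < π := by linarith

theorem continuousOn_cot (hL : 0 < L) {x₀ : ℝ} (hx₀ : 0 < x₀) :
    ContinuousOn (fun x => cot (π / L * x)) (Icc x₀ (L / 2)) := by
  simp only [cot_eq_cos_div_sin]
  exact ContinuousOn.div (by fun_prop) (by fun_prop) fun x hx =>
    (sin_angle_pos hL ⟨hx₀.trans_le hx.1, hx.2⟩).ne'

/-- The velocity towards the origin is bounded below by the vorticity farther out. -/
theorem integral_mul_cot_le (hL : 0 < L) (hw : Continuous w) (hper : Function.Periodic w L)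
    (hodd : ∀ x, w (-x) = -w x) (hpos : ∀ x ∈ Icc 0 (L / 2), 0 ≤ w x)
    {x : ℝ} (hx : x ∈ Ioo 0 (L / 2)) :
    (2 / π) * ∫ y in x..(L / 2), w y * cot (π / L * y) ≤
      -(velocity L w x * cot (π / L * x)) := by
  obtain ⟨hint, heq⟩ := velocity_eq_logKernel hL hw hper hodd hx
  have hμ : 0 < π / L := by have := pi_pos; positivity
  have hcx : 0 ≤ cot (π / L * x) := cot_nonneg_of_mem hL ⟨hx.1.le, hx.2.le⟩
  have i1 := hint.mono_set (c := 0) (d := x) (by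
    rw [uIcc_of_le hx.1.le, uIcc_of_le (by linarith [hx.1, hx.2])]
    exact Icc_subset_Icc_right hx.2.le)
  have i2 := hint.mono_set (c := x) (d := L / 2) (by
    rw [uIcc_of_le hx.2.le, uIcc_of_le (by linarith [hx.1, hx.2])]
    exact Icc_subset_Icc_left hx.1.le)
  have hsplit := intervalIntegral.integral_add_adjacent_intervals i1 i2
  have n1 : ∀ᵐ y ∂(volume : Measure ℝ), y ∉ ({x, 0, L / 2} : Set ℝ) :=
    (Set.toFinite _).countable.ae_notMem _
  have h1 : 0 ≤ ∫ y in (0 : ℝ)..x, w y * logKernel 0 (π / L * x) (π / L * y) := by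
    refine intervalIntegral.integral_nonneg_of_ae_restrict hx.1.le ?_
    rw [EventuallyLE, ae_restrict_iff' measurableSet_Icc]
    filter_upwards [n1] with y hy1 hy
    simp only [mem_insert_iff, mem_singleton_iff, not_or] at hy1
    have hy' : y ∈ Ioo 0 (L / 2) :=
      ⟨lt_of_le_of_ne hy.1 (Ne.symm hy1.2.1), hy.2.trans_lt hx.2⟩
    exact mul_nonneg (hpos y (Ioo_subset_Icc_self hy')) (logKernel_zero_nonneg
      (angle_mem_Ioo hL hx) (angle_mem_Ioo hL hy')
      fun h => hy1.1 (mul_left_cancel₀ hμ.ne' h).symm)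
  have h2 : (∫ y in x..(L / 2), 2 * (w y * cot (π / L * y))) ≤
      ∫ y in x..(L / 2), cot (π / L * x) * (w y * logKernel 0 (π / L * x) (π / L * y)) := by
    refine intervalIntegral.integral_mono_ae_restrict hx.2.le ?_ (i2.const_mul _) ?_
    · refine ContinuousOn.intervalIntegrable ?_
      rw [uIcc_of_le hx.2.le]
      exact (hw.continuousOn.mul (continuousOn_cot hL hx.1)).const_smul (2 : ℝ)
    rw [EventuallyLE, ae_restrict_iff' measurableSet_Icc]
    filter_upwards [n1] with y hy1 hy
    simp only [mem_insert_iff, mem_singleton_iff, not_or] at hy1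
    have hy' : y ∈ Ioo 0 (L / 2) := ⟨hx.1.trans_le hy.1, lt_of_le_of_ne hy.2 hy1.2.2⟩
    have hlt : x < y := lt_of_le_of_ne hy.1 (Ne.symm hy1.1)
    have := mul_le_mul_of_nonneg_left (two_mul_cot_le (angle_mem_Ioo hL hx) (angle_mem_Ioo hL hy')
      (mul_lt_mul_of_pos_left hlt hμ)) (hpos y (Ioo_subset_Icc_self hy'))
    calc 2 * (w y * cot (π / L * y)) = w y * (2 * cot (π / L * y)) := by ring
      _ ≤ _ := this
      _ = _ := by ring
  rw [intervalIntegral.integral_const_mul, intervalIntegral.integral_const_mul] at h2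
  have h3 : 2 * (∫ y in x..(L / 2), w y * cot (π / L * y)) ≤
      π * -(velocity L w x * cot (π / L * x)) := by
    have h4 := mul_nonneg hcx h1
    rw [heq] at hsplit
    calc _ ≤ _ := h2
      _ ≤ cot (π / L * x) * (∫ y in (0 : ℝ)..x, w y * logKernel 0 (π / L * x) (π / L * y)) +
        cot (π / L * x) * ∫ y in x..(L / 2), w y * logKernel 0 (π / L * x) (π / L * y) := by
          linarith
      _ = _ := by rw [← mul_add, hsplit]; ring
  have := pi_pos
  rw [div_mul_eq_mul_div, div_le_iff₀ this]
  linarith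

end velocity

/-! ### Positivity of the stretching term -/

section quadratic

variable {L : ℝ} {w h : ℝ → ℝ} {x₀ ε : ℝ}

theorem measurable_logKernel (ε μ : ℝ) :
    Measurable fun p : ℝ × ℝ => logKernel ε (μ * p.1) (μ * p.2) := by
  unfold logKernel kernelNum kernelDen sinCosProd
  fun_prop

theorem measurable_logKernelDeriv (ε μ : ℝ) :
    Measurable fun p : ℝ × ℝ => logKernelDeriv ε (μ * p.1) (μ * p.2) := by
  unfold logKernelDeriv kernelNum kernelDen sinCosProd
  fun_prop

theorem measurable_cot_mul (μ : ℝ) : Measurable fun x : ℝ => cot (μ * x) := by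
  simp only [cot_eq_cos_div_sin]
  fun_prop

theorem sin_angle_le (hL : 0 < L) (hx₀ : 0 < x₀) {x : ℝ} (hx : x ∈ Icc x₀ (L / 2)) :
    sin (π / L * x₀) ≤ sin (π / L * x) := by
  have := pi_pos
  refine sin_le_sin_of_le_of_le_pi_div_two ?_ ?_ ?_
  · have : 0 < π / L * x₀ := by positivity
    linarith
  · calc π / L * x ≤ π / L * (L / 2) := by
          have := hx.2
          gcongr
      _ = π / 2 := by field_simp
  · have := hx.1
    gcongr

theorem abs_cot_le (hL : 0 < L) (hx₀ : 0 < x₀) {x : ℝ} (hx : x ∈ Icc x₀ (L / 2)) :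
    |cot (π / L * x)| ≤ 1 / sin (π / L * x₀) := by
  have h1 := sin_angle_pos hL ⟨hx₀, hx.1.trans hx.2⟩
  have h3 := sin_angle_pos hL ⟨hx₀.trans_le hx.1, hx.2⟩
  rw [cot_eq_cos_div_sin, abs_div, abs_of_pos h3]
  exact div_le_div₀ zero_le_one (abs_cos_le_one _) h1 (sin_angle_le hL hx₀ hx)

theorem inv_sin_sq_le (hL : 0 < L) (hx₀ : 0 < x₀) {x : ℝ} (hx : x ∈ Icc x₀ (L / 2)) :
    1 / sin (π / L * x) ^ 2 ≤ 1 / sin (π / L * x₀) ^ 2 := by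
  have h1 := sin_angle_pos hL ⟨hx₀, hx.1.trans hx.2⟩
  exact one_div_le_one_div_of_le (by positivity)
    (pow_le_pow_left₀ h1.le (sin_angle_le hL hx₀ hx) 2)

theorem hasDerivAt_cot_mul (hL : 0 < L) {x : ℝ} (hx : x ∈ Ioc 0 (L / 2)) :
    HasDerivAt (fun x => cot (π / L * x)) (-(π / L) / sin (π / L * x) ^ 2) x := by
  have hs := sin_angle_pos hL hx
  have h1 : HasDerivAt (fun z : ℝ => π / L * z) (π / L) x := by
    simpa using (hasDerivAt_id x).const_mul (π / L)
  have := h1.cos.div h1.sin hs.ne'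
  simp only [cot_eq_cos_div_sin]
  refine this.congr_deriv ?_
  have h2 := sin_sq_add_cos_sq (π / L * x)
  congr 1
  linear_combination -(π / L) * h2

theorem hasDerivAt_cot_mul_logKernel (hL : 0 < L) (hε : 0 < ε) {x y : ℝ}
    (hx : x ∈ Ioo 0 (L / 2)) (hy : y ∈ Ioo 0 (L / 2)) :
    HasDerivAt (fun x => cot (π / L * x) * logKernel ε (π / L * x) (π / L * y))
      (-(π / L * ((logKernel ε (π / L * x) (π / L * y) - logKernelDeriv ε (π / L * x) (π / L * y)) /
        sin (π / L * x) ^ 2))) x := by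
  have hs := sin_angle_pos hL ⟨hx.1, hx.2.le⟩
  have hax := angle_mem_Ioo hL hx
  have hc := cos_pos_of_mem_Ioo ⟨by linarith [hax.1, pi_pos], hax.2⟩
  have h1 : HasDerivAt (fun z : ℝ => π / L * z) (π / L) x := by
    simpa using (hasDerivAt_id x).const_mul (π / L)
  have h2 := (hasDerivAt_logKernel hε hax (angle_mem_Ioo hL hy)).comp x h1
  refine ((hasDerivAt_cot_mul hL ⟨hx.1, hx.2.le⟩).mul h2).congr_deriv ?_
  rw [cot_eq_cos_div_sin, Function.comp_apply]
  generalize sin (π / L * x) = S at *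
  generalize cos (π / L * x) = C at *
  field_simp
  ring

theorem continuousOn_cot_mul_logKernel (hL : 0 < L) (hε : 0 < ε) (hx₀ : 0 < x₀) {y : ℝ}
    (hy : y ∈ Ioo 0 (L / 2)) :
    ContinuousOn (fun x => cot (π / L * x) * logKernel ε (π / L * x) (π / L * y))
      (Icc x₀ (L / 2)) := by
  intro x hx
  refine ((continuousOn_cot hL hx₀) x hx).mul ?_
  have hby := angle_mem_Ioo hL hy
  rcases hx.2.eq_or_lt with h | h
  · -- at the midpoint the cross term vanishes and both sines are cosines of the other angle
    have hx2 : π / L * x = π / 2 := by rw [h]; field_simp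
    have hc := cos_pos_of_mem_Ioo ⟨by linarith [hby.1, pi_pos], hby.2⟩
    have hA : kernelNum ε (π / L * x) (π / L * y) ≠ 0 := by
      rw [kernelNum, sinCosProd, hx2, cos_pi_div_two, add_comm (π / 2), sin_add_pi_div_two]
      simp [hc.ne']
    have hB : kernelDen ε (π / L * x) (π / L * y) ≠ 0 := by
      rw [kernelDen, sinCosProd, hx2, cos_pi_div_two, sin_pi_div_two_sub]
      simp [hc.ne']
    refine ContinuousAt.continuousWithinAt ?_
    have cA : ContinuousAt (fun x => kernelNum ε (π / L * x) (π / L * y)) x := by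
      unfold kernelNum sinCosProd; fun_prop
    have cB : ContinuousAt (fun x => kernelDen ε (π / L * x) (π / L * y)) x := by
      unfold kernelDen sinCosProd; fun_prop
    exact ((cA.div cB hB).log (div_ne_zero hA hB)).div_const 2
  · have hax := angle_mem_Ioo hL ⟨hx₀.trans_le hx.1, h⟩
    have h1 : ContinuousAt (fun z : ℝ => π / L * z) x := by fun_prop
    exact (ContinuousAt.comp (f := fun z : ℝ => π / L * z)
      (hasDerivAt_logKernel hε hax hby).continuousAt h1).continuousWithinAt

theorem abs_logKernel_le (hε : 0 < ε) {a b : ℝ} (ha : a ∈ Ioo 0 (π / 2))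
    (hb : b ∈ Ioo 0 (π / 2)) : |logKernel ε a b| ≤ log (1 + 2 / ε) / 2 := by
  rw [abs_of_nonneg (logKernel_nonneg hε ha hb)]
  exact logKernel_le hε ha hb

theorem integrable_prod_of_bound {f : ℝ × ℝ → ℝ} (hf : Measurable f) {a b c d C : ℝ}
    (h : ∀ x ∈ Ioo a b, ∀ y ∈ Ioo c d, |f (x, y)| ≤ C) :
    Integrable f ((volume.restrict (Ioo a b)).prod (volume.restrict (Ioo c d))) := by
  refine Integrable.of_bound hf.aestronglyMeasurable C ?_
  rw [Measure.prod_restrict, ae_restrict_iff' (measurableSet_Ioo.prod measurableSet_Ioo)]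
  exact Eventually.of_forall fun p hp => h p.1 hp.1 p.2 hp.2

theorem intervalIntegral_eq_Ioo {a b : ℝ} (hab : a ≤ b) (f : ℝ → ℝ) :
    ∫ x in a..b, f x = ∫ x in Ioo a b, f x := by
  rw [intervalIntegral.integral_of_le hab, integral_Ioc_eq_integral_Ioo]

theorem integrable_deriv_mul_kernel (hL : 0 < L) (hε : 0 < ε) (hw : Continuous w) {q : ℝ → ℝ}
    (hq : ContDiff ℝ 1 q) (hx₀ : x₀ ∈ Ioo 0 (L / 2)) :
    Integrable (fun p : ℝ × ℝ => deriv q p.1 *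
      (w p.2 * (cot (π / L * p.1) * logKernel ε (π / L * p.1) (π / L * p.2))))
      ((volume.restrict (Ioo x₀ (L / 2))).prod (volume.restrict (Ioo 0 (L / 2)))) := by
  have hq' : Continuous (deriv q) := hq.continuous_deriv le_rfl
  obtain ⟨C₁, hC₁⟩ := (isCompact_Icc (a := x₀) (b := L / 2)).exists_bound_of_continuousOn
    hq'.continuousOn
  obtain ⟨C₂, hC₂⟩ := (isCompact_Icc (a := 0) (b := L / 2)).exists_bound_of_continuousOn
    hw.continuousOn
  refine integrable_prod_of_bound (C := C₁ * (C₂ * (1 / sin (π / L * x₀) *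
    (log (1 + 2 / ε) / 2)))) ?_ fun x hx y hy => ?_
  · refine Measurable.mul (hq'.measurable.comp measurable_fst) (Measurable.mul
      (hw.measurable.comp measurable_snd) (Measurable.mul ?_ (measurable_logKernel ε (π / L))))
    exact (measurable_cot_mul (π / L)).comp measurable_fst
  · have hx' : x ∈ Ioo 0 (L / 2) := ⟨hx₀.1.trans hx.1, hx.2⟩
    have h1 := hC₁ x (Ioo_subset_Icc_self hx)
    have h2 := hC₂ y (Ioo_subset_Icc_self hy)
    have h3 := abs_cot_le hL hx₀.1 (Ioo_subset_Icc_self hx)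
    have h4 := abs_logKernel_le hε (angle_mem_Ioo hL hx') (angle_mem_Ioo hL hy)
    rw [Real.norm_eq_abs] at h1 h2
    have p1 := (abs_nonneg _).trans h1
    have p2 := (abs_nonneg _).trans h2
    have p3 := (abs_nonneg _).trans h3
    have p4 := (abs_nonneg _).trans h4
    simp only [abs_mul]
    gcongr

theorem exists_symm_kernel_bound (hL : 0 < L) (hε : 0 < ε) (hw : Continuous w) {q : ℝ → ℝ}
    (hq : Continuous q) (hx₀ : x₀ ∈ Ioo 0 (L / 2)) (hq0 : ∀ x ∈ Icc 0 x₀, q x = 0) :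
    ∃ C, ∀ x ∈ Ioo 0 (L / 2), ∀ y ∈ Ioo 0 (L / 2), |q x * w y *
      ((logKernel ε (π / L * x) (π / L * y) - logKernelDeriv ε (π / L * x) (π / L * y)) /
        sin (π / L * x) ^ 2)| ≤ C := by
  obtain ⟨C₁, hC₁⟩ := (isCompact_Icc (a := 0) (b := L / 2)).exists_bound_of_continuousOn
    hq.continuousOn
  obtain ⟨C₂, hC₂⟩ := (isCompact_Icc (a := 0) (b := L / 2)).exists_bound_of_continuousOn
    hw.continuousOn
  refine ⟨C₁ * C₂ * ((log (1 + 2 / ε) / 2 + 1 / (2 * ε)) *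
    (1 / sin (π / L * x₀) ^ 2)), fun x hx y hy => ?_⟩
  have h1 := hC₁ x (Ioo_subset_Icc_self hx)
  have h2 := hC₂ y (Ioo_subset_Icc_self hy)
  have h4 := abs_logKernel_le hε (angle_mem_Ioo hL hx) (angle_mem_Ioo hL hy)
  have h5 := abs_logKernelDeriv_le hε (angle_mem_Ioo hL hx) (angle_mem_Ioo hL hy)
  rw [Real.norm_eq_abs] at h1 h2
  have p1 := (abs_nonneg _).trans h1
  have p2 := (abs_nonneg _).trans h2
  have p4 := (abs_nonneg _).trans h4
  rcases le_or_gt x x₀ with h | h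
  · simp only [hq0 x ⟨hx.1.le, h⟩, zero_mul, abs_zero]
    positivity
  · have h3 := inv_sin_sq_le hL hx₀.1 (x := x) ⟨h.le, hx.2.le⟩
    have h6 := sin_angle_pos hL ⟨hx.1, hx.2.le⟩
    have h7 : |logKernel ε (π / L * x) (π / L * y) - logKernelDeriv ε (π / L * x) (π / L * y)| ≤
        log (1 + 2 / ε) / 2 + 1 / (2 * ε) := (abs_sub _ _).trans (add_le_add h4 h5)
    have p3 : 0 ≤ 1 / sin (π / L * x) ^ 2 := by positivity
    rw [div_eq_mul_one_div]
    simp only [abs_mul, abs_of_nonneg p3]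
    gcongr

theorem measurable_symm_kernel (hw : Continuous w) {q : ℝ → ℝ} (hq : Continuous q) (ε L : ℝ) :
    Measurable (Function.uncurry fun x y => q x * w y *
      ((logKernel ε (π / L * x) (π / L * y) - logKernelDeriv ε (π / L * x) (π / L * y)) /
        sin (π / L * x) ^ 2)) :=
  Measurable.mul (Measurable.mul (hq.measurable.comp measurable_fst)
    (hw.measurable.comp measurable_snd)) (Measurable.div ((measurable_logKernel ε (π / L)).sub
    (measurable_logKernelDeriv ε (π / L))) (by fun_prop))

/-- The quadratic form of the regularized kernel is nonnegative: after an integration by parts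
and a symmetrization its kernel is pointwise nonnegative. -/
theorem integral_deriv_mul_logKernel_nonneg (hL : 0 < L) (hε : 0 < ε) (hw : ContDiff ℝ 1 w)
    (hpos : ∀ x ∈ Icc 0 (L / 2), 0 ≤ w x) (hh : ContDiff ℝ 1 h)
    (hmono : MonotoneOn h (Icc 0 (L / 2))) (hx₀ : x₀ ∈ Ioo 0 (L / 2))
    (hzero : ∀ x ∈ Icc 0 x₀, h x = 0) :
    0 ≤ ∫ x in Ioo x₀ (L / 2), deriv (fun x => h x * w x) x *
      ∫ y in Ioo 0 (L / 2), w y * (cot (π / L * x) * logKernel ε (π / L * x) (π / L * y)) := by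
  set q : ℝ → ℝ := fun x => h x * w x with hq
  have hqd : ContDiff ℝ 1 q := hh.mul hw
  have hq0 : ∀ x ∈ Icc 0 x₀, q x = 0 := fun x hx => by simp [hq, hzero x hx]
  have hμ : 0 < π / L := by have := pi_pos; positivity
  have hwc := hw.continuous
  have hqc := hqd.continuous
  set Q : ℝ → ℝ → ℝ := fun x y =>
    (logKernel ε (π / L * x) (π / L * y) - logKernelDeriv ε (π / L * x) (π / L * y)) /
      sin (π / L * x) ^ 2 with hQ
  have hh0 : ∀ x ∈ Icc 0 (L / 2), 0 ≤ h x := fun x hx => by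
    rw [← hzero 0 ⟨le_rfl, hx₀.1.le⟩]
    exact hmono ⟨le_rfl, hx.1.trans hx.2⟩ hx hx.1
  obtain ⟨C, hC⟩ := exists_symm_kernel_bound hL hε hwc hqc hx₀ hq0
  have hQm : Measurable (Function.uncurry fun x y => q x * w y * Q x y) :=
    measurable_symm_kernel hwc hqc ε L
  -- integration by parts in `x`, for each fixed `y`
  have hparts : ∀ y ∈ Ioo 0 (L / 2),
      (∫ x in Ioo x₀ (L / 2), deriv q x *
        (w y * (cot (π / L * x) * logKernel ε (π / L * x) (π / L * y)))) =
      ∫ x in Ioo x₀ (L / 2), π / L * (q x * w y * Q x y) := by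
    intro y hy
    have hK := continuousOn_cot_mul_logKernel hL hε hx₀.1 hy
    have i1 : IntegrableOn (fun x => deriv q x *
        (w y * (cot (π / L * x) * logKernel ε (π / L * x) (π / L * y)))) (Ioo x₀ (L / 2)) := by
      refine IntegrableOn.mono_set (ContinuousOn.integrableOn_Icc ?_) Ioo_subset_Icc_self
      exact (hqd.continuous_deriv le_rfl).continuousOn.mul (continuousOn_const.mul hK)
    have i2 : IntegrableOn (fun x => π / L * (q x * w y * Q x y)) (Ioo x₀ (L / 2)) := by
      refine Integrable.const_mul ?_ _
      refine Measure.integrableOn_of_bounded (s_finite := by simp) (M := C) ?_ ?_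
      · exact (hQm.comp (measurable_id.prodMk measurable_const)).aestronglyMeasurable
      · rw [ae_restrict_iff' measurableSet_Ioo]
        exact Eventually.of_forall fun x hx => hC x ⟨hx₀.1.trans hx.1, hx.2⟩ y hy
    have hd : ∀ x ∈ Ioo x₀ (L / 2), HasDerivAt
        (fun x => q x * (w y * (cot (π / L * x) * logKernel ε (π / L * x) (π / L * y))))
        (deriv q x * (w y * (cot (π / L * x) * logKernel ε (π / L * x) (π / L * y))) -
          π / L * (q x * w y * Q x y)) x := by
      intro x hx
      have hx' : x ∈ Ioo 0 (L / 2) := ⟨hx₀.1.trans hx.1, hx.2⟩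
      have h1 : HasDerivAt q (deriv q x) x := (hqd.differentiable one_ne_zero x).hasDerivAt
      refine (h1.mul ((hasDerivAt_cot_mul_logKernel hL hε hx' hy).const_mul (w y))).congr_deriv ?_
      simp only [hQ]
      ring
    have hI : IntervalIntegrable (fun x => deriv q x *
        (w y * (cot (π / L * x) * logKernel ε (π / L * x) (π / L * y))) -
          π / L * (q x * w y * Q x y)) volume x₀ (L / 2) := by
      rw [intervalIntegrable_iff_integrableOn_Ioo_of_le hx₀.2.le]
      exact i1.sub i2
    have hftc := intervalIntegral.integral_eq_sub_of_hasDerivAt_of_le hx₀.2.le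
      (hqc.continuousOn.mul (continuousOn_const.mul hK)) hd hI
    have hcot : cot (π / L * (L / 2)) = 0 := by
      have : π / L * (L / 2) = π / 2 := by field_simp
      rw [this, cot_eq_cos_div_sin, cos_pi_div_two, zero_div]
    rw [intervalIntegral_eq_Ioo hx₀.2.le, integral_sub i1 i2] at hftc
    simp only [Pi.mul_apply] at hftc
    rw [hcot, hq0 x₀ ⟨hx₀.1.le, le_rfl⟩] at hftc
    simp only [zero_mul, mul_zero, sub_zero] at hftc
    linarith
  have hint := integrable_deriv_mul_kernel hL hε hwc hqd hx₀
  have hint2 : Integrable (Function.uncurry fun x y => q x * w y * Q x y)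
      ((volume.restrict (Ioo 0 (L / 2))).prod (volume.restrict (Ioo 0 (L / 2)))) :=
    integrable_prod_of_bound hQm hC
  have hint3 : Integrable (Function.uncurry fun x y => π / L * (q x * w y * Q x y))
      ((volume.restrict (Ioo x₀ (L / 2))).prod (volume.restrict (Ioo 0 (L / 2)))) :=
    (integrable_prod_of_bound hQm fun x hx y hy =>
      hC x ⟨hx₀.1.trans hx.1, hx.2⟩ y hy).const_mul _
  have e1 : (∫ x in Ioo x₀ (L / 2), deriv q x *
      ∫ y in Ioo 0 (L / 2), w y * (cot (π / L * x) * logKernel ε (π / L * x) (π / L * y))) =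
      π / L * ∫ x in Ioo x₀ (L / 2), ∫ y in Ioo 0 (L / 2), q x * w y * Q x y := by
    simp only [← integral_const_mul]
    rw [integral_integral_swap hint, setIntegral_congr_fun measurableSet_Ioo hparts,
      ← integral_integral_swap hint3]
  -- `q` vanishes up to `x₀`, so the domain of integration can be made symmetric
  have e2 : (∫ x in Ioo x₀ (L / 2), ∫ y in Ioo 0 (L / 2), q x * w y * Q x y) =
      ∫ x in Ioo 0 (L / 2), ∫ y in Ioo 0 (L / 2), q x * w y * Q x y := by
    refine (setIntegral_eq_of_subset_of_forall_sdiff_eq_zero measurableSet_Ioo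
      (Ioo_subset_Ioo_left hx₀.1.le) fun x hx => ?_).symm
    have : x ≤ x₀ := not_lt.1 fun h => hx.2 ⟨h, hx.1.2⟩
    simp [hq0 x ⟨hx.1.1.le, this⟩]
  rw [e1, e2]
  refine mul_nonneg hμ.le ?_
  -- symmetrization: the form equals its own transpose
  have e3 : (∫ x in Ioo 0 (L / 2), ∫ y in Ioo 0 (L / 2), q x * w y * Q x y) =
      ∫ x in Ioo 0 (L / 2), ∫ y in Ioo 0 (L / 2), q y * w x * Q y x :=
    integral_integral_swap hint2
  have e4 : 0 ≤ (∫ x in Ioo 0 (L / 2), ∫ y in Ioo 0 (L / 2), q x * w y * Q x y) +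
      ∫ x in Ioo 0 (L / 2), ∫ y in Ioo 0 (L / 2), q y * w x * Q y x := by
    have hint2' : Integrable (Function.uncurry fun x y => q y * w x * Q y x)
        ((volume.restrict (Ioo 0 (L / 2))).prod (volume.restrict (Ioo 0 (L / 2)))) := hint2.swap
    have hadd := integral_add hint2.integral_prod_left hint2'.integral_prod_left
    simp only [Function.uncurry_apply_pair] at hadd
    rw [← hadd]
    refine integral_nonneg_of_ae ?_
    filter_upwards [hint2.prod_right_ae, hint2'.prod_right_ae, ae_restrict_mem measurableSet_Ioo]
      with x h1' h2' hx
    simp only [Function.uncurry_apply_pair] at h1' h2'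
    simp only [Pi.zero_apply]
    rw [← integral_add h1' h2']
    refine setIntegral_nonneg measurableSet_Ioo fun y hy => ?_
    have hμx := angle_mem_Ioo hL hx
    have hμy := angle_mem_Ioo hL hy
    have inv : ∀ z, π / L * z / (π / L) = z := fun z => by field_simp
    have back : ∀ a ∈ Ioo 0 (π / 2), a / (π / L) ∈ Ioo 0 (L / 2) := fun a ha =>
      ⟨div_pos ha.1 hμ, by
        rw [div_lt_iff₀ hμ]
        calc a < π / 2 := ha.2
          _ = L / 2 * (π / L) := by field_simp⟩
    have hsym := symm_kernel_nonneg hε (f := fun a => h (a / (π / L)))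
      (fun a ha b hb hab => hmono (Ioo_subset_Icc_self (back a ha))
        (Ioo_subset_Icc_self (back b hb)) (div_le_div_of_nonneg_right hab hμ.le))
      (fun a ha => hh0 _ (Ioo_subset_Icc_self (back a ha))) hμx hμy
    simp only [inv] at hsym
    have := mul_nonneg (mul_nonneg (hpos x (Ioo_subset_Icc_self hx))
      (hpos y (Ioo_subset_Icc_self hy))) hsym
    refine this.trans (le_of_eq ?_)
    simp only [hq, hQ]
    ring
  linarith

end quadratic

section quadraticLimit

variable {L : ℝ} {w h : ℝ → ℝ} {x₀ : ℝ}

theorem tendsto_logKernel {a b : ℝ} (ha : a ∈ Ioo 0 (π / 2)) (hb : b ∈ Ioo 0 (π / 2))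
    (hab : a ≠ b) :
    Tendsto (fun ε => logKernel ε a b) (𝓝[>] 0) (𝓝 (logKernel 0 a b)) := by
  have hm := (sin_sub_sq_pos ha hb hab).ne'
  have hn : 0 < sin (a + b) :=
    sin_pos_of_pos_of_lt_pi (by linarith [ha.1, hb.1]) (by linarith [ha.2, hb.2])
  have c : ContinuousAt (fun ε => logKernel ε a b) 0 := by
    have cA : ContinuousAt (fun ε => kernelNum ε a b) 0 := by unfold kernelNum; fun_prop
    have cB : ContinuousAt (fun ε => kernelDen ε a b) 0 := by unfold kernelDen; fun_prop
    have hA : kernelNum 0 a b ≠ 0 := by simp [kernelNum, hn.ne']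
    have hB : kernelDen 0 a b ≠ 0 := by simpa [kernelDen] using hm
    exact ((cA.div cB hB).log (div_ne_zero hA hB)).div_const 2
  exact c.tendsto.mono_left nhdsWithin_le_nhds

/-- The inner integral of the regularized form, its monotone bound and its limit. -/
theorem tendsto_integral_logKernel (hL : 0 < L) (hw : Continuous w) (hper : Function.Periodic w L)
    (hodd : ∀ x, w (-x) = -w x) (hpos : ∀ x ∈ Icc 0 (L / 2), 0 ≤ w x)
    {x : ℝ} (hx : x ∈ Ioo 0 (L / 2)) :
    (∀ ε > 0, |∫ y in Ioo 0 (L / 2),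
      w y * (cot (π / L * x) * logKernel ε (π / L * x) (π / L * y))| ≤
        -(π * (velocity L w x * cot (π / L * x)))) ∧
    Tendsto (fun ε => ∫ y in Ioo 0 (L / 2),
      w y * (cot (π / L * x) * logKernel ε (π / L * x) (π / L * y))) (𝓝[>] 0)
      (𝓝 (-(π * (velocity L w x * cot (π / L * x))))) := by
  obtain ⟨hint, heq⟩ := velocity_eq_logKernel hL hw hper hodd hx
  have hL2 : (0 : ℝ) ≤ L / 2 := by positivity
  have hμ : 0 < π / L := by have := pi_pos; positivity
  have hc : 0 ≤ cot (π / L * x) := cot_nonneg_of_mem hL ⟨hx.1.le, hx.2.le⟩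
  have hbd : Integrable (fun y => w y * (cot (π / L * x) * logKernel 0 (π / L * x) (π / L * y)))
      (volume.restrict (Ioo 0 (L / 2))) := by
    rw [intervalIntegrable_iff_integrableOn_Ioo_of_le hL2] at hint
    have := Integrable.const_mul hint (cot (π / L * x))
    refine this.congr (Eventually.of_forall fun y => ?_)
    ring
  have heq' : (∫ y in Ioo 0 (L / 2),
      w y * (cot (π / L * x) * logKernel 0 (π / L * x) (π / L * y))) =
      -(π * (velocity L w x * cot (π / L * x))) := by
    rw [intervalIntegral_eq_Ioo hL2] at heq
    have : ∀ y, w y * (cot (π / L * x) * logKernel 0 (π / L * x) (π / L * y)) =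
      cot (π / L * x) * (w y * logKernel 0 (π / L * x) (π / L * y)) := fun y => by ring
    simp only [this]
    rw [integral_const_mul, heq]
    ring
  have hne : ∀ᵐ y ∂(volume.restrict (Ioo 0 (L / 2))), π / L * x ≠ π / L * y := by
    have n1 : ∀ᵐ y ∂(volume : Measure ℝ), y ∉ ({x} : Set ℝ) :=
      (Set.toFinite _).countable.ae_notMem _
    filter_upwards [ae_restrict_of_ae n1] with y hy h
    exact hy (mul_left_cancel₀ hμ.ne' h).symm
  have hmeas : ∀ ε, AEStronglyMeasurable
      (fun y => w y * (cot (π / L * x) * logKernel ε (π / L * x) (π / L * y)))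
      (volume.restrict (Ioo 0 (L / 2))) := fun ε =>
    (hw.measurable.mul (((measurable_logKernel ε (π / L)).comp
      (measurable_const.prodMk measurable_id)).const_mul _)).aestronglyMeasurable
  have hle : ∀ ε > 0, ∀ᵐ y ∂(volume.restrict (Ioo 0 (L / 2))),
      ‖w y * (cot (π / L * x) * logKernel ε (π / L * x) (π / L * y))‖ ≤
      w y * (cot (π / L * x) * logKernel 0 (π / L * x) (π / L * y)) := by
    intro ε hε
    filter_upwards [hne, ae_restrict_mem measurableSet_Ioo] with y hy1 hy
    have ha := angle_mem_Ioo hL hx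
    have hb := angle_mem_Ioo hL hy
    have hwy := hpos y (Ioo_subset_Icc_self hy)
    have h1 := logKernel_nonneg hε ha hb
    have h2 := logKernel_le_logKernel_zero hε ha hb hy1
    rw [Real.norm_of_nonneg (by positivity)]
    gcongr
  refine ⟨fun ε hε => ?_, ?_⟩
  · rw [← heq', ← Real.norm_eq_abs]
    exact norm_integral_le_of_norm_le hbd (hle ε hε)
  · rw [← heq']
    refine tendsto_integral_filter_of_dominated_convergence _ (Eventually.of_forall hmeas) ?_ hbd ?_
    · filter_upwards [self_mem_nhdsWithin] with ε hε using hle ε hε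
    · filter_upwards [hne, ae_restrict_mem measurableSet_Ioo] with y hy1 hy
      exact ((tendsto_logKernel (angle_mem_Ioo hL hx) (angle_mem_Ioo hL hy) hy1).const_mul
        _).const_mul _

theorem continuous_velocity (hL : 0 < L) (hw : ContDiff ℝ 1 w) (hper : Function.Periodic w L) :
    Continuous (velocity L w) :=
  continuous_iff_continuousAt.2 fun x => (hasDerivAt_velocity hL hw hper x).continuousAt

/-- The stretching term `∫ h w ∂ₓ(u cot)` is nonnegative for monotone `h ≥ 0`. It is written here
after an integration by parts, so that no principal value appears. -/
theorem integral_deriv_mul_velocity_nonpos (hL : 0 < L) (hw : ContDiff ℝ 1 w)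
    (hper : Function.Periodic w L) (hodd : ∀ x, w (-x) = -w x)
    (hpos : ∀ x ∈ Icc 0 (L / 2), 0 ≤ w x) (hh : ContDiff ℝ 1 h)
    (hmono : MonotoneOn h (Icc 0 (L / 2))) (hx₀ : x₀ ∈ Ioo 0 (L / 2))
    (hzero : ∀ x ∈ Icc 0 x₀, h x = 0) :
    (∫ x in x₀..(L / 2), deriv (fun x => h x * w x) x *
      (velocity L w x * cot (π / L * x))) ≤ 0 := by
  have hq : ContDiff ℝ 1 fun x => h x * w x := hh.mul hw
  have hq' : Continuous (deriv fun x => h x * w x) := hq.continuous_deriv le_rfl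
  have hucot : ContinuousOn (fun x => velocity L w x * cot (π / L * x)) (Icc x₀ (L / 2)) :=
    (continuous_velocity hL hw hper).continuousOn.mul (continuousOn_cot hL hx₀.1)
  have hlim : Tendsto (fun ε => ∫ x in Ioo x₀ (L / 2), deriv (fun x => h x * w x) x *
      ∫ y in Ioo 0 (L / 2), w y * (cot (π / L * x) * logKernel ε (π / L * x) (π / L * y)))
      (𝓝[>] 0) (𝓝 (∫ x in Ioo x₀ (L / 2), deriv (fun x => h x * w x) x *
        -(π * (velocity L w x * cot (π / L * x))))) := by
    refine tendsto_integral_filter_of_dominated_convergence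
      (fun x => |deriv (fun x => h x * w x) x| * -(π * (velocity L w x * cot (π / L * x))))
      ?_ ?_ ?_ ?_
    · filter_upwards [self_mem_nhdsWithin] with ε hε
      have := (integrable_deriv_mul_kernel hL hε hw.continuous hq hx₀).integral_prod_left
      simp only [integral_const_mul] at this
      exact this.aestronglyMeasurable
    · filter_upwards [self_mem_nhdsWithin] with ε hε
      filter_upwards [ae_restrict_mem measurableSet_Ioo] with x hx
      rw [norm_mul, Real.norm_eq_abs, Real.norm_eq_abs]
      exact mul_le_mul_of_nonneg_left ((tendsto_integral_logKernel hL hw.continuous hper hodd hpos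
        ⟨hx₀.1.trans hx.1, hx.2⟩).1 ε hε) (abs_nonneg _)
    · exact (ContinuousOn.integrableOn_Icc (hq'.abs.continuousOn.mul
        (continuousOn_const.mul hucot).neg)).mono_set Ioo_subset_Icc_self
    · filter_upwards [ae_restrict_mem measurableSet_Ioo] with x hx
      exact (tendsto_integral_logKernel hL hw.continuous hper hodd hpos
        ⟨hx₀.1.trans hx.1, hx.2⟩).2.const_mul _
  have hge := ge_of_tendsto hlim (by
    filter_upwards [self_mem_nhdsWithin] with ε hε
    exact integral_deriv_mul_logKernel_nonneg hL hε hw hpos hh hmono hx₀ hzero)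
  have e : ∀ x, deriv (fun x => h x * w x) x * -(π * (velocity L w x * cot (π / L * x))) =
      -π * (deriv (fun x => h x * w x) x * (velocity L w x * cot (π / L * x))) := fun x => by ring
  simp only [e] at hge
  rw [integral_const_mul] at hge
  rw [intervalIntegral_eq_Ioo hx₀.2.le]
  have := pi_pos
  nlinarith

end quadraticLimit

/-! ### Square integrable bounds for the velocity and the Hilbert transform -/

section fourier

theorem hasDerivAt_sin_mul_log_sin_mul_cos (n : ℕ) {t : ℝ} (ht : t ∈ Ioo 0 π) :
    HasDerivAt (fun t => sin t * log (sin t) * cos ((2 * n + 1) * t))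
      ((cos (2 * n * t) + cos (2 * (n + 1) * t)) / 2 +
        ((n + 1) * (log (sin t) * cos (2 * (n + 1) * t)) - n * (log (sin t) * cos (2 * n * t))))
      t := by
  have hs := sin_pos_of_pos_of_lt_pi ht.1 ht.2
  have h1 : HasDerivAt (fun t : ℝ => (2 * n + 1) * t) (2 * n + 1 : ℝ) t := by
    simpa using (hasDerivAt_id t).const_mul (2 * n + 1 : ℝ)
  refine (((hasDerivAt_sin t).mul ((hasDerivAt_sin t).log hs.ne')).mul h1.cos).congr_deriv ?_
  have e1 : cos (2 * n * t) = cos ((2 * n + 1) * t) * cos t + sin ((2 * n + 1) * t) * sin t := by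
    rw [← cos_sub]; congr 1; ring
  have e2 : cos (2 * (n + 1) * t) =
      cos ((2 * n + 1) * t) * cos t - sin ((2 * n + 1) * t) * sin t := by
    rw [← cos_add]; congr 1; ring
  simp only [e1, e2, Pi.mul_apply]
  field_simp
  ring

theorem intervalIntegrable_log_sin_mul_cos (c a b : ℝ) :
    IntervalIntegrable (fun t => log (sin t) * cos (c * t)) volume a b :=
  IntervalIntegrable.mul_continuousOn (f := fun t => log (sin t)) intervalIntegrable_log_sin
    (by fun_prop)

/-- The recursion between consecutive cosine coefficients of `log sin`, obtained by integrating
the derivative of `sin t log (sin t) cos ((2 n + 1) t)`. -/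
theorem integral_log_sin_mul_cos_succ (n : ℕ) :
    (n + 1) * (∫ t in (0 : ℝ)..π, log (sin t) * cos (2 * (n + 1) * t)) =
      n * (∫ t in (0 : ℝ)..π, log (sin t) * cos (2 * n * t)) -
        ∫ t in (0 : ℝ)..π, (cos (2 * n * t) + cos (2 * (n + 1) * t)) / 2 := by
  have i1 := (intervalIntegrable_log_sin_mul_cos (2 * (n + 1)) 0 π).const_mul (n + 1 : ℝ)
  have i2 := (intervalIntegrable_log_sin_mul_cos (2 * n) 0 π).const_mul (n : ℝ)
  have i3 : IntervalIntegrable (fun t : ℝ => (cos (2 * n * t) + cos (2 * (n + 1) * t)) / 2)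
      volume 0 π := Continuous.intervalIntegrable (by fun_prop) _ _
  have hc : Continuous fun t => sin t * log (sin t) * cos ((2 * n + 1) * t) :=
    (continuous_mul_log.comp continuous_sin).mul (by fun_prop)
  have h := intervalIntegral.integral_eq_sub_of_hasDerivAt_of_le pi_pos.le hc.continuousOn
    (fun t ht => hasDerivAt_sin_mul_log_sin_mul_cos n ht) (i3.add (i1.sub i2))
  rw [intervalIntegral.integral_add i3 (i1.sub i2), intervalIntegral.integral_sub i1 i2,
    intervalIntegral.integral_const_mul, intervalIntegral.integral_const_mul] at h
  simp only [sin_pi, sin_zero, zero_mul, sub_zero] at h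
  linarith

theorem integral_cos_two_mul_nat {n : ℕ} (hn : n ≠ 0) :
    ∫ t in (0 : ℝ)..π, cos (2 * n * t) = 0 := by
  have h2 : (2 * n : ℝ) ≠ 0 := by positivity
  rw [intervalIntegral.integral_comp_mul_left _ h2, integral_cos]
  have : (2 * n : ℝ) * π = (2 * n : ℕ) * π := by push_cast; ring
  rw [this, sin_nat_mul_pi]
  simp

theorem nat_mul_integral_log_sin_mul_cos (n : ℕ) :
    (n + 1) * (∫ t in (0 : ℝ)..π, log (sin t) * cos (2 * (n + 1) * t)) = -(π / 2) := by
  have hi : ∀ c : ℝ, IntervalIntegrable (fun t => cos (c * t)) volume 0 π := fun c =>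
    Continuous.intervalIntegrable (by fun_prop) _ _
  induction n with
  | zero =>
    rw [integral_log_sin_mul_cos_succ, intervalIntegral.integral_div,
      intervalIntegral.integral_add (hi _) (hi _)]
    have := integral_cos_two_mul_nat one_ne_zero
    push_cast at this ⊢
    rw [zero_add, this]
    simp
  | succ k ih =>
    rw [integral_log_sin_mul_cos_succ, intervalIntegral.integral_div,
      intervalIntegral.integral_add (hi _) (hi _)]
    have h1 := integral_cos_two_mul_nat (Nat.succ_ne_zero k)
    have h2 := integral_cos_two_mul_nat (Nat.succ_ne_zero (k + 1))
    push_cast at h1 h2 ih ⊢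
    rw [h1, h2, ih]
    simp

variable {L : ℝ}

/-- The character `exp (-2 π i n x / L)`. -/
noncomputable def character (L : ℝ) (n : ℤ) (x : ℝ) : ℂ :=
  Complex.exp ((-(2 * π * n / L * x) : ℝ) * Complex.I)

/-- The Fourier coefficient of the kernel `log |sin (π z / L)|`, not normalized. -/
noncomputable def kernelCoeff (L : ℝ) (n : ℤ) : ℂ :=
  ∫ z in (-(L / 2))..(L / 2), (log (sin (π / L * z)) : ℂ) * character L n z

theorem continuous_character (L : ℝ) (n : ℤ) : Continuous (character L n) := by
  unfold character; fun_prop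

theorem norm_character (L : ℝ) (n : ℤ) (x : ℝ) : ‖character L n x‖ = 1 :=
  Complex.norm_exp_ofReal_mul_I _

theorem character_add (L : ℝ) (n : ℤ) (x y : ℝ) :
    character L n (x + y) = character L n x * character L n y := by
  rw [character, character, character, ← Complex.exp_add]
  congr 1
  push_cast
  ring

theorem character_eq (L : ℝ) (n : ℤ) (x : ℝ) : character L n x =
    (cos (2 * π * n / L * x) : ℂ) - (sin (2 * π * n / L * x) : ℂ) * Complex.I := by
  rw [character, Complex.exp_mul_I, ← Complex.ofReal_cos, ← Complex.ofReal_sin, cos_neg, sin_neg]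
  push_cast
  ring

theorem character_periodic (hL : 0 < L) (n : ℤ) : Function.Periodic (character L n) L := by
  intro x
  rw [character_eq, character_eq]
  have : 2 * π * n / L * (x + L) = 2 * π * n / L * x + n * (2 * π) := by field_simp
  rw [this, cos_add_int_mul_two_pi, sin_add_int_mul_two_pi]

theorem kernelCoeff_eq (hL : 0 < L) (n : ℤ) :
    kernelCoeff L n = ((L / π * ∫ t in (0 : ℝ)..π, log (sin t) * cos (2 * n * t) : ℝ) : ℂ) := by
  have hpi := pi_pos
  have hμ : π / L ≠ 0 := by positivity
  have hk := kernel_integrable hL (-(L / 2)) (L / 2)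
  have i1 : IntervalIntegrable (fun z => log (sin (π / L * z)) * cos (2 * π * n / L * z))
      volume (-(L / 2)) (L / 2) := hk.mul_continuousOn (by fun_prop)
  have i2 : IntervalIntegrable (fun z => log (sin (π / L * z)) * sin (2 * π * n / L * z))
      volume (-(L / 2)) (L / 2) := hk.mul_continuousOn (by fun_prop)
  have e : ∀ z, (log (sin (π / L * z)) : ℂ) * character L n z =
      ((log (sin (π / L * z)) * cos (2 * π * n / L * z) : ℝ) : ℂ) -
        ((log (sin (π / L * z)) * sin (2 * π * n / L * z) : ℝ) : ℂ) * Complex.I := by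
    intro z
    rw [character_eq]
    push_cast
    ring
  have hodd : (∫ z in (-(L / 2))..(L / 2), log (sin (π / L * z)) * sin (2 * π * n / L * z)) = 0 := by
    have := intervalIntegral.integral_comp_neg (a := -(L / 2)) (b := L / 2)
      (fun z => log (sin (π / L * z)) * sin (2 * π * n / L * z))
    simp only [mul_neg, sin_neg, log_neg_eq_log, neg_neg, intervalIntegral.integral_neg] at this
    linarith
  have hper : Function.Periodic
      (fun z => log (sin (π / L * z)) * cos (2 * π * n / L * z)) L := by
    intro z
    have h1 : π / L * (z + L) = π / L * z + π := by field_simp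
    have h2 : 2 * π * n / L * (z + L) = 2 * π * n / L * z + n * (2 * π) := by field_simp
    simp only [h1, h2, sin_add_pi, log_neg_eq_log, cos_add_int_mul_two_pi]
  have hshift := hper.intervalIntegral_add_eq (-(L / 2)) 0
  rw [show -(L / 2) + L = L / 2 by ring, zero_add] at hshift
  have hscale := intervalIntegral.integral_comp_mul_left (a := 0) (b := L)
    (fun t => log (sin t) * cos (2 * n * t)) hμ
  rw [mul_zero, show π / L * L = π by field_simp] at hscale
  have e2 : ∀ z, cos (2 * n * (π / L * z)) = cos (2 * π * n / L * z) := fun z => by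
    congr 1; ring
  simp only [e2] at hscale
  have j1 : IntervalIntegrable (fun z =>
      ((log (sin (π / L * z)) * cos (2 * π * n / L * z) : ℝ) : ℂ)) volume (-(L / 2)) (L / 2) :=
    ⟨i1.1.ofReal, i1.2.ofReal⟩
  have j2 : IntervalIntegrable (fun z =>
      ((log (sin (π / L * z)) * sin (2 * π * n / L * z) : ℝ) : ℂ)) volume (-(L / 2)) (L / 2) :=
    ⟨i2.1.ofReal, i2.2.ofReal⟩
  unfold kernelCoeff
  simp only [e]
  rw [intervalIntegral.integral_sub j1 (j2.mul_const _),
    intervalIntegral.integral_mul_const, intervalIntegral.integral_ofReal,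
    intervalIntegral.integral_ofReal, hodd, hshift, hscale]
  simp

theorem norm_mul_kernelCoeff_le (hL : 0 < L) (n : ℤ) : |(n : ℝ)| * ‖kernelCoeff L n‖ ≤ L / 2 := by
  have hpi := pi_pos
  rcases Nat.eq_zero_or_pos n.natAbs with h | h
  · rw [Int.natAbs_eq_zero] at h
    simp only [h, Int.cast_zero, abs_zero, zero_mul]
    positivity
  · obtain ⟨m, hm⟩ := Nat.exists_eq_succ_of_ne_zero h.ne'
    have hn : |(n : ℝ)| = m + 1 := by
      rw [← Int.cast_abs, Int.abs_eq_natAbs, hm]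
      push_cast
      ring
    have hcos : ∀ t, cos (2 * n * t) = cos (2 * (m + 1) * t) := by
      intro t
      rw [← hn]
      rcases abs_choice (n : ℝ) with h' | h' <;> rw [h']
      rw [← cos_neg]
      congr 1
      ring
    have h3 := nat_mul_integral_log_sin_mul_cos m
    rw [kernelCoeff_eq hL, hn]
    simp only [hcos]
    rw [Complex.norm_real, norm_mul, Real.norm_of_nonneg (by positivity : 0 ≤ L / π)]
    have h4 := congrArg norm h3
    rw [norm_mul, norm_neg, Real.norm_of_nonneg (by positivity : (0 : ℝ) ≤ m + 1),
      Real.norm_of_nonneg (by positivity : 0 ≤ π / 2)] at h4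
    calc _ = L / π * ((m + 1) * ‖∫ t in (0 : ℝ)..π, log (sin t) * cos (2 * (m + 1) * t)‖) := by ring
      _ = L / 2 := by rw [h4]; field_simp
      _ ≤ L / 2 := le_rfl

theorem norm_kernelCoeff_le (hL : 0 < L) (n : ℤ) :
    ‖kernelCoeff L n‖ ≤ ∫ z in (-(L / 2))..(L / 2), |log (sin (π / L * z))| := by
  unfold kernelCoeff
  refine (intervalIntegral.norm_integral_le_integral_norm (by linarith)).trans (le_of_eq ?_)
  congr 1
  funext z
  rw [norm_mul, norm_character, mul_one, Complex.norm_real, Real.norm_eq_abs]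

theorem fourierCoeffOn_eq_character (hL : 0 < L) (f : ℝ → ℝ) (n : ℤ) :
    fourierCoeffOn hL (fun x => (f x : ℂ)) n =
      (1 / L : ℂ) * ∫ x in (0 : ℝ)..L, character L n x * f x := by
  rw [fourierCoeffOn_eq_integral, sub_zero, Complex.real_smul]
  push_cast
  congr 2
  funext x
  rw [fourier_coe_apply, smul_eq_mul, character]
  congr 2
  push_cast
  ring

theorem exists_bound_of_periodic {f : ℝ → ℝ} (hL : 0 < L) (hf : Continuous f)
    (hper : Function.Periodic f L) : ∃ M, ∀ x, |f x| ≤ M := by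
  obtain ⟨M, hM⟩ := (hper.isBounded_of_continuous hL.ne' hf).exists_norm_le
  exact ⟨M, fun x => hM _ ⟨x, rfl⟩⟩

/-- The Biot–Savart law is a convolution, hence a Fourier multiplier. -/
theorem fourierCoeffOn_velocity (hL : 0 < L) {w : ℝ → ℝ} (hw : Continuous w)
    (hper : Function.Periodic w L) (n : ℤ) :
    fourierCoeffOn hL (fun x => (velocity L w x : ℂ)) n =
      (1 / π : ℂ) * kernelCoeff L n * fourierCoeffOn hL (fun x => (w x : ℂ)) n := by
  obtain ⟨M, hM⟩ := exists_bound_of_periodic hL hw hper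
  have hchar := continuous_character L n
  have hL2 : -(L / 2) ≤ L / 2 := by linarith
  have hk : IntegrableOn (fun z => log (sin (π / L * z))) (Ioc (-(L / 2)) (L / 2)) :=
    (intervalIntegrable_iff_integrableOn_Ioc_of_le hL2).1 (kernel_integrable hL _ _)
  rw [fourierCoeffOn_eq_character, fourierCoeffOn_eq_character]
  have hint : Integrable (Function.uncurry fun x z =>
      (character L n x * w (x - z) : ℂ) * (log (sin (π / L * z)) : ℂ))
      ((volume.restrict (Ioc 0 L)).prod (volume.restrict (Ioc (-(L / 2)) (L / 2)))) := by
    have h1 : Integrable (fun p : ℝ × ℝ => (1 : ℂ) * (log (sin (π / L * p.2)) : ℂ))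
        ((volume.restrict (Ioc 0 L)).prod (volume.restrict (Ioc (-(L / 2)) (L / 2)))) :=
      Integrable.mul_prod (f := fun _ => (1 : ℂ)) (integrable_const _) hk.ofReal
    simp only [one_mul] at h1
    refine h1.bdd_mul (c := M) (Continuous.aestronglyMeasurable ?_)
      (Eventually.of_forall fun p => ?_)
    · exact (hchar.comp continuous_fst).mul
        (Complex.continuous_ofReal.comp (hw.comp (continuous_fst.sub continuous_snd)))
    · rw [norm_mul, norm_character, one_mul, Complex.norm_real]
      exact hM _
  have e1 : ∀ x, character L n x * (velocity L w x : ℂ) = (1 / π : ℂ) *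
      ∫ z in Ioc (-(L / 2)) (L / 2),
        (character L n x * w (x - z) : ℂ) * (log (sin (π / L * z)) : ℂ) := by
    intro x
    rw [velocity_eq_centered hL hper, intervalIntegral.integral_of_le hL2]
    push_cast
    rw [← integral_complex_ofReal]
    have : ∀ z, (character L n x * w (x - z) : ℂ) * (log (sin (π / L * z)) : ℂ) =
      character L n x * ((w (x - z) * log (sin (π / L * z)) : ℝ) : ℂ) := fun z => by
        push_cast; ring
    simp only [this]
    rw [integral_const_mul]
    ring
  have e2 : ∀ z, (∫ x in Ioc 0 L,
      (character L n x * w (x - z) : ℂ) * (log (sin (π / L * z)) : ℂ)) =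
      ((log (sin (π / L * z)) : ℂ) * character L n z) *
        ∫ x in (0 : ℝ)..L, character L n x * w x := by
    intro z
    rw [integral_mul_const, ← intervalIntegral.integral_of_le hL.le]
    have h1 : ∀ x, (character L n x * w (x - z) : ℂ) =
        character L n z * (character L n (x - z) * w (x - z)) := by
      intro x
      rw [← mul_assoc, ← character_add]
      congr 2
      ring
    simp only [h1]
    rw [intervalIntegral.integral_const_mul,
      intervalIntegral.integral_comp_sub_right (fun x => character L n x * (w x : ℂ)) z]
    have hp : Function.Periodic (fun x => character L n x * (w x : ℂ)) L := by
      intro x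
      simp only [character_periodic hL n x, hper x]
    have h2 := hp.intervalIntegral_add_eq (0 - z) 0
    rw [show 0 - z + L = L - z by ring, zero_add] at h2
    rw [h2]
    ring
  have e3 : (∫ x in (0 : ℝ)..L, character L n x * (velocity L w x : ℂ)) =
      (1 / π : ℂ) * (kernelCoeff L n * ∫ x in (0 : ℝ)..L, character L n x * w x) := by
    simp only [e1]
    rw [intervalIntegral.integral_const_mul, intervalIntegral.integral_of_le hL.le,
      integral_integral_swap hint]
    simp only [e2]
    rw [integral_mul_const, kernelCoeff, intervalIntegral.integral_of_le hL2]
  rw [e3]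
  ring

theorem hasSum_sq_norm_fourierCoeffOn (hL : 0 < L) {f : ℝ → ℝ} (hf : Continuous f) :
    HasSum (fun n => ‖fourierCoeffOn hL (fun x => (f x : ℂ)) n‖ ^ 2)
      (L⁻¹ * ∫ x in (0 : ℝ)..L, f x ^ 2) := by
  obtain ⟨C, hC⟩ := (isCompact_Icc (a := 0) (b := L)).exists_bound_of_continuousOn hf.continuousOn
  have h := hasSum_sq_fourierCoeffOn (f := fun x => (f x : ℂ)) hL (MemLp.of_bound
    (Complex.continuous_ofReal.comp hf).aestronglyMeasurable C (by
      rw [ae_restrict_iff' measurableSet_Ioc]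
      refine Eventually.of_forall fun x hx => ?_
      rw [Complex.norm_real]
      exact hC x (Ioc_subset_Icc_self hx)))
  simpa [sub_zero, smul_eq_mul, Complex.norm_real, sq_abs] using h

theorem deriv_periodic {f : ℝ → ℝ} (hper : Function.Periodic f L) :
    Function.Periodic (deriv f) L := by
  intro x
  rw [← deriv_comp_add_const]
  congr 1
  exact funext hper

theorem velocity_periodic (hL : 0 < L) {w : ℝ → ℝ} (hper : Function.Periodic w L) :
    Function.Periodic (velocity L w) L := by
  intro x
  rw [velocity_eq_centered hL hper, velocity_eq_centered hL hper]
  congr 2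
  funext z
  rw [show x + L - z = x - z + L by ring, hper]

theorem deriv_velocity (hL : 0 < L) {w : ℝ → ℝ} (hw : ContDiff ℝ 1 w)
    (hper : Function.Periodic w L) (x : ℝ) : deriv (velocity L w) x =
      (1 / π) * ∫ z in (-(L / 2))..(L / 2), deriv w (x - z) * log (sin (π / L * z)) :=
  (hasDerivAt_velocity hL hw hper x).deriv

theorem continuous_deriv_velocity (hL : 0 < L) {w : ℝ → ℝ} (hw : ContDiff ℝ 1 w)
    (hper : Function.Periodic w L) : Continuous (deriv (velocity L w)) := by
  rw [funext (deriv_velocity hL hw hper)]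
  refine continuous_const.mul ?_
  have hd : Continuous (deriv w) := hw.continuous_deriv le_rfl
  obtain ⟨M, hM⟩ := exists_bound_of_periodic hL hd (deriv_periodic hper)
  have hk := kernel_integrable hL (-(L / 2)) (L / 2)
  refine intervalIntegral.continuous_of_dominated_interval
    (bound := fun z => M * |log (sin (π / L * z))|) (fun x => ?_) (fun x => ?_)
    (hk.abs.const_mul M) ?_
  · exact (Continuous.aestronglyMeasurable (by fun_prop)).mul
      (intervalIntegrable_iff.mp hk).aestronglyMeasurable
  · refine Eventually.of_forall fun z _ => ?_
    rw [norm_mul, Real.norm_eq_abs, Real.norm_eq_abs]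
    exact mul_le_mul_of_nonneg_right (hM _) (abs_nonneg _)
  · exact Eventually.of_forall fun z _ => by fun_prop

theorem abs_deriv_velocity_le (hL : 0 < L) {w : ℝ → ℝ} (hw : ContDiff ℝ 1 w)
    (hper : Function.Periodic w L) {M : ℝ} (hM : ∀ x, |deriv w x| ≤ M) (x : ℝ) :
    |deriv (velocity L w) x| ≤
      (1 / π) * (M * ∫ z in (-(L / 2))..(L / 2), |log (sin (π / L * z))|) := by
  have hpi := pi_pos
  have hk := kernel_integrable hL (-(L / 2)) (L / 2)
  rw [deriv_velocity hL hw hper, abs_mul, abs_of_pos (by positivity : 0 < 1 / π)]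
  refine mul_le_mul_of_nonneg_left ?_ (by positivity)
  rw [← intervalIntegral.integral_const_mul, ← Real.norm_eq_abs]
  refine intervalIntegral.norm_integral_le_of_norm_le (by linarith) ?_ (hk.abs.const_mul M)
  refine Eventually.of_forall fun z _ => ?_
  rw [norm_mul, Real.norm_eq_abs, Real.norm_eq_abs]
  exact mul_le_mul_of_nonneg_right (hM _) (abs_nonneg _)

theorem integral_sq_le_of_norm_fourierCoeffOn_le (hL : 0 < L) {f g : ℝ → ℝ} (hf : Continuous f)
    (hg : Continuous g) {C : ℝ} (h : ∀ n, ‖fourierCoeffOn hL (fun x => (f x : ℂ)) n‖ ≤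
      C * ‖fourierCoeffOn hL (fun x => (g x : ℂ)) n‖) :
    ∫ x in (0 : ℝ)..L, f x ^ 2 ≤ C ^ 2 * ∫ x in (0 : ℝ)..L, g x ^ 2 := by
  have h1 := hasSum_le (fun n => ?_) (hasSum_sq_norm_fourierCoeffOn hL hf)
    ((hasSum_sq_norm_fourierCoeffOn hL hg).mul_left (C ^ 2))
  · have : L⁻¹ * ∫ x in (0 : ℝ)..L, f x ^ 2 ≤ L⁻¹ * (C ^ 2 * ∫ x in (0 : ℝ)..L, g x ^ 2) := by
      linarith
    exact le_of_mul_le_mul_left this (by positivity)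
  · rw [← mul_pow]
    exact pow_le_pow_left₀ (norm_nonneg _) (h n) 2

theorem integral_sq_velocity_le (hL : 0 < L) {w : ℝ → ℝ} (hw : ContDiff ℝ 1 w)
    (hper : Function.Periodic w L) :
    ∫ x in (0 : ℝ)..L, velocity L w x ^ 2 ≤
      ((1 / π) * ∫ z in (-(L / 2))..(L / 2), |log (sin (π / L * z))|) ^ 2 *
        ∫ x in (0 : ℝ)..L, w x ^ 2 := by
  refine integral_sq_le_of_norm_fourierCoeffOn_le hL (continuous_velocity hL hw hper)
    hw.continuous fun n => ?_
  rw [fourierCoeffOn_velocity hL hw.continuous hper, norm_mul, norm_mul]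
  have hpi := pi_pos
  have : ‖(1 / π : ℂ)‖ = 1 / π := by
    rw [norm_div, norm_one, Complex.norm_real, Real.norm_of_nonneg hpi.le]
  rw [this]
  gcongr
  exact norm_kernelCoeff_le hL n

/-- The periodic Hilbert transform is a contraction of `L²`. -/
theorem integral_sq_deriv_velocity_le (hL : 0 < L) {w : ℝ → ℝ} (hw : ContDiff ℝ 1 w)
    (hper : Function.Periodic w L) :
    ∫ x in (0 : ℝ)..L, deriv (velocity L w) x ^ 2 ≤ ∫ x in (0 : ℝ)..L, w x ^ 2 := by
  have hpi := pi_pos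
  have hcont := continuous_deriv_velocity hL hw hper
  have hLper : velocity L w L = velocity L w 0 := by
    simpa using velocity_periodic hL hper 0
  have hdiff : ∀ x, HasDerivAt (velocity L w) (deriv (velocity L w) x) x := fun x =>
    (hasDerivAt_velocity hL hw hper x).differentiableAt.hasDerivAt
  have h := integral_sq_le_of_norm_fourierCoeffOn_le hL hcont hw.continuous (C := 1) fun n => ?_
  · simpa using h
  rw [one_mul]
  rcases eq_or_ne n 0 with rfl | hn
  · have h0 : fourierCoeffOn hL (fun x => ((deriv (velocity L w) x : ℝ) : ℂ)) 0 = 0 := by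
      rw [fourierCoeffOn_eq_character]
      have : ∀ x, character L 0 x * ((deriv (velocity L w) x : ℝ) : ℂ) = ((deriv (velocity L w) x : ℝ) : ℂ) :=
        fun x => by simp [character]
      simp only [this]
      rw [intervalIntegral.integral_ofReal, intervalIntegral.integral_eq_sub_of_hasDerivAt
        (fun x _ => hdiff x) (hcont.intervalIntegrable _ _), hLper]
      simp
    rw [h0, norm_zero]
    exact norm_nonneg _
  · have h1 := fourierCoeffOn_of_hasDerivAt hL (f := fun x => (velocity L w x : ℂ))
      (f' := fun x => ((deriv (velocity L w) x : ℝ) : ℂ)) hn (fun x _ => (hdiff x).ofReal_comp)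
      ((Complex.continuous_ofReal.comp hcont).intervalIntegrable _ _)
    rw [hLper, sub_self, mul_zero, zero_sub, fourierCoeffOn_velocity hL hw.continuous hper] at h1
    have hn' : (n : ℂ) ≠ 0 := by exact_mod_cast hn
    have hpi' : (π : ℂ) ≠ 0 := by exact_mod_cast hpi.ne'
    have hL' : (L : ℂ) ≠ 0 := by exact_mod_cast hL.ne'
    have h2 : fourierCoeffOn hL (fun x => ((deriv (velocity L w) x : ℝ) : ℂ)) n =
        (2 * Complex.I / L : ℂ) * (n * kernelCoeff L n) *
          fourierCoeffOn hL (fun x => (w x : ℂ)) n := by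
      have hI := Complex.I_ne_zero
      push_cast at h1
      rw [sub_zero] at h1
      field_simp at h1 ⊢
      linear_combination -h1
    have h3 := norm_mul_kernelCoeff_le hL n
    have h4 : ‖(2 * Complex.I / L : ℂ)‖ = 2 / L := by
      rw [norm_div, norm_mul, Complex.norm_I, Complex.norm_real, Real.norm_of_nonneg hL.le]
      simp
    rw [h2, norm_mul, norm_mul, norm_mul, h4, Complex.norm_intCast]
    have h5 : 2 / L * (|(n : ℝ)| * ‖kernelCoeff L n‖) ≤ 1 := by
      calc _ ≤ 2 / L * (L / 2) := by gcongr
        _ = 1 := by field_simp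
    calc _ ≤ 1 * ‖fourierCoeffOn hL (fun x => (w x : ℂ)) n‖ := by gcongr
      _ = _ := one_mul _

end fourier

/-! ### Functions regular in space and time -/

section spaceTime

variable {T : ℝ} {f : ℝ → ℝ → ℝ}

/-- `f` is `n` times continuously differentiable jointly in `(t, x)` on `[0, T) × ℝ`. -/
def SpaceTimeContDiff (n : WithTop ℕ∞) (T : ℝ) (f : ℝ → ℝ → ℝ) : Prop :=
  ContDiffOn ℝ n (fun p : ℝ × ℝ => f p.1 p.2) (Ico 0 T ×ˢ univ)

theorem uniqueDiffOn_slab (T : ℝ) : UniqueDiffOn ℝ (Ico 0 T ×ˢ (univ : Set ℝ)) :=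
  (uniqueDiffOn_Ico 0 T).prod uniqueDiffOn_univ

theorem slab_mem_nhds {t : ℝ} (ht : t ∈ Ioo 0 T) (x : ℝ) :
    Ico 0 T ×ˢ (univ : Set ℝ) ∈ 𝓝 (t, x) :=
  prod_mem_nhds (Ico_mem_nhds ht.1 ht.2) univ_mem

theorem SpaceTimeContDiff.slice {n : WithTop ℕ∞} (hf : SpaceTimeContDiff n T f) {t : ℝ}
    (ht : t ∈ Ico 0 T) : ContDiff ℝ n (f t) := by
  rw [← contDiffOn_univ]
  exact ContDiffOn.comp (g := fun p : ℝ × ℝ => f p.1 p.2) (f := fun x : ℝ => (t, x)) hf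
    (by fun_prop) fun x _ => ⟨ht, mem_univ _⟩

theorem SpaceTimeContDiff.deriv_eq_fderivWithin (hf : SpaceTimeContDiff 1 T f) {t : ℝ}
    (ht : t ∈ Ico 0 T) (x : ℝ) : deriv (f t) x =
      fderivWithin ℝ (fun p : ℝ × ℝ => f p.1 p.2) (Ico 0 T ×ˢ univ) (t, x) (0, 1) := by
  have h1 := ((hf.differentiableOn one_ne_zero) (t, x) ⟨ht, mem_univ _⟩).hasFDerivWithinAt
  have h2 : HasDerivWithinAt (fun x : ℝ => (t, x)) ((0 : ℝ), (1 : ℝ)) univ x :=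
    ((hasDerivAt_const x t).prodMk (hasDerivAt_id x)).hasDerivWithinAt
  have h3 := HasFDerivWithinAt.comp_hasDerivWithinAt (l := fun p : ℝ × ℝ => f p.1 p.2)
    (f := fun x : ℝ => (t, x)) x h1 h2 (fun x _ => ⟨ht, mem_univ _⟩)
  rw [hasDerivWithinAt_univ] at h3
  exact h3.deriv

theorem SpaceTimeContDiff.deriv_space {m n : WithTop ℕ∞} (hf : SpaceTimeContDiff n T f)
    (hmn : m + 1 ≤ n) : SpaceTimeContDiff m T fun t x => deriv (f t) x := by
  have h := (ContDiffOn.fderivWithin hf (uniqueDiffOn_slab T) hmn).clm_apply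
    (contDiffOn_const (c := ((0 : ℝ), (1 : ℝ))))
  refine h.congr fun p hp => ?_
  have h1 : SpaceTimeContDiff 1 T f := hf.of_le (le_trans (by simp) hmn)
  exact h1.deriv_eq_fderivWithin hp.1 p.2

theorem SpaceTimeContDiff.hasDerivAt_time (hf : SpaceTimeContDiff 1 T f) {t : ℝ}
    (ht : t ∈ Ioo 0 T) (x : ℝ) : HasDerivAt (fun s => f s x)
      (fderiv ℝ (fun p : ℝ × ℝ => f p.1 p.2) (t, x) (1, 0)) t := by
  have h1 := ((hf.contDiffAt (slab_mem_nhds ht x)).differentiableAt one_ne_zero).hasFDerivAt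
  have h2 : HasDerivAt (fun t : ℝ => (t, x)) ((1 : ℝ), (0 : ℝ)) t :=
    (hasDerivAt_id t).prodMk (hasDerivAt_const t x)
  exact HasFDerivAt.comp_hasDerivAt (l := fun p : ℝ × ℝ => f p.1 p.2)
    (f := fun t : ℝ => (t, x)) t h1 h2

theorem SpaceTimeContDiff.hasDerivAt (hf : SpaceTimeContDiff 1 T f) {t : ℝ}
    (ht : t ∈ Ioo 0 T) (x : ℝ) : HasDerivAt (fun s => f s x) (deriv (fun s => f s x) t) t :=
  (hf.hasDerivAt_time ht x).differentiableAt.hasDerivAt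

theorem SpaceTimeContDiff.hasDerivAt_space (hf : SpaceTimeContDiff 1 T f) {t : ℝ}
    (ht : t ∈ Ico 0 T) (x : ℝ) : HasDerivAt (f t) (deriv (f t) x) x :=
  ((hf.slice ht).differentiable one_ne_zero x).hasDerivAt

theorem SpaceTimeContDiff.continuousOn_deriv_time (hf : SpaceTimeContDiff 1 T f) :
    ContinuousOn (fun p : ℝ × ℝ => deriv (fun s => f s p.2) p.1) (Ioo 0 T ×ˢ univ) := by
  have ho : IsOpen (Ioo 0 T ×ˢ (univ : Set ℝ)) := isOpen_Ioo.prod isOpen_univ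
  have h1 : ContDiffOn ℝ 1 (fun p : ℝ × ℝ => f p.1 p.2) (Ioo 0 T ×ˢ univ) :=
    ContDiffOn.mono hf (prod_mono Ioo_subset_Ico_self le_rfl)
  have h2 := (h1.continuousOn_fderiv_of_isOpen ho le_rfl).clm_apply
    (continuousOn_const (c := ((1 : ℝ), (0 : ℝ))))
  exact h2.congr fun p hp => (hf.hasDerivAt_time hp.1 p.2).deriv

/-- Space and time derivatives commute for a function that is twice continuously
differentiable. -/
theorem SpaceTimeContDiff.hasDerivAt_deriv_time (hf : SpaceTimeContDiff 2 T f) {t : ℝ}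
    (ht : t ∈ Ioo 0 T) (x : ℝ) : HasDerivAt (fun y => deriv (fun s => f s y) t)
      (deriv (fun s => deriv (f s) x) t) x := by
  set F : ℝ × ℝ → ℝ := fun p => f p.1 p.2 with hF
  have hf1 : SpaceTimeContDiff 1 T f := hf.of_le one_le_two
  have hc : ContDiffAt ℝ 2 F (t, x) := hf.contDiffAt (slab_mem_nhds ht x)
  have hd : HasFDerivAt (fderiv ℝ F) (fderiv ℝ (fderiv ℝ F) (t, x)) (t, x) :=
    ((hc.fderiv_right (m := 1) (by norm_num)).differentiableAt one_ne_zero).hasFDerivAt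
  have hsymm := hc.isSymmSndFDerivAt (by simp)
  have h1 : (fun y => deriv (fun s => f s y) t) = fun y => fderiv ℝ F (t, y) (1, 0) :=
    funext fun y => (hf1.hasDerivAt_time ht y).deriv
  have hx : HasDerivAt (fun y : ℝ => (t, y)) ((0 : ℝ), (1 : ℝ)) x :=
    (hasDerivAt_const x t).prodMk (hasDerivAt_id x)
  have ht' : HasDerivAt (fun s : ℝ => (s, x)) ((1 : ℝ), (0 : ℝ)) t :=
    (hasDerivAt_id t).prodMk (hasDerivAt_const t x)
  have h2 := (HasFDerivAt.comp_hasDerivAt (f := fun y : ℝ => (t, y)) x hd hx).clm_apply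
    (hasDerivAt_const x ((1 : ℝ), (0 : ℝ)))
  have h3 := (HasFDerivAt.comp_hasDerivAt (f := fun s : ℝ => (s, x)) t hd ht').clm_apply
    (hasDerivAt_const t ((0 : ℝ), (1 : ℝ)))
  have h4 : (fun s => deriv (f s) x) =ᶠ[𝓝 t] fun s => fderiv ℝ F (s, x) (0, 1) := by
    filter_upwards [Ioo_mem_nhds ht.1 ht.2] with s hs
    rw [hf1.deriv_eq_fderivWithin (Ioo_subset_Ico_self hs),
      fderivWithin_of_mem_nhds (slab_mem_nhds hs x)]
  rw [h1, h4.deriv_eq]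
  refine h2.congr_deriv ?_
  refine Eq.trans ?_ h3.deriv.symm
  simpa using hsymm.eq (0, 1) (1, 0)

theorem exists_bound_of_continuousOn_slab {g : ℝ → ℝ → ℝ} {L : ℝ} (hL : 0 < L)
    (hg : ContinuousOn (fun p : ℝ × ℝ => g p.1 p.2) (Ico 0 T ×ˢ univ))
    (hper : ∀ t ∈ Ico 0 T, Function.Periodic (g t) L) {t₁ : ℝ} (ht₁ : t₁ < T) :
    ∃ M, 0 ≤ M ∧ ∀ t ∈ Icc 0 t₁, ∀ x, |g t x| ≤ M := by
  have hsub : Icc 0 t₁ ×ˢ Icc 0 L ⊆ Ico 0 T ×ˢ (univ : Set ℝ) :=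
    prod_mono (Icc_subset_Ico_right ht₁) (subset_univ _)
  obtain ⟨M, hM⟩ := (isCompact_Icc.prod isCompact_Icc).exists_bound_of_continuousOn (hg.mono hsub)
  refine ⟨max M 0, le_max_right _ _, fun t ht x => ?_⟩
  obtain ⟨y, hy, hxy⟩ := (hper t ⟨ht.1, ht.2.trans_lt ht₁⟩).exists_mem_Ico₀ hL x
  rw [hxy]
  exact (hM (t, y) ⟨ht, Ico_subset_Icc_self hy⟩).trans (le_max_left _ _)

theorem SpaceTimeContDiff.continuousOn_integral {n : WithTop ℕ∞} (hf : SpaceTimeContDiff n T f)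
    {k : ℝ → ℝ} {a b : ℝ} (hab : a ≤ b) (hk : ContinuousOn k (Icc a b)) :
    ContinuousOn (fun t => ∫ x in a..b, f t x * k x) (Ico 0 T) := by
  intro t ht
  obtain ⟨t₂, h1, h2⟩ := exists_between ht.2
  obtain ⟨M, hM⟩ := (isCompact_Icc (a := 0) (b := t₂)).prod (isCompact_Icc (a := a) (b := b))
    |>.exists_bound_of_continuousOn (f := fun p : ℝ × ℝ => f p.1 p.2)
      (hf.continuousOn.mono (prod_mono (Icc_subset_Ico_right h2) (subset_univ _)))
  have hev : ∀ᶠ s in 𝓝[Ico 0 T] t, s ∈ Icc 0 t₂ := by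
    filter_upwards [self_mem_nhdsWithin, mem_nhdsWithin_of_mem_nhds (Iio_mem_nhds h1)] with s hs hs'
      using ⟨hs.1, hs'.le⟩
  have hki : IntervalIntegrable k volume a b := by
    refine ContinuousOn.intervalIntegrable ?_
    rwa [uIcc_of_le hab]
  refine intervalIntegral.continuousWithinAt_of_dominated_interval
    (bound := fun x => M * |k x|) ?_ ?_ (hki.abs.const_mul M) ?_
  · filter_upwards [self_mem_nhdsWithin] with s hs
    exact ((hf.slice hs).continuous.aestronglyMeasurable).mul
      (intervalIntegrable_iff.mp hki).aestronglyMeasurable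
  · filter_upwards [hev] with s hs
    refine Eventually.of_forall fun x hx => ?_
    rw [uIoc_of_le hab] at hx
    rw [norm_mul, Real.norm_eq_abs (k x)]
    exact mul_le_mul_of_nonneg_right (hM (s, x) ⟨hs, Ioc_subset_Icc_self hx⟩) (abs_nonneg _)
  · refine Eventually.of_forall fun x _ => ContinuousWithinAt.mul ?_ continuousWithinAt_const
    exact ContinuousWithinAt.comp (g := fun p : ℝ × ℝ => f p.1 p.2) (f := fun s : ℝ => (s, x))
      (hf.continuousOn (t, x) ⟨ht, mem_univ _⟩) (by fun_prop) fun s hs => ⟨hs, mem_univ _⟩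

theorem SpaceTimeContDiff.hasDerivAt_integral (hf : SpaceTimeContDiff 1 T f)
    {k : ℝ → ℝ} {a b : ℝ} (hab : a ≤ b) (hk : ContinuousOn k (Icc a b)) {t : ℝ}
    (ht : t ∈ Ioo 0 T) :
    HasDerivAt (fun t => ∫ x in a..b, f t x * k x)
      (∫ x in a..b, deriv (fun s => f s x) t * k x) t := by
  obtain ⟨t₀, h1, h2⟩ := exists_between ht.1
  obtain ⟨t₂, h3, h4⟩ := exists_between ht.2
  obtain ⟨M, hM⟩ := (isCompact_Icc (a := t₀) (b := t₂)).prod (isCompact_Icc (a := a) (b := b))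
    |>.exists_bound_of_continuousOn (f := fun p : ℝ × ℝ => deriv (fun s => f s p.2) p.1)
      (hf.continuousOn_deriv_time.mono (prod_mono (Icc_subset_Ioo h1 h4) (subset_univ _)))
  have hki : IntervalIntegrable k volume a b := by
    refine ContinuousOn.intervalIntegrable ?_
    rwa [uIcc_of_le hab]
  have hkm := (intervalIntegrable_iff.mp hki).aestronglyMeasurable
  have hsub : ∀ s ∈ Icc t₀ t₂, s ∈ Ioo 0 T := fun s hs => ⟨h1.trans_le hs.1, hs.2.trans_lt h4⟩
  refine (intervalIntegral.hasDerivAt_integral_of_dominated_loc_of_deriv_le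
    (F := fun t x => f t x * k x) (F' := fun t x => deriv (fun s => f s x) t * k x)
    (s := Icc t₀ t₂) (bound := fun x => M * |k x|) (Icc_mem_nhds h2 h3) ?_ ?_ ?_ ?_ ?_ ?_).2
  · filter_upwards [Icc_mem_nhds h2 h3] with s hs
    exact ((hf.slice (Ioo_subset_Ico_self (hsub s hs))).continuous.aestronglyMeasurable).mul hkm
  · exact hki.continuousOn_mul (hf.slice (Ioo_subset_Ico_self ht)).continuous.continuousOn
  · refine AEStronglyMeasurable.mul (Continuous.aestronglyMeasurable ?_) hkm
    have := hf.continuousOn_deriv_time.comp (f := fun x : ℝ => (t, x)) (s := univ)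
      (by fun_prop) fun x _ => ⟨ht, mem_univ _⟩
    exact continuousOn_univ.1 this
  · refine Eventually.of_forall fun x hx s hs => ?_
    rw [uIoc_of_le hab] at hx
    rw [norm_mul, Real.norm_eq_abs (k x)]
    exact mul_le_mul_of_nonneg_right (hM (s, x) ⟨hs, Ioc_subset_Icc_self hx⟩) (abs_nonneg _)
  · exact hki.abs.const_mul M
  · exact Eventually.of_forall fun x _ s hs => (hf.hasDerivAt (hsub s hs) x).mul_const _

/-- Grönwall's inequality with zero initial value, for a nonnegative function. -/
theorem eq_zero_of_deriv_le {E E' : ℝ → ℝ} {C t₁ : ℝ} (hc : ContinuousOn E (Icc 0 t₁))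
    (hd : ∀ t ∈ Ioo 0 t₁, HasDerivAt E (E' t) t) (hle : ∀ t ∈ Ioo 0 t₁, E' t ≤ C * E t)
    (h0 : E 0 = 0) (hpos : ∀ t ∈ Icc 0 t₁, 0 ≤ E t) {t : ℝ} (ht : t ∈ Icc 0 t₁) : E t = 0 := by
  have hanti : AntitoneOn (fun t => exp (-(C * t)) * E t) (Icc 0 t₁) := by
    have hder : ∀ t ∈ Ioo 0 t₁, HasDerivAt (fun t => exp (-(C * t)) * E t)
        (exp (-(C * t)) * (E' t - C * E t)) t := by
      intro t ht
      have h1 : HasDerivAt (fun t : ℝ => -(C * t)) (-C) t := by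
        simpa using (hasDerivAt_id t).const_mul C |>.fun_neg
      refine (h1.exp.mul (hd t ht)).congr_deriv ?_
      ring
    refine antitoneOn_of_deriv_nonpos (convex_Icc 0 t₁) ?_ ?_ ?_
    · exact ContinuousOn.mul (by fun_prop) hc
    · rw [interior_Icc]
      exact fun t ht => (hder t ht).differentiableAt.differentiableWithinAt
    · rw [interior_Icc]
      intro t ht
      rw [(hder t ht).deriv]
      exact mul_nonpos_of_nonneg_of_nonpos (exp_pos _).le (by linarith [hle t ht])
  have h1 := hanti ⟨le_rfl, ht.1.trans ht.2⟩ ht ht.1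
  simp only [h0, mul_zero] at h1
  have h2 := exp_pos (-(C * t))
  have h3 := hpos t ht
  nlinarith

end spaceTime

/-! ### Transport with a sign -/

section transport

theorem hasDerivAt_max_zero_sq (s : ℝ) : HasDerivAt (fun s : ℝ => max s 0 ^ 2) (2 * max s 0) s := by
  rcases lt_trichotomy s 0 with h | h | h
  · have e : (fun s : ℝ => max s 0 ^ 2) =ᶠ[𝓝 s] fun _ => 0 := by
      filter_upwards [Iio_mem_nhds h] with r hr
      rw [max_eq_right (le_of_lt hr)]; norm_num
    rw [max_eq_right h.le, mul_zero]
    exact (hasDerivAt_const s (0 : ℝ)).congr_of_eventuallyEq e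
  · subst h
    rw [max_self, mul_zero, hasDerivAt_iff_isLittleO]
    have h1 : (fun s : ℝ => s ^ 2) =o[𝓝 0] fun s : ℝ => s := by
      simpa using Asymptotics.isLittleO_pow_pow (𝕜 := ℝ) (m := 1) (n := 2) (by norm_num)
    refine (Asymptotics.IsBigO.of_bound 1 (Eventually.of_forall fun r => ?_)).trans_isLittleO
      (h1.congr_right fun s => (sub_zero s).symm)
    simp only [max_self, sub_zero, smul_zero, norm_pow, one_mul, Real.norm_eq_abs,
      ne_eq, OfNat.ofNat_ne_zero, not_false_eq_true, zero_pow]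
    refine pow_le_pow_left₀ (abs_nonneg _) ?_ 2
    rw [abs_of_nonneg (le_max_right _ _)]
    exact max_le (le_abs_self r) (abs_nonneg r)
  · have e : (fun s : ℝ => max s 0 ^ 2) =ᶠ[𝓝 s] fun s => s ^ 2 := by
      filter_upwards [Ioi_mem_nhds h] with r hr
      rw [max_eq_left (le_of_lt hr)]
    rw [max_eq_left h.le]
    have := (hasDerivAt_pow 2 s).congr_of_eventuallyEq e
    simpa using this

theorem contDiff_max_zero_sq : ContDiff ℝ 1 fun s : ℝ => max s 0 ^ 2 := by
  rw [contDiff_one_iff_deriv]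
  refine ⟨fun s => (hasDerivAt_max_zero_sq s).differentiableAt, ?_⟩
  rw [funext fun s => (hasDerivAt_max_zero_sq s).deriv]
  fun_prop

theorem eq_zero_of_integral_eq_zero {g : ℝ → ℝ} {a b : ℝ} (hab : a < b)
    (hg : ContinuousOn g (Icc a b)) (hpos : ∀ x ∈ Icc a b, 0 ≤ g x) (h : ∫ x in a..b, g x = 0)
    {x : ℝ} (hx : x ∈ Icc a b) : g x = 0 := by
  by_contra hne
  have := intervalIntegral.integral_pos hab hg (fun y hy => hpos y (Ioc_subset_Icc_self hy))
    ⟨x, hx, lt_of_le_of_ne (hpos x hx) (Ne.symm hne)⟩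
  linarith

/-- Integration by parts in a transport term whose boundary contributions cancel. -/
theorem integral_mul_deriv_eq_neg {v g : ℝ → ℝ} {a b : ℝ} (hv : ContDiff ℝ 1 v)
    (hg : ContDiff ℝ 1 g) (hb : v b * g b = v a * g a) :
    ∫ x in a..b, v x * deriv g x = -∫ x in a..b, deriv v x * g x := by
  rw [intervalIntegral.integral_mul_deriv_eq_deriv_mul
    (fun x _ => (hv.differentiable one_ne_zero x).hasDerivAt)
    (fun x _ => (hg.differentiable one_ne_zero x).hasDerivAt)
    ((hv.continuous_deriv le_rfl).intervalIntegrable _ _)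
    ((hg.continuous_deriv le_rfl).intervalIntegrable _ _), hb]
  ring

variable {T : ℝ} {f c v : ℝ → ℝ → ℝ}

theorem SpaceTimeContDiff.continuousOn_integral_slice {n : WithTop ℕ∞}
    (hf : SpaceTimeContDiff n T f) {a b : ℝ} (hab : a ≤ b) :
    ContinuousOn (fun t => ∫ x in a..b, f t x) (Ico 0 T) := by
  simpa using hf.continuousOn_integral hab (continuousOn_const (c := (1 : ℝ)))

theorem SpaceTimeContDiff.hasDerivAt_integral_slice (hf : SpaceTimeContDiff 1 T f)
    {a b : ℝ} (hab : a ≤ b) {t : ℝ} (ht : t ∈ Ioo 0 T) :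
    HasDerivAt (fun t => ∫ x in a..b, f t x) (∫ x in a..b, deriv (fun s => f s x) t) t := by
  simpa using hf.hasDerivAt_integral hab (continuousOn_const (c := (1 : ℝ))) ht

theorem SpaceTimeContDiff.continuous_deriv_time_slice (hf : SpaceTimeContDiff 1 T f)
    {t : ℝ} (ht : t ∈ Ioo 0 T) : Continuous fun x => deriv (fun s => f s x) t :=
  continuousOn_univ.1 (hf.continuousOn_deriv_time.comp (f := fun x : ℝ => (t, x)) (s := univ)
    (by fun_prop) fun x _ => ⟨ht, mem_univ _⟩)

/-- A solution of `f_t + v f_x ≥ c f` on an interval at whose ends the velocity `v` vanishes stays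
nonnegative. The proof is an energy estimate for the square of the negative part. -/
theorem nonneg_of_transport (hf : SpaceTimeContDiff 1 T f) {t₁ ℓ C : ℝ} (hℓ : 0 < ℓ)
    (ht₁ : t₁ < T) (hv : ∀ t ∈ Ioo 0 t₁, ContDiff ℝ 1 (v t))
    (hv0 : ∀ t ∈ Ioo 0 t₁, v t 0 = 0) (hvℓ : ∀ t ∈ Ioo 0 t₁, v t ℓ = 0)
    (hvC : ∀ t ∈ Ioo 0 t₁, ∀ x, |deriv (v t) x| ≤ C)
    (hcC : ∀ t ∈ Ioo 0 t₁, ∀ x, |c t x| ≤ C)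
    (heq : ∀ t ∈ Ioo 0 t₁, ∀ x ∈ Icc 0 ℓ,
      c t x * f t x ≤ deriv (fun s => f s x) t + v t x * deriv (f t) x)
    (h0 : ∀ x ∈ Icc 0 ℓ, 0 ≤ f 0 x) {t : ℝ} (ht : t ∈ Icc 0 t₁) {x : ℝ} (hx : x ∈ Icc 0 ℓ) :
    0 ≤ f t x := by
  set N : ℝ → ℝ → ℝ := fun t x => max (-f t x) 0 ^ 2 with hN
  have hNC : SpaceTimeContDiff 1 T N := contDiff_max_zero_sq.comp_contDiffOn (ContDiffOn.neg hf)
  have hIco : ∀ t ∈ Icc 0 t₁, t ∈ Ico 0 T := fun t ht => ⟨ht.1, ht.2.trans_lt ht₁⟩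
  have hIoo : ∀ t ∈ Ioo 0 t₁, t ∈ Ioo 0 T := fun t ht => ⟨ht.1, ht.2.trans ht₁⟩
  have hE0 : (∫ x in (0 : ℝ)..ℓ, N 0 x) = 0 := by
    rw [intervalIntegral.integral_congr (g := fun _ => 0) fun x hx => ?_]
    · simp
    · rw [uIcc_of_le hℓ.le] at hx
      simp [hN, h0 x hx]
  have hE : ∀ t ∈ Icc 0 t₁, (∫ x in (0 : ℝ)..ℓ, N t x) = 0 := by
    intro t ht
    refine eq_zero_of_deriv_le (E := fun t => ∫ x in (0 : ℝ)..ℓ, N t x) (C := 3 * C)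
      ((hNC.continuousOn_integral_slice hℓ.le).mono hIco)
      (fun t ht => hNC.hasDerivAt_integral_slice hℓ.le (hIoo t ht)) (fun t ht => ?_) hE0
      (fun t _ => intervalIntegral.integral_nonneg hℓ.le fun x _ => by positivity) ht
    have htT := hIoo t ht
    have htI := Ioo_subset_Ico_self htT
    have hNs := hNC.slice htI
    have hcontT := hNC.continuous_deriv_time_slice htT
    have hdv := (hv t ht).continuous_deriv le_rfl
    have hdN := hNs.continuous_deriv le_rfl
    have hibp := integral_mul_deriv_eq_neg (a := 0) (b := ℓ) (hv t ht) hNs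
      (by rw [hv0 t ht, hvℓ t ht, zero_mul, zero_mul])
    have hpt : ∀ x ∈ Icc 0 ℓ, deriv (fun s => N s x) t ≤
        2 * C * N t x - v t x * deriv (N t) x := by
      intro x hx
      have h1 : deriv (fun s => N s x) t = 2 * max (-f t x) 0 * -deriv (fun s => f s x) t :=
        ((hasDerivAt_max_zero_sq _).comp t (hf.hasDerivAt htT x).fun_neg).deriv
      have h2 : deriv (N t) x = 2 * max (-f t x) 0 * -deriv (f t) x :=
        ((hasDerivAt_max_zero_sq _).comp x (hf.hasDerivAt_space htI x).fun_neg).deriv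
      have h3 := heq t ht x hx
      have h4 := hcC t ht x
      have h5 : max (-f t x) 0 * f t x = -max (-f t x) 0 ^ 2 := by
        rcases max_choice (-f t x) 0 with h | h <;> rw [h] <;> ring
      have h6 : 0 ≤ max (-f t x) 0 := le_max_right _ _
      rw [h1, h2]
      simp only [hN]
      have h7 := mul_le_mul_of_nonneg_left h3 h6
      have h8 : c t x * max (-f t x) 0 ^ 2 ≤ C * max (-f t x) 0 ^ 2 :=
        mul_le_mul_of_nonneg_right ((le_abs_self _).trans h4) (sq_nonneg _)
      have h9 : max (-f t x) 0 * (c t x * f t x) = -(c t x * max (-f t x) 0 ^ 2) := by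
        rw [mul_left_comm, h5]; ring
      nlinarith
    have iN : ∀ C : ℝ, IntervalIntegrable (fun x => C * N t x) volume 0 ℓ := fun C =>
      (hNs.continuous.intervalIntegrable _ _).const_mul _
    have iv : IntervalIntegrable (fun x => v t x * deriv (N t) x) volume 0 ℓ :=
      ((hv t ht).continuous.mul hdN).intervalIntegrable _ _
    have hle := intervalIntegral.integral_mono_on hℓ.le
      (hcontT.intervalIntegrable _ _) ((iN (2 * C)).sub iv) hpt
    have hle2 : (∫ x in (0 : ℝ)..ℓ, deriv (v t) x * N t x) ≤ ∫ x in (0 : ℝ)..ℓ, C * N t x :=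
      intervalIntegral.integral_mono_on hℓ.le
        ((hdv.mul hNs.continuous).intervalIntegrable _ _) (iN C) fun x _ =>
          mul_le_mul_of_nonneg_right ((le_abs_self _).trans (hvC t ht x)) (sq_nonneg _)
    rw [intervalIntegral.integral_sub (iN _) iv, hibp, intervalIntegral.integral_const_mul] at hle
    rw [intervalIntegral.integral_const_mul] at hle2
    linarith
  have hz := eq_zero_of_integral_eq_zero hℓ
    (hNC.slice (hIco t ht)).continuous.continuousOn
    (fun x _ => sq_nonneg _) (hE t ht) hx
  simp only [hN, ne_eq, OfNat.ofNat_ne_zero, not_false_eq_true, pow_eq_zero_iff] at hz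
  have := le_max_left (-f t x) 0
  linarith

end transport

/-! ### Symmetry and signs of regular solutions -/

section solution

variable {L T : ℝ} {ω₀ θ₀ : ℝ → ℝ} {ω θ : ℝ → ℝ → ℝ}

theorem IsRegularSolution.mono {I J : Set ℝ} (sol : IsRegularSolution L ω₀ θ₀ I ω θ)
    (hJI : J ⊆ I) : IsRegularSolution L ω₀ θ₀ J ω θ where
  contDiffOn_vorticity := sol.contDiffOn_vorticity.mono (prod_mono hJI le_rfl)
  contDiffOn_density := sol.contDiffOn_density.mono (prod_mono hJI le_rfl)
  periodic_vorticity t ht := sol.periodic_vorticity t (hJI ht)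
  periodic_density t ht := sol.periodic_density t (hJI ht)
  vorticity_eq t ht := sol.vorticity_eq t (interior_mono hJI ht)
  density_eq t ht := sol.density_eq t (interior_mono hJI ht)
  initial_vorticity := sol.initial_vorticity
  initial_density := sol.initial_density

theorem SpaceTimeContDiff.reflect {n : WithTop ℕ∞} {f : ℝ → ℝ → ℝ}
    (hf : SpaceTimeContDiff n T f) : SpaceTimeContDiff n T fun t x => f t (-x) :=
  ContDiffOn.comp (g := fun p : ℝ × ℝ => f p.1 p.2) (f := fun p : ℝ × ℝ => (p.1, -p.2)) hf
    (by fun_prop) fun _ hp => ⟨hp.1, mem_univ _⟩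

theorem periodic_reflect {w : ℝ → ℝ} (hper : Function.Periodic w L) :
    Function.Periodic (fun y => w (-y)) L := by
  intro y
  have := hper (-(y + L))
  simp only at this ⊢
  rw [← this]
  congr 1
  ring

theorem velocity_reflect (hL : 0 < L) {w : ℝ → ℝ} (hper : Function.Periodic w L) (x : ℝ) :
    velocity L (fun y => w (-y)) x = velocity L w (-x) := by
  rw [velocity_eq_centered hL hper, velocity_eq_centered hL (periodic_reflect hper)]
  congr 1
  have := intervalIntegral.integral_comp_neg (a := -(L / 2)) (b := L / 2)
    (fun z => w (-x - z) * log (sin (π / L * z)))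
  rw [neg_neg] at this
  rw [← this]
  congr 1
  funext z
  rw [mul_neg, sin_neg, log_neg_eq_log]
  congr 2
  ring

theorem hasDerivAt_comp_neg {f : ℝ → ℝ} {d x : ℝ} (h : HasDerivAt f d (-x)) :
    HasDerivAt (fun y => f (-y)) (-d) x := by
  refine (HasDerivAt.comp x h (hasDerivAt_neg x)).congr_deriv ?_
  ring

theorem velocity_add (hL : 0 < L) {w₁ w₂ : ℝ → ℝ} (h₁ : Continuous w₁) (h₂ : Continuous w₂)
    (x : ℝ) : velocity L (fun y => w₁ y + w₂ y) x = velocity L w₁ x + velocity L w₂ x := by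
  unfold velocity
  have hi := intervalIntegrable_log_sin_sub hL x 0 L
  simp only [log_abs, add_mul]
  rw [intervalIntegral.integral_add (hi.continuousOn_mul h₁.continuousOn)
    (hi.continuousOn_mul h₂.continuousOn), mul_add]

theorem contDiff_velocity (hL : 0 < L) {w : ℝ → ℝ} (hw : ContDiff ℝ 1 w)
    (hper : Function.Periodic w L) : ContDiff ℝ 1 (velocity L w) := by
  rw [contDiff_one_iff_deriv]
  exact ⟨fun x => (hasDerivAt_velocity hL hw hper x).differentiableAt,
    continuous_deriv_velocity hL hw hper⟩

theorem IsRegularSolution.vorticity_contDiff (sol : IsRegularSolution L ω₀ θ₀ (Ico 0 T) ω θ) :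
    SpaceTimeContDiff 1 T ω := sol.contDiffOn_vorticity

theorem IsRegularSolution.density_contDiff (sol : IsRegularSolution L ω₀ θ₀ (Ico 0 T) ω θ) :
    SpaceTimeContDiff 2 T θ := sol.contDiffOn_density

theorem IsRegularSolution.density_contDiff_one (sol : IsRegularSolution L ω₀ θ₀ (Ico 0 T) ω θ) :
    SpaceTimeContDiff 1 T θ := sol.density_contDiff.of_le one_le_two

theorem IsRegularSolution.gradient_contDiff (sol : IsRegularSolution L ω₀ θ₀ (Ico 0 T) ω θ) :
    SpaceTimeContDiff 1 T fun t x => deriv (θ t) x :=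
  sol.density_contDiff.deriv_space (by norm_num)

theorem IsRegularSolution.deriv_vorticity (sol : IsRegularSolution L ω₀ θ₀ (Ico 0 T) ω θ)
    {t : ℝ} (ht : t ∈ Ioo 0 T) (x : ℝ) : deriv (fun s => ω s x) t =
      deriv (θ t) x - velocity L (ω t) x * deriv (ω t) x := by
  rw [← sol.vorticity_eq t (by rwa [interior_Ico]) x]
  ring

theorem IsRegularSolution.deriv_density (sol : IsRegularSolution L ω₀ θ₀ (Ico 0 T) ω θ)
    {t : ℝ} (ht : t ∈ Ioo 0 T) (x : ℝ) : deriv (fun s => θ s x) t =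
      -(velocity L (ω t) x * deriv (θ t) x) := by
  have := sol.density_eq t (by rwa [interior_Ico]) x
  linarith

/-- The equation for the density gradient, by differentiation of the transport equation. -/
theorem IsRegularSolution.deriv_gradient (sol : IsRegularSolution L ω₀ θ₀ (Ico 0 T) ω θ)
    (hL : 0 < L) {t : ℝ} (ht : t ∈ Ioo 0 T) (x : ℝ) : deriv (fun s => deriv (θ s) x) t =
      -(deriv (velocity L (ω t)) x * deriv (θ t) x +
        velocity L (ω t) x * deriv (deriv (θ t)) x) := by
  have htI := Ioo_subset_Ico_self ht
  have h1 := sol.density_contDiff.hasDerivAt_deriv_time ht x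
  rw [funext fun y => sol.deriv_density ht y] at h1
  have h2 := (hasDerivAt_velocity hL (sol.vorticity_contDiff.slice htI)
    (sol.periodic_vorticity t htI) x).differentiableAt.hasDerivAt
  have h3 := sol.gradient_contDiff.hasDerivAt_space htI x
  exact h1.unique (h2.mul h3).neg

theorem IsRegularSolution.periodic_gradient (sol : IsRegularSolution L ω₀ θ₀ (Ico 0 T) ω θ)
    {t : ℝ} (ht : t ∈ Ico 0 T) : Function.Periodic (deriv (θ t)) L :=
  deriv_periodic (sol.periodic_density t ht)

/-- On compact time intervals all first derivatives occurring in the equations, and the second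
space derivative of the density, are bounded. -/
theorem IsRegularSolution.exists_bound (sol : IsRegularSolution L ω₀ θ₀ (Ico 0 T) ω θ)
    (hL : 0 < L) {t₁ : ℝ} (ht₁ : t₁ < T) :
    ∃ M, 0 ≤ M ∧ ∀ t ∈ Icc 0 t₁, ∀ x, |deriv (ω t) x| ≤ M ∧ |deriv (θ t) x| ≤ M ∧
      |deriv (deriv (θ t)) x| ≤ M ∧ |deriv (velocity L (ω t)) x| ≤ M := by
  have hIco : ∀ t ∈ Icc 0 t₁, t ∈ Ico 0 T := fun t ht => ⟨ht.1, ht.2.trans_lt ht₁⟩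
  obtain ⟨M₁, h1, hM₁⟩ := exists_bound_of_continuousOn_slab hL
    (sol.vorticity_contDiff.deriv_space (m := 0) (by simp)).continuousOn
    (fun t ht => deriv_periodic (sol.periodic_vorticity t ht)) ht₁
  obtain ⟨M₂, h2, hM₂⟩ := exists_bound_of_continuousOn_slab hL
    sol.gradient_contDiff.continuousOn (fun t ht => sol.periodic_gradient ht) ht₁
  obtain ⟨M₃, h3, hM₃⟩ := exists_bound_of_continuousOn_slab hL
    (sol.gradient_contDiff.deriv_space (m := 0) (by simp)).continuousOn
    (fun t ht => deriv_periodic (sol.periodic_gradient ht)) ht₁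
  set M₄ := (1 / π) * (M₁ * ∫ z in (-(L / 2))..(L / 2), |log (sin (π / L * z))|) with hM₄
  have h4 : ∀ t ∈ Icc 0 t₁, ∀ x, |deriv (velocity L (ω t)) x| ≤ M₄ := fun t ht x =>
    abs_deriv_velocity_le hL (sol.vorticity_contDiff.slice (hIco t ht))
      (sol.periodic_vorticity t (hIco t ht)) (hM₁ t ht) x
  refine ⟨max (max M₁ M₂) (max M₃ M₄), h1.trans ((le_max_left _ _).trans (le_max_left _ _)),
    fun t ht x => ⟨?_, ?_, ?_, ?_⟩⟩
  · exact (hM₁ t ht x).trans ((le_max_left _ _).trans (le_max_left _ _))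
  · exact (hM₂ t ht x).trans ((le_max_right _ _).trans (le_max_left _ _))
  · exact (hM₃ t ht x).trans ((le_max_left _ _).trans (le_max_right _ _))
  · exact (h4 t ht x).trans ((le_max_right _ _).trans (le_max_right _ _))

/-- Pointwise form of the energy estimate for the difference of a solution and its reflection. -/
theorem energy_density_le {M W P U V G a p q r s Wx Px : ℝ} (hM : 0 ≤ M)
    (ha : |a| ≤ M) (hp : |p| ≤ M) (hq : |q| ≤ M) (hr : |r| ≤ M)
    (hG : G = 2 * W * Wx + 2 * P * Px) :
    2 * W * (P - s * Wx - U * a) + 2 * P * (-(r * P) - s * Px + V * p - U * q) ≤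
      (1 + 4 * M) * (W ^ 2 + P ^ 2) + 2 * M * U ^ 2 + M * V ^ 2 - s * G := by
  have k : ∀ c x y : ℝ, |c| ≤ M → c * (2 * x * y) ≤ M * (x ^ 2 + y ^ 2) := by
    intro c x y hc
    have h1 := abs_le.1 hc
    have e1 : 0 ≤ (M - c) * (x + y) ^ 2 := mul_nonneg (by linarith) (sq_nonneg _)
    have e2 : 0 ≤ (M + c) * (x - y) ^ 2 := mul_nonneg (by linarith) (sq_nonneg _)
    linarith
  have k1 := k (-a) W U (by rwa [abs_neg])
  have k2 := k (-r) P P (by rwa [abs_neg])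
  have k3 := k p P V hp
  have k4 := k (-q) P U (by rwa [abs_neg])
  have k5 : 2 * W * P ≤ W ^ 2 + P ^ 2 := two_mul_le_add_sq W P
  have k6 : 0 ≤ M * W ^ 2 := by positivity
  rw [hG]
  nlinarith

/-- A regular solution with odd initial vorticity and even initial density has odd vorticity: the
even part of the vorticity and of the density gradient satisfy a closed energy estimate. -/
theorem IsRegularSolution.odd_vorticity (sol : IsRegularSolution L ω₀ θ₀ (Ico 0 T) ω θ)
    (hL : 0 < L) (hω : ∀ x, ω₀ (-x) = -ω₀ x) (hθ : ∀ x, θ₀ (-x) = θ₀ x) {t : ℝ}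
    (ht : t ∈ Ico 0 T) (x : ℝ) : ω t (-x) = -ω t x := by
  obtain ⟨t₁, htt₁, ht₁⟩ := exists_between ht.2
  obtain ⟨M, hM0, hM⟩ := sol.exists_bound hL ht₁
  have hIco : ∀ t ∈ Icc 0 t₁, t ∈ Ico 0 T := fun t ht => ⟨ht.1, ht.2.trans_lt ht₁⟩
  have hIoo : ∀ t ∈ Ioo 0 t₁, t ∈ Ioo 0 T := fun t ht => ⟨ht.1, ht.2.trans ht₁⟩
  set K := ((1 / π) * ∫ z in (-(L / 2))..(L / 2), |log (sin (π / L * z))|) ^ 2 with hK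
  set p : ℝ → ℝ → ℝ := fun t x => deriv (θ t) x with hpdef
  have hp1 : SpaceTimeContDiff 1 T p := sol.gradient_contDiff
  have hω1 := sol.vorticity_contDiff
  -- twice the even parts of the vorticity and of the density gradient
  set W : ℝ → ℝ → ℝ := fun t x => ω t x + ω t (-x) with hW
  set P : ℝ → ℝ → ℝ := fun t x => p t x + p t (-x) with hP
  have hWC : SpaceTimeContDiff 1 T W := ContDiffOn.add hω1 hω1.reflect
  have hPC : SpaceTimeContDiff 1 T P := ContDiffOn.add hp1 hp1.reflect
  set G : ℝ → ℝ → ℝ := fun t x => W t x ^ 2 + P t x ^ 2 with hGdef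
  have hGC : SpaceTimeContDiff 1 T G :=
    ContDiffOn.add (ContDiffOn.pow hWC 2) (ContDiffOn.pow hPC 2)
  have hWper : ∀ t ∈ Ico 0 T, Function.Periodic (W t) L := fun t ht x => by
    simp only [hW, sol.periodic_vorticity t ht x, periodic_reflect (sol.periodic_vorticity t ht) x]
  have hPper : ∀ t ∈ Ico 0 T, Function.Periodic (P t) L := fun t ht x => by
    simp only [hP, hpdef, sol.periodic_gradient ht x, periodic_reflect (sol.periodic_gradient ht) x]
  have hE0 : (∫ x in (0 : ℝ)..L, G 0 x) = 0 := by
    have h1 : ω 0 = ω₀ := funext sol.initial_vorticity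
    have h2 : θ 0 = θ₀ := funext sol.initial_density
    have h3 : ∀ x, deriv θ₀ (-x) = -deriv θ₀ x := by
      intro x
      have := deriv_comp_neg (f := θ₀) x
      rw [funext hθ] at this
      linarith
    have : ∀ x, G 0 x = 0 := fun x => by simp [hGdef, hW, hP, hpdef, h1, h2, h3, hω]
    simp [this]
  have hE : (∫ x in (0 : ℝ)..L, G t x) = 0 := by
    refine eq_zero_of_deriv_le (E := fun t => ∫ x in (0 : ℝ)..L, G t x)
      (C := (1 + 4 * M) + 2 * M * K + M + M)
      ((hGC.continuousOn_integral_slice hL.le).mono hIco)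
      (fun t ht => hGC.hasDerivAt_integral_slice hL.le (hIoo t ht)) (fun t ht => ?_) hE0
      (fun t _ => intervalIntegral.integral_nonneg hL.le fun x _ => by positivity)
      ⟨ht.1, htt₁.le⟩
    have htT := hIoo t ht
    have htI := Ioo_subset_Ico_self htT
    have htC := Ioo_subset_Icc_self ht
    have hωs := hω1.slice htI
    have hωp := sol.periodic_vorticity t htI
    have hWs := hWC.slice htI
    set u := velocity L (ω t) with hu
    set U := velocity L (W t) with hU
    have huC : ContDiff ℝ 1 u := contDiff_velocity hL hωs hωp
    have hUC : ContDiff ℝ 1 U := contDiff_velocity hL hWs (hWper t htI)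
    have hUeq : ∀ x, U x = u x + u (-x) := fun x => by
      rw [hU, hu, ← velocity_reflect hL hωp]
      exact velocity_add hL hωs.continuous (hωs.continuous.comp continuous_neg) x
    have hUd : ∀ x, deriv U x = deriv u x - deriv u (-x) := by
      intro x
      have h1 := (huC.differentiable one_ne_zero x).hasDerivAt
      have h2 := hasDerivAt_comp_neg (huC.differentiable one_ne_zero (-x)).hasDerivAt
      rw [funext hUeq]
      exact (h1.add h2).deriv
    have hpt : ∀ x ∈ Icc 0 L, deriv (fun s => G s x) t ≤
        (1 + 4 * M) * G t x + 2 * M * U x ^ 2 + M * deriv U x ^ 2 - u x * deriv (G t) x := by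
      intro x _
      have hWt : HasDerivAt (fun s => W s x)
          (P t x - u x * (deriv (ω t) x - deriv (ω t) (-x)) - U x * deriv (ω t) (-x)) t := by
        refine ((hω1.hasDerivAt htT x).add (hω1.hasDerivAt htT (-x))).congr_deriv ?_
        rw [sol.deriv_vorticity htT, sol.deriv_vorticity htT, hUeq]
        simp only [hP, hpdef, hu]
        ring
      have hPt : HasDerivAt (fun s => P s x) (-(deriv u x * P t x) -
          u x * (deriv (p t) x - deriv (p t) (-x)) + deriv U x * p t (-x) -
            U x * deriv (p t) (-x)) t := by
        refine ((hp1.hasDerivAt htT x).add (hp1.hasDerivAt htT (-x))).congr_deriv ?_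
        have e1 := sol.deriv_gradient hL htT x
        have e2 := sol.deriv_gradient hL htT (-x)
        simp only [hpdef] at e1 e2 ⊢
        rw [e1, e2, hUeq, hUd]
        simp only [hP, hpdef, hu]
        ring
      have hWx : HasDerivAt (W t) (deriv (ω t) x - deriv (ω t) (-x)) x :=
        (hω1.hasDerivAt_space htI x).add (hasDerivAt_comp_neg (hω1.hasDerivAt_space htI (-x)))
      have hPx : HasDerivAt (P t) (deriv (p t) x - deriv (p t) (-x)) x :=
        (hp1.hasDerivAt_space htI x).add (hasDerivAt_comp_neg (hp1.hasDerivAt_space htI (-x)))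
      have hGt := ((hWt.pow 2).add (hPt.pow 2)).deriv
      have hGx := ((hWx.pow 2).add (hPx.pow 2)).deriv
      have hM1 := hM t htC x
      have hM2 := hM t htC (-x)
      have key := energy_density_le (W := W t x) (P := P t x) (U := U x) (V := deriv U x)
        (s := u x) (G := deriv (G t) x) hM0 hM2.1 hM2.2.1 hM2.2.2.1 hM1.2.2.2
        (Wx := deriv (ω t) x - deriv (ω t) (-x)) (Px := deriv (p t) x - deriv (p t) (-x)) (by
          refine hGx.trans ?_
          ring)
      refine le_trans (le_of_eq ?_) key
      refine hGt.trans ?_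
      simp only [hpdef]
      ring
    have hGs := hGC.slice htI
    have hibp := integral_mul_deriv_eq_neg (a := 0) (b := L) huC hGs (by
      have h1 : u L = u 0 := by simpa using velocity_periodic hL hωp 0
      have h2 : W t L = W t 0 := by simpa using hWper t htI 0
      have h3 : P t L = P t 0 := by simpa using hPper t htI 0
      simp only [hGdef, h1, h2, h3])
    have hdu := huC.continuous_deriv le_rfl
    have hdG := hGs.continuous_deriv le_rfl
    have hdU := hUC.continuous_deriv le_rfl
    have iG : ∀ c : ℝ, IntervalIntegrable (fun x => c * G t x) volume 0 L := fun c =>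
      (hGs.continuous.intervalIntegrable _ _).const_mul _
    have iU : IntervalIntegrable (fun x => 2 * M * U x ^ 2) volume 0 L :=
      ((hUC.continuous.pow 2).intervalIntegrable _ _).const_mul _
    have iV : IntervalIntegrable (fun x => M * deriv U x ^ 2) volume 0 L :=
      ((hdU.pow 2).intervalIntegrable _ _).const_mul _
    have iu : IntervalIntegrable (fun x => u x * deriv (G t) x) volume 0 L :=
      (huC.continuous.mul hdG).intervalIntegrable _ _
    have hle := intervalIntegral.integral_mono_on hL.le
      ((hGC.continuous_deriv_time_slice htT).intervalIntegrable _ _)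
      ((((iG (1 + 4 * M)).add iU).add iV).sub iu) hpt
    have hle2 : (∫ x in (0 : ℝ)..L, deriv u x * G t x) ≤ ∫ x in (0 : ℝ)..L, M * G t x :=
      intervalIntegral.integral_mono_on hL.le
        ((hdu.mul hGs.continuous).intervalIntegrable _ _) (iG M) fun x _ =>
          mul_le_mul_of_nonneg_right ((le_abs_self _).trans (hM t htC x).2.2.2) (by positivity)
    have hWG : (∫ x in (0 : ℝ)..L, W t x ^ 2) ≤ ∫ x in (0 : ℝ)..L, G t x :=
      intervalIntegral.integral_mono_on hL.le
        ((hWs.continuous.pow 2).intervalIntegrable _ _) (hGs.continuous.intervalIntegrable _ _)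
        fun x _ => le_add_of_nonneg_right (sq_nonneg _)
    have hU2 := integral_sq_velocity_le hL hWs (hWper t htI)
    have hV2 := integral_sq_deriv_velocity_le hL hWs (hWper t htI)
    rw [intervalIntegral.integral_sub (((iG _).add iU).add iV) iu,
      intervalIntegral.integral_add ((iG _).add iU) iV, intervalIntegral.integral_add (iG _) iU,
      hibp, intervalIntegral.integral_const_mul, intervalIntegral.integral_const_mul,
      intervalIntegral.integral_const_mul] at hle
    rw [intervalIntegral.integral_const_mul] at hle2
    have hK0 : 0 ≤ K := sq_nonneg _
    have hU3 := mul_le_mul_of_nonneg_left (hU2.trans (mul_le_mul_of_nonneg_left hWG hK0))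
      (by positivity : 0 ≤ 2 * M)
    have hV3 := mul_le_mul_of_nonneg_left (hV2.trans hWG) hM0
    linarith
  obtain ⟨y, hy, hxy⟩ := (hWper t ht).exists_mem_Ico₀ hL x
  have hz := eq_zero_of_integral_eq_zero hL (hGC.slice ht).continuous.continuousOn
    (fun x _ => by positivity) hE (Ico_subset_Icc_self hy)
  have hW0 : W t y = 0 := by
    have h1 := sq_nonneg (W t y)
    have h2 := sq_nonneg (P t y)
    exact pow_eq_zero_iff two_ne_zero |>.1 (by simp only [hGdef] at hz; linarith)
  rw [← hxy] at hW0
  simp only [hW] at hW0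
  linarith

/-- The density stays nondecreasing on the half period. -/
theorem IsRegularSolution.gradient_nonneg (sol : IsRegularSolution L ω₀ θ₀ (Ico 0 T) ω θ)
    (hL : 0 < L) (hω : ∀ x, ω₀ (-x) = -ω₀ x) (hθ : ∀ x, θ₀ (-x) = θ₀ x)
    (hmono : ∀ x ∈ Icc 0 (L / 2), 0 ≤ deriv θ₀ x) {t : ℝ} (ht : t ∈ Ico 0 T) {x : ℝ}
    (hx : x ∈ Icc 0 (L / 2)) : 0 ≤ deriv (θ t) x := by
  obtain ⟨t₁, htt₁, ht₁⟩ := exists_between ht.2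
  obtain ⟨M, hM0, hM⟩ := sol.exists_bound hL ht₁
  have hIco : ∀ t ∈ Ioo 0 t₁, t ∈ Ico 0 T := fun t ht => ⟨ht.1.le, ht.2.trans ht₁⟩
  have h2 : θ 0 = θ₀ := funext sol.initial_density
  refine nonneg_of_transport (f := fun t x => deriv (θ t) x) (v := fun t => velocity L (ω t))
    (c := fun t x => -deriv (velocity L (ω t)) x) (C := M) sol.gradient_contDiff (half_pos hL) ht₁
    (fun t ht => contDiff_velocity hL (sol.vorticity_contDiff.slice (hIco t ht))
      (sol.periodic_vorticity t (hIco t ht)))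
    (fun t ht => velocity_zero hL (sol.vorticity_contDiff.slice (hIco t ht)).continuous
      (sol.periodic_vorticity t (hIco t ht)) (sol.odd_vorticity hL hω hθ (hIco t ht)))
    (fun t ht => velocity_half_period hL (sol.vorticity_contDiff.slice (hIco t ht)).continuous
      (sol.periodic_vorticity t (hIco t ht)) (sol.odd_vorticity hL hω hθ (hIco t ht)))
    (fun t ht x => (hM t (Ioo_subset_Icc_self ht) x).2.2.2)
    (fun t ht x => by rw [abs_neg]; exact (hM t (Ioo_subset_Icc_self ht) x).2.2.2)
    (fun t ht x _ => ?_) (fun x hx => ?_) ⟨ht.1, htt₁.le⟩ hx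
  · have := sol.deriv_gradient hL ⟨ht.1, ht.2.trans ht₁⟩ x
    linarith
  · rw [h2]
    exact hmono x hx

/-- The vorticity stays nonnegative on the half period. -/
theorem IsRegularSolution.vorticity_nonneg (sol : IsRegularSolution L ω₀ θ₀ (Ico 0 T) ω θ)
    (hL : 0 < L) (hω : ∀ x, ω₀ (-x) = -ω₀ x) (hθ : ∀ x, θ₀ (-x) = θ₀ x)
    (hmono : ∀ x ∈ Icc 0 (L / 2), 0 ≤ deriv θ₀ x) (hpos : ∀ x ∈ Icc 0 (L / 2), 0 ≤ ω₀ x)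
    {t : ℝ} (ht : t ∈ Ico 0 T) {x : ℝ} (hx : x ∈ Icc 0 (L / 2)) : 0 ≤ ω t x := by
  obtain ⟨t₁, htt₁, ht₁⟩ := exists_between ht.2
  obtain ⟨M, hM0, hM⟩ := sol.exists_bound hL ht₁
  have hIco : ∀ t ∈ Ioo 0 t₁, t ∈ Ico 0 T := fun t ht => ⟨ht.1.le, ht.2.trans ht₁⟩
  refine nonneg_of_transport (f := ω) (v := fun t => velocity L (ω t))
    (c := fun _ _ => 0) (C := M) sol.vorticity_contDiff (half_pos hL) ht₁
    (fun t ht => contDiff_velocity hL (sol.vorticity_contDiff.slice (hIco t ht))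
      (sol.periodic_vorticity t (hIco t ht)))
    (fun t ht => velocity_zero hL (sol.vorticity_contDiff.slice (hIco t ht)).continuous
      (sol.periodic_vorticity t (hIco t ht)) (sol.odd_vorticity hL hω hθ (hIco t ht)))
    (fun t ht => velocity_half_period hL (sol.vorticity_contDiff.slice (hIco t ht)).continuous
      (sol.periodic_vorticity t (hIco t ht)) (sol.odd_vorticity hL hω hθ (hIco t ht)))
    (fun t ht x => (hM t (Ioo_subset_Icc_self ht) x).2.2.2)
    (fun t ht x => by rwa [abs_zero])
    (fun t ht x hx => ?_) (fun x hx => ?_) ⟨ht.1, htt₁.le⟩ hx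
  · have h1 := sol.deriv_vorticity ⟨ht.1, ht.2.trans ht₁⟩ x
    have h2 := sol.gradient_nonneg hL hω hθ hmono (hIco t ht) hx
    linarith
  · rw [sol.initial_vorticity]
    exact hpos x hx

end solution

/-! ### A quadratic system of differential inequalities -/

section blowup

theorem monotoneOn_Ico_of_hasDerivAt {f f' : ℝ → ℝ} {s T : ℝ} (hf : ContinuousOn f (Ico s T))
    (hd : ∀ t ∈ Ioo s T, HasDerivAt f (f' t) t) (h : ∀ t ∈ Ioo s T, 0 ≤ f' t) :
    MonotoneOn f (Ico s T) := by
  refine monotoneOn_of_deriv_nonneg (convex_Ico s T) hf ?_ ?_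
  · rw [interior_Ico]
    exact fun t ht => (hd t ht).differentiableAt.differentiableWithinAt
  · rw [interior_Ico]
    intro t ht
    rw [(hd t ht).deriv]
    exact h t ht

/-- If `I' ≥ a J` and `J' ≥ b I²`, then `I` is unbounded before the time `2 √(6 / (a b m))`, where
`m > 0` bounds `I` from below initially: each step of length `2⁻ᵏ √(6 / (a b m))` multiplies the
lower bound by four. -/
theorem exists_lt_of_quadratic {I J I' J' : ℝ → ℝ} {a b m T : ℝ} (ha : 0 < a) (hb : 0 < b)
    (hm : 0 < m) (hT : T = 2 * √(6 / (a * b * m))) (hI : ContinuousOn I (Ico 0 T))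
    (hJ : ContinuousOn J (Ico 0 T)) (hI' : ∀ t ∈ Ioo 0 T, HasDerivAt I (I' t) t)
    (hJ' : ∀ t ∈ Ioo 0 T, HasDerivAt J (J' t) t) (hIJ : ∀ t ∈ Ioo 0 T, a * J t ≤ I' t)
    (hJI : ∀ t ∈ Ioo 0 T, b * I t ^ 2 ≤ J' t) (hI0 : m ≤ I 0) (hJ0 : 0 ≤ J 0) (B : ℝ) :
    ∃ t ∈ Ico 0 T, B < I t := by
  set τ := √(6 / (a * b * m)) with hτ
  have hτ0 : 0 < τ := Real.sqrt_pos.2 (by positivity)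
  have hτ2 : a * b * m * τ ^ 2 = 6 := by
    rw [hτ, Real.sq_sqrt (by positivity)]
    field_simp
  have hJmono : MonotoneOn J (Ico 0 T) :=
    monotoneOn_Ico_of_hasDerivAt hJ hJ' fun t ht => le_trans (by positivity) (hJI t ht)
  have hJpos : ∀ t ∈ Ico 0 T, 0 ≤ J t := fun t ht =>
    hJ0.trans (hJmono ⟨le_rfl, ht.1.trans_lt ht.2⟩ ht ht.1)
  have hImono : MonotoneOn I (Ico 0 T) :=
    monotoneOn_Ico_of_hasDerivAt hI hI' fun t ht =>
      le_trans (mul_nonneg ha.le (hJpos t (Ioo_subset_Ico_self ht))) (hIJ t ht)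
  have hstep : ∀ s ∈ Ico 0 T, ∀ n, 0 < n → n ≤ I s → ∀ t ∈ Ico s T,
      I s + a * b * n ^ 2 * (t - s) ^ 2 / 2 ≤ I t := by
    intro s hs n hn hnI t ht
    have hsub : Ico s T ⊆ Ico 0 T := Ico_subset_Ico_left hs.1
    have hsub' : Ioo s T ⊆ Ioo 0 T := Ioo_subset_Ioo_left hs.1
    -- `J' ≥ b n²` is integrated first, then `I' ≥ a b n² (t - s)`
    have h1 : MonotoneOn (fun t => J t - b * n ^ 2 * (t - s)) (Ico s T) := by
      refine monotoneOn_Ico_of_hasDerivAt (f' := fun t => J' t - b * n ^ 2)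
        ((hJ.mono hsub).sub (by fun_prop)) (fun t ht => ?_) fun t ht => ?_
      · have := ((hasDerivAt_id t).sub_const s).const_mul (b * n ^ 2)
        rw [mul_one] at this
        exact (hJ' t (hsub' ht)).sub this
      · have h2 : n ≤ I t := hnI.trans (hImono hs (hsub (Ioo_subset_Ico_self ht)) ht.1.le)
        have h3 := hJI t (hsub' ht)
        have h4 : b * n ^ 2 ≤ b * I t ^ 2 := by gcongr
        linarith
    have h5 : ∀ t ∈ Ico s T, b * n ^ 2 * (t - s) ≤ J t := by
      intro t ht
      have := h1 ⟨le_rfl, hs.2⟩ ht ht.1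
      simp only [sub_self, mul_zero, sub_zero] at this
      linarith [hJpos s hs]
    have h6 : MonotoneOn (fun t => I t - a * b * n ^ 2 * (t - s) ^ 2 / 2) (Ico s T) := by
      refine monotoneOn_Ico_of_hasDerivAt (f' := fun t => I' t - a * b * n ^ 2 * (t - s))
        ((hI.mono hsub).sub (by fun_prop)) (fun t ht => ?_) fun t ht => ?_
      · have := ((((hasDerivAt_id t).sub_const s).pow 2).const_mul (a * b * n ^ 2)).div_const 2
        refine (hI' t (hsub' ht)).sub (this.congr_deriv ?_)
        simp
        ring
      · have h7 := hIJ t (hsub' ht)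
        have h8 := mul_le_mul_of_nonneg_left (h5 t (Ioo_subset_Ico_self ht)) ha.le
        linarith
    have := h6 ⟨le_rfl, hs.2⟩ ht ht.1
    simp only [sub_self, ne_eq, OfNat.ofNat_ne_zero, not_false_eq_true, zero_pow, mul_zero,
      zero_div, sub_zero] at this
    linarith
  -- the partial sums of the step lengths `τ, τ / 2, τ / 4, …`
  set s : ℕ → ℝ := fun k => 2 * τ * (1 - (1 / 2) ^ k) with hs
  have hsmem : ∀ k, s k ∈ Ico 0 T := by
    intro k
    have h1 : (0 : ℝ) < (1 / 2) ^ k := by positivity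
    have h2 : ((1 : ℝ) / 2) ^ k ≤ 1 := pow_le_one₀ (by norm_num) (by norm_num)
    refine ⟨mul_nonneg (by positivity) (by linarith), ?_⟩
    rw [hT]
    simp only [hs]
    nlinarith
  have hgrow : ∀ k, 4 ^ k * m ≤ I (s k) := by
    intro k
    induction k with
    | zero => simpa [hs] using hI0
    | succ k ih =>
      have hdiff : s (k + 1) - s k = τ * (1 / 2) ^ k := by
        simp only [hs, pow_succ]; ring
      have hle : s k ≤ s (k + 1) := by
        have : 0 ≤ τ * (1 / 2) ^ k := by positivity
        linarith
      have h1 := hstep (s k) (hsmem k) (4 ^ k * m) (by positivity) ih (s (k + 1))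
        ⟨hle, (hsmem (k + 1)).2⟩
      have h2 : a * b * (4 ^ k * m) ^ 2 * (s (k + 1) - s k) ^ 2 / 2 = 3 * (4 ^ k * m) := by
        rw [hdiff]
        have h3 : ((4 : ℝ) ^ k) * ((1 / 2) ^ k) ^ 2 = 1 := by
          rw [← pow_mul, mul_comm k 2, pow_mul, ← mul_pow]; norm_num
        calc _ = (a * b * m * τ ^ 2) * (4 ^ k * ((1 / 2) ^ k) ^ 2) * (4 ^ k * m) / 2 := by ring
          _ = _ := by rw [hτ2, h3]; ring
      rw [h2] at h1
      calc (4 : ℝ) ^ (k + 1) * m = 4 ^ k * m + 3 * (4 ^ k * m) := by ring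
        _ ≤ I (s k) + 3 * (4 ^ k * m) := by linarith
        _ ≤ _ := h1
  obtain ⟨k, hk⟩ := pow_unbounded_of_one_lt (B / m) (by norm_num : (1 : ℝ) < 4)
  refine ⟨s k, hsmem k, lt_of_lt_of_le ?_ (hgrow k)⟩
  rwa [div_lt_iff₀ hm] at hk

theorem sq_integral_le {y : ℝ → ℝ} {a b : ℝ} (hab : a < b) (hy : ContinuousOn y (Icc a b)) :
    (∫ x in a..b, y x) ^ 2 ≤ (b - a) * ∫ x in a..b, y x ^ 2 := by
  have hba : 0 < b - a := sub_pos.2 hab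
  have hi : IntervalIntegrable y volume a b := by
    refine ContinuousOn.intervalIntegrable ?_
    rwa [uIcc_of_le hab.le]
  have hi2 : IntervalIntegrable (fun x => y x ^ 2) volume a b := by
    refine ContinuousOn.intervalIntegrable ?_
    rw [uIcc_of_le hab.le]
    exact hy.pow 2
  set A := ∫ x in a..b, y x with hA
  -- the integral of the squared deviation from the mean value is nonnegative
  have h : 0 ≤ ∫ x in a..b, (y x - A / (b - a)) ^ 2 :=
    intervalIntegral.integral_nonneg hab.le fun x _ => sq_nonneg _
  have e : ∀ x, (y x - A / (b - a)) ^ 2 =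
      y x ^ 2 - 2 * (A / (b - a)) * y x + (A / (b - a)) ^ 2 := fun x => by ring
  simp only [e] at h
  rw [intervalIntegral.integral_add (hi2.sub (hi.const_mul _)) (by simp),
    intervalIntegral.integral_sub hi2 (hi.const_mul _), intervalIntegral.integral_const_mul,
    intervalIntegral.integral_const, ← hA, smul_eq_mul] at h
  have h2 : (∫ x in a..b, y x ^ 2) - 2 * (A / (b - a)) * A + (b - a) * (A / (b - a)) ^ 2 =
      (∫ x in a..b, y x ^ 2) - A ^ 2 / (b - a) := by field_simp; ring
  rw [h2, sub_nonneg, div_le_iff₀ hba] at h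
  linarith

end blowup

/-! ### Formation of the shock -/

section shock

variable {L : ℝ}

/-- The growth of a weighted integral of a monotone quantity transported by the flow. -/
theorem integral_mul_le_integral_deriv_mul_velocity (hL : 0 < L) {w h : ℝ → ℝ} {x₀ : ℝ}
    (hw : ContDiff ℝ 1 w)
    (hper : Function.Periodic w L) (hodd : ∀ x, w (-x) = -w x)
    (hpos : ∀ x ∈ Icc 0 (L / 2), 0 ≤ w x) (hh : ContDiff ℝ 1 h)
    (hh' : ∀ x ∈ Icc 0 (L / 2), 0 ≤ deriv h x) (hx₀ : x₀ ∈ Ioo 0 (L / 2)) (hzero : h x₀ = 0) :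
    (2 / π) * ∫ x in x₀..(L / 2), h x * w x * cot (π / L * x) ≤
      ∫ x in x₀..(L / 2), deriv h x * -(velocity L w x * cot (π / L * x)) := by
  set φ : ℝ → ℝ := fun x => w x * cot (π / L * x) with hφ
  have hcot := continuousOn_cot hL hx₀.1
  have hφc : ContinuousOn φ (Icc x₀ (L / 2)) := hw.continuous.continuousOn.mul hcot
  have hd : Continuous (deriv h) := hh.continuous_deriv le_rfl
  have hφi : ∀ x ∈ Icc x₀ (L / 2), IntervalIntegrable φ volume x (L / 2) := by
    intro x hx
    refine ContinuousOn.intervalIntegrable ?_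
    rw [uIcc_of_le hx.2]
    exact hφc.mono (Icc_subset_Icc_left hx.1)
  have hR : ∀ x ∈ Icc x₀ (L / 2), HasDerivAt (fun x => ∫ y in x..(L / 2), φ y) (-φ x) x := by
    intro x hx
    have hx' : x ∈ Ioc 0 (L / 2) := ⟨hx₀.1.trans_le hx.1, hx.2⟩
    refine intervalIntegral.integral_hasDerivAt_left (hφi x hx)
      (hw.continuous.measurable.mul
        (measurable_cot_mul (π / L))).stronglyMeasurable.stronglyMeasurableAtFilter ?_
    exact hw.continuous.continuousAt.mul (hasDerivAt_cot_mul hL hx').continuousAt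
  have hRc : ContinuousOn (fun x => ∫ y in x..(L / 2), φ y) (Icc x₀ (L / 2)) :=
    fun x hx => (hR x hx).continuousAt.continuousWithinAt
  have hle := hx₀.2.le
  have hparts := intervalIntegral.integral_mul_deriv_eq_deriv_mul
    (u := fun x => ∫ y in x..(L / 2), φ y) (v := h) (u' := fun x => -φ x) (v' := deriv h)
    (a := x₀) (b := L / 2) (fun x hx => hR x (by rwa [uIcc_of_le hle] at hx))
    (fun x _ => (hh.differentiable one_ne_zero x).hasDerivAt) (hφi x₀ ⟨le_rfl, hle⟩).neg
    (hd.intervalIntegrable _ _)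
  rw [hzero, mul_zero, intervalIntegral.integral_same, zero_mul, sub_zero, zero_sub] at hparts
  have e1 : (∫ x in x₀..(L / 2), h x * w x * cot (π / L * x)) =
      ∫ x in x₀..(L / 2), (∫ y in x..(L / 2), φ y) * deriv h x := by
    rw [hparts, ← intervalIntegral.integral_neg]
    congr 1
    funext x
    simp only [hφ]
    ring
  rw [e1, ← intervalIntegral.integral_const_mul]
  refine intervalIntegral.integral_mono_on_of_le_Ioo hle ?_ ?_ fun x hx => ?_
  · refine ContinuousOn.intervalIntegrable ?_
    rw [uIcc_of_le hle]
    exact continuousOn_const.mul (hRc.mul hd.continuousOn)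
  · refine ContinuousOn.intervalIntegrable ?_
    rw [uIcc_of_le hle]
    exact hd.continuousOn.mul ((continuous_velocity hL hw hper).continuousOn.mul hcot).neg
  · have hx' : x ∈ Ioo 0 (L / 2) := ⟨hx₀.1.trans hx.1, hx.2⟩
    have := mul_le_mul_of_nonneg_right
      (integral_mul_cot_le hL hw.continuous hper hodd hpos hx') (hh' x (Ioo_subset_Icc_self hx'))
    linarith

theorem hasDerivAt_max_zero_cube (c s : ℝ) :
    HasDerivAt (fun s : ℝ => max (s - c) 0 ^ 3 / 3) (max (s - c) 0 ^ 2) s := by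
  have h0 : ∀ s : ℝ, max s 0 ^ 3 = s * max s 0 ^ 2 := fun s => by
    rcases le_total s 0 with h | h
    · rw [max_eq_right h]; ring
    · rw [max_eq_left h]; ring
  have h1 := (hasDerivAt_id (s - c)).mul (hasDerivAt_max_zero_sq (s - c))
  have h2 : HasDerivAt (fun s : ℝ => max s 0 ^ 3 / 3) (max (s - c) 0 ^ 2) (s - c) := by
    simp only [h0]
    refine (h1.div_const 3).congr_deriv ?_
    rcases le_total (s - c) 0 with h | h
    · simp [max_eq_right h]
    · simp only [max_eq_left h, id]; ring
  exact h2.comp_sub_const s c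

end shock

section shockSolution

variable {L T : ℝ} {ω₀ θ₀ : ℝ → ℝ} {ω θ : ℝ → ℝ → ℝ}

theorem IsRegularSolution.continuousOn_density (sol : IsRegularSolution L ω₀ θ₀ (Ico 0 T) ω θ)
    (x : ℝ) : ContinuousOn (fun t => θ t x) (Ico 0 T) :=
  sol.contDiffOn_density.continuousOn.comp (f := fun t : ℝ => (t, x)) (by fun_prop)
    fun _ ht => ⟨ht, mem_univ _⟩

theorem IsRegularSolution.density_eq_initial (sol : IsRegularSolution L ω₀ θ₀ (Ico 0 T) ω θ)
    {x : ℝ} (hx : ∀ t ∈ Ico 0 T, velocity L (ω t) x = 0) {t : ℝ} (ht : t ∈ Ico 0 T) :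
    θ t x = θ₀ x := by
  have hd : ∀ t ∈ Ioo 0 T, HasDerivAt (fun t => θ t x) 0 t := by
    intro t ht
    have := sol.density_contDiff_one.hasDerivAt ht x
    rwa [sol.deriv_density ht, hx t (Ioo_subset_Ico_self ht), zero_mul, neg_zero] at this
  have h0 : (0 : ℝ) ∈ Ico 0 T := ⟨le_rfl, ht.1.trans_lt ht.2⟩
  have h1 := monotoneOn_Ico_of_hasDerivAt (sol.continuousOn_density x) hd
    (fun _ _ => le_rfl) h0 ht ht.1
  have h2 := monotoneOn_Ico_of_hasDerivAt (sol.continuousOn_density x).neg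
    (fun t ht => (hd t ht).neg) (fun _ _ => by simp) h0 ht ht.1
  have h3 := sol.initial_density x
  simp only [Pi.neg_apply] at h1 h2
  linarith

/-- The lower bound for the time derivative of the second functional: the stretching term has a
sign, and the buoyancy term controls the square of the first functional. -/
theorem le_integral_buoyancy (hL : 0 < L) {q : ℝ → ℝ} (hq : ContDiff ℝ 1 q) {c M x₀ : ℝ}
    (hM : 0 < M) (hx₀ : x₀ ∈ Ioo 0 (L / 2)) (hc : q x₀ ≤ c)
    (hqM : ∀ x ∈ Icc x₀ (L / 2), q x - c ≤ M) :
    2 * π / (3 * M * L ^ 2) * (∫ x in x₀..(L / 2), max (q x - c) 0 ^ 2 * cot (π / L * x)) ^ 2 ≤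
      ∫ x in x₀..(L / 2), max (q x - c) 0 ^ 2 * deriv q x * cot (π / L * x) := by
  have hpi := pi_pos
  have hle := hx₀.2.le
  have hqc := hq.continuous
  have hqd : Continuous (deriv q) := hq.continuous_deriv le_rfl
  have hcot := continuousOn_cot hL hx₀.1
  have hmem : ∀ x ∈ Icc x₀ (L / 2), x ∈ Ioc 0 (L / 2) := fun x hx => ⟨hx₀.1.trans_le hx.1, hx.2⟩
  have hsin : ∀ x ∈ Icc x₀ (L / 2), 0 < sin (π / L * x) := fun x hx =>
    sin_angle_pos hL (hmem x hx)
  have hmaxc : Continuous fun x => max (q x - c) 0 := by fun_prop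
  have hdcot : ContinuousOn (fun x => -(π / L) / sin (π / L * x) ^ 2) (Icc x₀ (L / 2)) :=
    ContinuousOn.div continuousOn_const (by fun_prop) fun x hx => by
      have := hsin x hx
      positivity
  have hparts := intervalIntegral.integral_mul_deriv_eq_deriv_mul
    (u := fun x => cot (π / L * x)) (v := fun x => max (q x - c) 0 ^ 3 / 3)
    (u' := fun x => -(π / L) / sin (π / L * x) ^ 2)
    (v' := fun x => max (q x - c) 0 ^ 2 * deriv q x) (a := x₀) (b := L / 2)
    (fun x hx => hasDerivAt_cot_mul hL (hmem x (by rwa [uIcc_of_le hle] at hx)))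
    (fun x _ => (hasDerivAt_max_zero_cube c (q x)).comp x
      (hq.differentiable one_ne_zero x).hasDerivAt)
    (ContinuousOn.intervalIntegrable (by rwa [uIcc_of_le hle]))
    (Continuous.intervalIntegrable (by fun_prop) _ _)
  have hcot0 : cot (π / L * (L / 2)) = 0 := by
    have : π / L * (L / 2) = π / 2 := by field_simp
    rw [this, cot_eq_cos_div_sin, cos_pi_div_two, zero_div]
  have hmax0 : max (q x₀ - c) 0 = 0 := max_eq_right (by linarith)
  simp only [hcot0, hmax0] at hparts
  have e1 : (∫ x in x₀..(L / 2), max (q x - c) 0 ^ 2 * deriv q x * cot (π / L * x)) =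
      ∫ x in x₀..(L / 2), π / L / sin (π / L * x) ^ 2 * (max (q x - c) 0 ^ 3 / 3) := by
    have : ∀ x, max (q x - c) 0 ^ 2 * deriv q x * cot (π / L * x) =
      cot (π / L * x) * (max (q x - c) 0 ^ 2 * deriv q x) := fun x => by ring
    simp only [this]
    rw [hparts]
    simp only [neg_div, neg_mul, intervalIntegral.integral_neg]
    ring
  have hycont : ContinuousOn (fun x => max (q x - c) 0 ^ 2 * cot (π / L * x)) (Icc x₀ (L / 2)) :=
    (hmaxc.pow 2).continuousOn.mul hcot
  have h1 := sq_integral_le hx₀.2 hycont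
  -- pointwise, `m⁴ cot² ≤ M m³ / sin²` for `0 ≤ m ≤ M`
  have h2 : (∫ x in x₀..(L / 2), π / (3 * M * L) * (max (q x - c) 0 ^ 2 * cot (π / L * x)) ^ 2) ≤
      ∫ x in x₀..(L / 2), π / L / sin (π / L * x) ^ 2 * (max (q x - c) 0 ^ 3 / 3) := by
    refine intervalIntegral.integral_mono_on hle ?_ ?_ fun x hx => ?_
    · refine ContinuousOn.intervalIntegrable ?_
      rw [uIcc_of_le hle]
      exact continuousOn_const.mul (hycont.pow 2)
    · refine ContinuousOn.intervalIntegrable ?_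
      rw [uIcc_of_le hle]
      refine ContinuousOn.mul (ContinuousOn.div continuousOn_const (by fun_prop) fun x hx => ?_)
        ((hmaxc.pow 3).div_const 3).continuousOn
      have := hsin x hx
      positivity
    · have hs := hsin x hx
      have hm0 : 0 ≤ max (q x - c) 0 := le_max_right _ _
      have hmM : max (q x - c) 0 ≤ M := max_le (hqM x hx) hM.le
      generalize max (q x - c) 0 = m at *
      rw [cot_eq_cos_div_sin]
      have h3 : cos (π / L * x) ^ 2 ≤ 1 := cos_sq_le_one _
      generalize sin (π / L * x) = s at *
      generalize cos (π / L * x) = d at *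
      have e2 : π / (3 * M * L) * (m ^ 2 * (d / s)) ^ 2 =
          π / (3 * L * s ^ 2) * (m ^ 3 * (m * d ^ 2 / M)) := by
        field_simp
      have e3 : π / L / s ^ 2 * (m ^ 3 / 3) = π / (3 * L * s ^ 2) * (m ^ 3 * 1) := by
        field_simp
      rw [e2, e3]
      have h4 : m * d ^ 2 / M ≤ 1 := by
        rw [div_le_one hM]
        nlinarith
      gcongr
  rw [intervalIntegral.integral_const_mul] at h2
  rw [e1]
  refine le_trans ?_ h2
  have h5 : 0 ≤ ∫ x in x₀..(L / 2), (max (q x - c) 0 ^ 2 * cot (π / L * x)) ^ 2 :=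
    intervalIntegral.integral_nonneg hle fun x _ => sq_nonneg _
  have h6 : (∫ x in x₀..(L / 2), max (q x - c) 0 ^ 2 * cot (π / L * x)) ^ 2 ≤
      L / 2 * ∫ x in x₀..(L / 2), (max (q x - c) 0 ^ 2 * cot (π / L * x)) ^ 2 := by
    refine h1.trans (mul_le_mul_of_nonneg_right ?_ h5)
    linarith [hx₀.1]
  calc _ ≤ 2 * π / (3 * M * L ^ 2) *
        (L / 2 * ∫ x in x₀..(L / 2), (max (q x - c) 0 ^ 2 * cot (π / L * x)) ^ 2) := by gcongr
    _ = _ := by field_simp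

/-- The density reaches the level `c` at every point of the half period before the time
determined by the data: otherwise the functional `∫ (θ - c)₊² cot` would stay bounded, whereas
it satisfies a system of quadratic differential inequalities. -/
theorem IsRegularSolution.exists_le_density (sol : IsRegularSolution L ω₀ θ₀ (Ico 0 T) ω θ)
    (hL : 0 < L) (hω : ∀ x, ω₀ (-x) = -ω₀ x) (hθ : ∀ x, θ₀ (-x) = θ₀ x)
    (hmono : ∀ x ∈ Icc 0 (L / 2), 0 ≤ deriv θ₀ x) (hpos : ∀ x ∈ Icc 0 (L / 2), 0 ≤ ω₀ x)
    {c m x₀ : ℝ} (hc : c < θ₀ (L / 2)) (hm : 0 < m) (hx₀ : x₀ ∈ Ioo 0 (L / 2))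
    (hI0 : m ≤ ∫ x in x₀..(L / 2), max (θ₀ x - c) 0 ^ 2 * cot (π / L * x))
    (hT : T = 2 * √(6 / (2 / π * (2 * π / (3 * (θ₀ (L / 2) - c) * L ^ 2)) * m))) :
    ∃ t ∈ Ico 0 T, c ≤ θ t x₀ := by
  by_contra! hlt
  have hpi := pi_pos
  have hM : 0 < θ₀ (L / 2) - c := sub_pos.2 hc
  have hT0 : 0 < T := by rw [hT]; positivity
  have hle := hx₀.2.le
  have hcot := continuousOn_cot hL hx₀.1
  have hcotpos : ∀ x ∈ Icc x₀ (L / 2), 0 ≤ cot (π / L * x) := fun x hx =>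
    cot_nonneg_of_mem hL ⟨hx₀.1.le.trans hx.1, hx.2⟩
  have hωC := sol.vorticity_contDiff
  have hodd : ∀ t ∈ Ico 0 T, ∀ x, ω t (-x) = -ω t x := fun t ht =>
    sol.odd_vorticity hL hω hθ ht
  have hωpos : ∀ t ∈ Ico 0 T, ∀ x ∈ Icc 0 (L / 2), 0 ≤ ω t x := fun t ht x hx =>
    sol.vorticity_nonneg hL hω hθ hmono hpos ht hx
  have hgrad : ∀ t ∈ Ico 0 T, ∀ x ∈ Icc 0 (L / 2), 0 ≤ deriv (θ t) x := fun t ht x hx =>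
    sol.gradient_nonneg hL hω hθ hmono ht hx
  have hend : ∀ t ∈ Ico 0 T, θ t (L / 2) = θ₀ (L / 2) := fun t ht =>
    sol.density_eq_initial (fun t ht => velocity_half_period hL (hωC.slice ht).continuous
      (sol.periodic_vorticity t ht) (hodd t ht)) ht
  have hθmono : ∀ t ∈ Ico 0 T, MonotoneOn (θ t) (Icc 0 (L / 2)) := fun t ht =>
    monotoneOn_of_deriv_nonneg (convex_Icc _ _)
      (sol.density_contDiff.slice ht).continuous.continuousOn
      ((sol.density_contDiff.slice ht).differentiable two_ne_zero).differentiableOn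
      fun x hx => hgrad t ht x (interior_subset hx)
  have hθM : ∀ t ∈ Ico 0 T, ∀ x ∈ Icc 0 (L / 2), θ t x - c ≤ θ₀ (L / 2) - c := by
    intro t ht x hx
    have := hθmono t ht hx ⟨by positivity, le_rfl⟩ hx.2
    rw [hend t ht] at this
    linarith
  set h : ℝ → ℝ → ℝ := fun t x => max (θ t x - c) 0 ^ 2 with hh
  have hhC : SpaceTimeContDiff 1 T h := contDiff_max_zero_sq.comp_contDiffOn
    (ContDiffOn.sub sol.density_contDiff_one contDiffOn_const)
  have hhx : ∀ t ∈ Ico 0 T, ∀ x, deriv (h t) x = 2 * max (θ t x - c) 0 * deriv (θ t) x :=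
    fun t ht x => ((hasDerivAt_max_zero_sq _).comp x
      ((sol.density_contDiff_one.hasDerivAt_space ht x).sub_const c)).deriv
  have hht : ∀ t ∈ Ioo 0 T, ∀ x, deriv (fun s => h s x) t =
      -(velocity L (ω t) x * deriv (h t) x) := by
    intro t ht x
    have h1 : deriv (fun s => h s x) t = 2 * max (θ t x - c) 0 * deriv (fun s => θ s x) t :=
      ((hasDerivAt_max_zero_sq _).comp t
        ((sol.density_contDiff_one.hasDerivAt ht x).sub_const c)).deriv
    rw [h1, hhx t (Ioo_subset_Ico_self ht), sol.deriv_density ht]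
    ring
  have hzero : ∀ t ∈ Ico 0 T, ∀ x ∈ Icc 0 x₀, h t x = 0 := by
    intro t ht x hx
    have h1 := hθmono t ht ⟨hx.1, hx.2.trans hle⟩ ⟨hx₀.1.le, hle⟩ hx.2
    have h2 := hlt t ht
    simp only [hh]
    rw [max_eq_right (by linarith)]
    norm_num
  have hhmono : ∀ t ∈ Ico 0 T, MonotoneOn (h t) (Icc 0 (L / 2)) := by
    intro t ht x hx y hy hxy
    have := hθmono t ht hx hy hxy
    simp only [hh]
    gcongr
  set g : ℝ → ℝ → ℝ := fun t x => h t x * ω t x with hg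
  have hgC : SpaceTimeContDiff 1 T g := ContDiffOn.mul hhC hωC
  have hgt : ∀ t ∈ Ioo 0 T, ∀ x, deriv (fun s => g s x) t =
      h t x * deriv (θ t) x - deriv (g t) x * velocity L (ω t) x := by
    intro t ht x
    have htI := Ioo_subset_Ico_self ht
    have h1 : deriv (fun s => g s x) t = deriv (fun s => h s x) t * ω t x +
        h t x * deriv (fun s => ω s x) t := ((hhC.hasDerivAt ht x).mul (hωC.hasDerivAt ht x)).deriv
    have h2 : deriv (g t) x = deriv (h t) x * ω t x + h t x * deriv (ω t) x :=
      ((hhC.hasDerivAt_space htI x).mul (hωC.hasDerivAt_space htI x)).deriv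
    rw [h1, h2, hht t ht, sol.deriv_vorticity ht]
    ring
  have key := exists_lt_of_quadratic (I := fun t => ∫ x in x₀..(L / 2), h t x * cot (π / L * x))
    (J := fun t => ∫ x in x₀..(L / 2), g t x * cot (π / L * x)) (a := 2 / π)
    (b := 2 * π / (3 * (θ₀ (L / 2) - c) * L ^ 2)) (m := m) (T := T) (by positivity)
    (by positivity) hm hT (hhC.continuousOn_integral hle hcot)
    (hgC.continuousOn_integral hle hcot)
    (fun t ht => hhC.hasDerivAt_integral hle hcot ht)
    (fun t ht => hgC.hasDerivAt_integral hle hcot ht) ?_ ?_ ?_ ?_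
    (∫ x in x₀..(L / 2), (θ₀ (L / 2) - c) ^ 2 * cot (π / L * x))
  · obtain ⟨t, ht, hlt'⟩ := key
    refine absurd hlt' (not_lt.2 ?_)
    refine intervalIntegral.integral_mono_on hle ?_ ?_ fun x hx => ?_
    · refine ContinuousOn.intervalIntegrable ?_
      rw [uIcc_of_le hle]
      exact (hhC.slice ht).continuous.continuousOn.mul hcot
    · refine ContinuousOn.intervalIntegrable ?_
      rw [uIcc_of_le hle]
      exact continuousOn_const.mul hcot
    · refine mul_le_mul_of_nonneg_right (pow_le_pow_left₀ (le_max_right _ _) ?_ 2) (hcotpos x hx)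
      exact max_le (hθM t ht x ⟨hx₀.1.le.trans hx.1, hx.2⟩) hM.le
  · intro t ht
    have htI := Ioo_subset_Ico_self ht
    refine (integral_mul_le_integral_deriv_mul_velocity hL (hωC.slice htI)
      (sol.periodic_vorticity t htI) (hodd t htI) (hωpos t htI) (hhC.slice htI) (fun x hx => ?_)
      hx₀ (hzero t htI x₀ ⟨hx₀.1.le, le_rfl⟩)).trans (le_of_eq ?_)
    · rw [hhx t htI]
      have := hgrad t htI x hx
      have := le_max_right (θ t x - c) 0
      positivity
    · congr 1
      funext x
      rw [hht t ht]
      ring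
  · intro t ht
    have htI := Ioo_subset_Ico_self ht
    have hθs := sol.density_contDiff_one.slice htI
    have hb := le_integral_buoyancy hL hθs hM hx₀ (hlt t htI).le
      fun x hx => hθM t htI x ⟨hx₀.1.le.trans hx.1, hx.2⟩
    have hs := integral_deriv_mul_velocity_nonpos hL (hωC.slice htI) (sol.periodic_vorticity t htI)
      (hodd t htI) (hωpos t htI) (hhC.slice htI) (hhmono t htI) hx₀ (hzero t htI)
    have hgd : Continuous (deriv (g t)) := (hgC.slice htI).continuous_deriv le_rfl
    have hθd : Continuous (deriv (θ t)) := hθs.continuous_deriv le_rfl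
    have i1 : IntervalIntegrable (fun x => h t x * deriv (θ t) x * cot (π / L * x))
        volume x₀ (L / 2) := by
      refine ContinuousOn.intervalIntegrable ?_
      rw [uIcc_of_le hle]
      exact ((hhC.slice htI).continuous.mul hθd).continuousOn.mul hcot
    have i2 : IntervalIntegrable
        (fun x => deriv (g t) x * (velocity L (ω t) x * cot (π / L * x))) volume x₀ (L / 2) := by
      refine ContinuousOn.intervalIntegrable ?_
      rw [uIcc_of_le hle]
      exact hgd.continuousOn.mul ((continuous_velocity hL (hωC.slice htI)
        (sol.periodic_vorticity t htI)).continuousOn.mul hcot)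
    have e : (∫ x in x₀..(L / 2), deriv (fun s => g s x) t * cot (π / L * x)) =
        (∫ x in x₀..(L / 2), h t x * deriv (θ t) x * cot (π / L * x)) -
        ∫ x in x₀..(L / 2), deriv (g t) x * (velocity L (ω t) x * cot (π / L * x)) := by
      rw [← intervalIntegral.integral_sub i1 i2]
      congr 1
      funext x
      rw [hgt t ht]
      ring
    rw [e]
    have hs' : (∫ x in x₀..(L / 2), deriv (g t) x * (velocity L (ω t) x * cot (π / L * x))) ≤ 0 :=
      hs
    have hb' : 2 * π / (3 * (θ₀ (L / 2) - c) * L ^ 2) *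
        (∫ x in x₀..(L / 2), h t x * cot (π / L * x)) ^ 2 ≤
        ∫ x in x₀..(L / 2), h t x * deriv (θ t) x * cot (π / L * x) := hb
    linarith
  · simpa only [hh, sol.initial_density] using hI0
  · have h0 : (0 : ℝ) ∈ Ico 0 T := ⟨le_rfl, hT0⟩
    refine intervalIntegral.integral_nonneg hle fun x hx => ?_
    have h1 := hωpos 0 h0 x ⟨hx₀.1.le.trans hx.1, hx.2⟩
    have h2 := hcotpos x hx
    simp only [hg, hh]
    positivity

end shockSolution

section shockTime

variable {L T : ℝ} {ω₀ θ₀ : ℝ → ℝ} {ω θ : ℝ → ℝ → ℝ}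

theorem IsRegularSolution.density_zero (sol : IsRegularSolution L ω₀ θ₀ (Ico 0 T) ω θ)
    (hL : 0 < L) (hω : ∀ x, ω₀ (-x) = -ω₀ x) (hθ : ∀ x, θ₀ (-x) = θ₀ x) {t : ℝ}
    (ht : t ∈ Ico 0 T) : θ t 0 = θ₀ 0 :=
  sol.density_eq_initial (fun t ht => velocity_zero hL (sol.vorticity_contDiff.slice ht).continuous
    (sol.periodic_vorticity t ht) (sol.odd_vorticity hL hω hθ ht)) ht

theorem IsRegularSolution.monotoneOn_density_time
    (sol : IsRegularSolution L ω₀ θ₀ (Ico 0 T) ω θ)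
    (hL : 0 < L) (hω : ∀ x, ω₀ (-x) = -ω₀ x) (hθ : ∀ x, θ₀ (-x) = θ₀ x)
    (hmono : ∀ x ∈ Icc 0 (L / 2), 0 ≤ deriv θ₀ x) (hpos : ∀ x ∈ Icc 0 (L / 2), 0 ≤ ω₀ x)
    {x : ℝ} (hx : x ∈ Icc 0 (L / 2)) : MonotoneOn (fun t => θ t x) (Ico 0 T) := by
  refine monotoneOn_Ico_of_hasDerivAt (sol.continuousOn_density x)
    (fun t ht => sol.density_contDiff_one.hasDerivAt ht x) fun t ht => ?_
  have htI := Ioo_subset_Ico_self ht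
  have h1 := velocity_nonpos hL (sol.vorticity_contDiff.slice htI).continuous
    (sol.periodic_vorticity t htI) (sol.odd_vorticity hL hω hθ htI)
    (fun x hx => sol.vorticity_nonneg hL hω hθ hmono hpos htI hx) hx
  have h2 := sol.gradient_nonneg hL hω hθ hmono htI hx
  rw [sol.deriv_density ht]
  nlinarith

/-- The shock forms by a time that depends on the period and the initial density only: the
functional at time zero is bounded below by its part beyond a point `δ` at which `θ₀` takes the
middle value. -/
theorem exists_shock_time (hL : 0 < L) (hsmooth : ContDiff ℝ 2 θ₀)
    (hθ : ∀ x, θ₀ (-x) = θ₀ x) (hmono : ∀ x ∈ Icc 0 (L / 2), 0 ≤ deriv θ₀ x)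
    (hjump : θ₀ 0 < θ₀ (L / 2)) :
    ∃ T : ℝ, 0 < T ∧ ∀ ω₀ : ℝ → ℝ, (∀ x, ω₀ (-x) = -ω₀ x) →
      (∀ x ∈ Icc 0 (L / 2), 0 ≤ ω₀ x) →
      ∀ ω θ : ℝ → ℝ → ℝ, IsRegularSolution L ω₀ θ₀ (Ico 0 T) ω θ →
        (∀ t ∈ Ico 0 T, θ t 0 = θ₀ 0) ∧
        ∀ x ∈ Ioc 0 (L / 2), ∀ᶠ t in 𝓝[<] T, (θ₀ (L / 2) - θ₀ 0) / 2 ≤ θ t x - θ t 0 := by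
  have hpi := pi_pos
  have hL2 : 0 < L / 2 := half_pos hL
  have hc := hsmooth.continuous
  have hθmono : MonotoneOn θ₀ (Icc 0 (L / 2)) :=
    monotoneOn_of_deriv_nonneg (convex_Icc _ _) hc.continuousOn
      (hsmooth.differentiable two_ne_zero).differentiableOn
      fun x hx => hmono x (interior_subset hx)
  set c := (θ₀ 0 + θ₀ (L / 2)) / 2 with hcdef
  have hc2 : c < θ₀ (L / 2) := by rw [hcdef]; linarith
  obtain ⟨δ, hδ, hδc⟩ := intermediate_value_Ioo hL2.le hc.continuousOn
    (show c ∈ Ioo (θ₀ 0) (θ₀ (L / 2)) from ⟨by rw [hcdef]; linarith, hc2⟩)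
  -- a point beyond `δ` at which the integrand defining `m` is positive
  obtain ⟨z, hz, hzc⟩ := intermediate_value_Ioo hδ.2.le hc.continuousOn
    (show (c + θ₀ (L / 2)) / 2 ∈ Ioo (θ₀ δ) (θ₀ (L / 2)) by rw [hδc]; constructor <;> linarith)
  have hcont : ∀ x₀ > 0, ContinuousOn (fun x => max (θ₀ x - c) 0 ^ 2 * cot (π / L * x))
      (Icc x₀ (L / 2)) := fun x₀ hx₀ =>
    (Continuous.continuousOn (by fun_prop)).mul (continuousOn_cot hL hx₀)
  have hnonneg : ∀ x ∈ Icc 0 (L / 2), 0 ≤ max (θ₀ x - c) 0 ^ 2 * cot (π / L * x) := fun x hx =>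
    mul_nonneg (sq_nonneg _) (cot_nonneg_of_mem hL hx)
  set m := ∫ x in δ..(L / 2), max (θ₀ x - c) 0 ^ 2 * cot (π / L * x) with hm
  have hm0 : 0 < m := by
    refine intervalIntegral.integral_pos hδ.2 (hcont δ hδ.1)
      (fun x hx => hnonneg x ⟨hδ.1.le.trans hx.1.le, hx.2⟩) ⟨z, Ioo_subset_Icc_self hz, ?_⟩
    have hz' : z ∈ Ioo 0 (L / 2) := ⟨hδ.1.trans hz.1, hz.2⟩
    have ha := angle_mem_Ioo hL hz'
    have h1 := sin_angle_pos hL ⟨hz'.1, hz'.2.le⟩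
    have h2 := cos_pos_of_mem_Ioo ⟨by linarith [ha.1], ha.2⟩
    have h3 : 0 < max (θ₀ z - c) 0 := lt_max_of_lt_left (by rw [hzc]; linarith)
    rw [cot_eq_cos_div_sin]
    positivity
  have hM : 0 < θ₀ (L / 2) - c := sub_pos.2 hc2
  refine ⟨2 * √(6 / (2 / π * (2 * π / (3 * (θ₀ (L / 2) - c) * L ^ 2)) * m)), by positivity,
    fun ω₀ hω hpos ω θ sol => ?_⟩
  set T := 2 * √(6 / (2 / π * (2 * π / (3 * (θ₀ (L / 2) - c) * L ^ 2)) * m)) with hT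
  have hT0 : 0 < T := by rw [hT]; positivity
  refine ⟨fun t ht => sol.density_zero hL hω hθ ht, fun x hx => ?_⟩
  have htime := sol.monotoneOn_density_time hL hω hθ hmono hpos ⟨hx.1.le, hx.2⟩
  obtain ⟨t₀, ht₀, hle⟩ : ∃ t ∈ Ico 0 T, c ≤ θ t x := by
    rcases le_or_gt c (θ₀ x) with h | h
    · exact ⟨0, ⟨le_rfl, hT0⟩, by rwa [sol.initial_density]⟩
    · have hxδ : x < δ := by
        by_contra! hδx
        have := hθmono (Ioo_subset_Icc_self hδ) ⟨hx.1.le, hx.2⟩ hδx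
        linarith
      have hx' : x ∈ Ioo 0 (L / 2) := ⟨hx.1, hxδ.trans hδ.2⟩
      refine sol.exists_le_density hL hω hθ hmono hpos hc2 hm0 hx' ?_ hT
      have i1 : IntervalIntegrable (fun x => max (θ₀ x - c) 0 ^ 2 * cot (π / L * x))
          volume x δ := by
        refine ContinuousOn.intervalIntegrable ?_
        rw [uIcc_of_le hxδ.le]
        exact (hcont x hx.1).mono (Icc_subset_Icc_right hδ.2.le)
      have i2 : IntervalIntegrable (fun x => max (θ₀ x - c) 0 ^ 2 * cot (π / L * x))
          volume δ (L / 2) := by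
        refine ContinuousOn.intervalIntegrable ?_
        rw [uIcc_of_le hδ.2.le]
        exact hcont δ hδ.1
      rw [← intervalIntegral.integral_add_adjacent_intervals i1 i2]
      exact le_add_of_nonneg_left (intervalIntegral.integral_nonneg hxδ.le fun y hy =>
        hnonneg y ⟨hx.1.le.trans hy.1, hy.2.trans hδ.2.le⟩)
  filter_upwards [Ico_mem_nhdsLT ht₀.2] with t ht
  have htI : t ∈ Ico 0 T := ⟨ht₀.1.trans ht.1, ht.2⟩
  have h1 := htime ht₀ htI ht.1
  simp only at h1
  rw [sol.density_zero hL hω hθ htI]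
  linarith

/-- A shock at the origin is incompatible with regularity up to and including the final time. -/
theorem not_isRegularSolution_Icc (hL : 0 < L) (hT : 0 < T) (hjump : θ₀ 0 < θ₀ (L / 2))
    (sol : IsRegularSolution L ω₀ θ₀ (Icc 0 T) ω θ)
    (hshock : ∀ x ∈ Ioc 0 (L / 2), ∀ᶠ t in 𝓝[<] T, (θ₀ (L / 2) - θ₀ 0) / 2 ≤ θ t x - θ t 0) :
    False := by
  have hL2 : 0 < L / 2 := half_pos hL
  have hTI : T ∈ Icc 0 T := ⟨hT.le, le_rfl⟩
  have hcont : ∀ x, Tendsto (fun t => θ t x) (𝓝[<] T) (𝓝 (θ T x)) := by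
    intro x
    have h1 : ContinuousOn (fun t => θ t x) (Icc 0 T) :=
      sol.contDiffOn_density.continuousOn.comp (f := fun t : ℝ => (t, x)) (by fun_prop)
        fun _ ht => ⟨ht, mem_univ _⟩
    refine (h1 T hTI).tendsto.mono_left (nhdsWithin_le_iff.2 ?_)
    exact mem_of_superset (Ico_mem_nhdsLT hT) Ico_subset_Icc_self
  have hx : ∀ x ∈ Ioc 0 (L / 2), (θ₀ (L / 2) - θ₀ 0) / 2 ≤ θ T x - θ T 0 := fun x hx =>
    ge_of_tendsto ((hcont x).sub (hcont 0)) (hshock x hx)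
  have hspace : Continuous fun x => θ T x - θ T 0 := by
    have h1 := sol.contDiffOn_density.continuousOn.comp (f := fun x : ℝ => (T, x)) (s := univ)
      (by fun_prop) fun _ _ => ⟨hTI, mem_univ _⟩
    exact (continuousOn_univ.1 h1).sub continuous_const
  have hlim : Tendsto (fun x => θ T x - θ T 0) (𝓝[>] 0) (𝓝 (θ T 0 - θ T 0)) :=
    (hspace.tendsto 0).mono_left nhdsWithin_le_nhds
  have h1 := ge_of_tendsto hlim (mem_of_superset (Ioc_mem_nhdsGT hL2) hx)
  linarith

end shockTime

end HouLuo

theorem mainTheorem3 (L : ℝ) (hL : 0 < L) (θ₀ : ℝ → ℝ)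
    (hθ_smooth : ContDiff ℝ 2 θ₀)
    (hθ_per : Function.Periodic θ₀ L)
    (hθ_even : ∀ x : ℝ, θ₀ (-x) = θ₀ x)
    (hθ_mono : ∀ x ∈ Set.Icc (0 : ℝ) (L / 2), 0 ≤ deriv θ₀ x)
    (hθ_pos : θ₀ 0 < θ₀ (L / 2)) :
    ∃ T : ℝ, 0 < T ∧
      ∀ ω₀ : ℝ → ℝ, ContDiff ℝ 1 ω₀ → Function.Periodic ω₀ L →
        (∀ x : ℝ, ω₀ (-x) = -ω₀ x) →
        (∀ x ∈ Set.Icc (0 : ℝ) (L / 2), 0 ≤ ω₀ x) →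
        -- there is no global regular solution
        (¬ ∃ ω θ : ℝ → ℝ → ℝ, HouLuo.IsRegularSolution L ω₀ θ₀ (Set.Ici 0) ω θ) ∧
        -- regularity is lost by the time `T`
        (¬ ∃ ω θ : ℝ → ℝ → ℝ, HouLuo.IsRegularSolution L ω₀ θ₀ (Set.Icc 0 T) ω θ) ∧
        -- a solution regular on `[0, T)` forms a shock in the density at `x = 0` by the time `T`
        (∀ ω θ : ℝ → ℝ → ℝ, HouLuo.IsRegularSolution L ω₀ θ₀ (Set.Ico 0 T) ω θ →
          (∀ t ∈ Set.Ico (0 : ℝ) T, θ t 0 = θ₀ 0) ∧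
          ∀ x ∈ Set.Ioc (0 : ℝ) (L / 2), ∀ᶠ t in 𝓝[<] T,
            (θ₀ (L / 2) - θ₀ 0) / 2 ≤ θ t x - θ t 0) := by
  obtain ⟨T, hT, hshock⟩ := HouLuo.exists_shock_time hL hθ_smooth hθ_even hθ_mono hθ_pos
  refine ⟨T, hT, fun ω₀ _ _ hω_odd hω_pos => ?_⟩
  have hno : ¬ ∃ ω θ : ℝ → ℝ → ℝ, HouLuo.IsRegularSolution L ω₀ θ₀ (Set.Icc 0 T) ω θ := by
    rintro ⟨ω, θ, sol⟩
    exact HouLuo.not_isRegularSolution_Icc hL hT hθ_pos sol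
      (hshock ω₀ hω_odd hω_pos ω θ (sol.mono Ico_subset_Icc_self)).2
  refine ⟨?_, hno, fun ω θ sol => hshock ω₀ hω_odd hω_pos ω θ sol⟩
  rintro ⟨ω, θ, sol⟩
  exact hno ⟨ω, θ, sol.mono Icc_subset_Ici_self⟩
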